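/- \textbf{Setting.} A \emph{local language} $L$ is a many-sorted relational language with constants, with, for every single sort $s$, a partially ordered monoid $\mathtt D^s$ of binary relation symbols on $s$ (the \emph{locality relations}), whose identity is the equality symbol of $s$ and is also the least element, and with a function assigning to any two constants $c_1,c_2$ of the same sort a locality relation $\mathtt B_{c_1,c_2}$ on that sort. Its cardinality $|L|$ is the number of its formulas, i.e. $\aleph_0$ plus the number of its symbols. Structures have a non-empty universe on each sort, and $|M|$ is the total number of single elements of $M$. An $L$-structure is \emph{local} if locality relations are symmetric, $d_1\preceq d_2$ implies $d_1^M\subseteq d_2^M$, $d_1^M\circ d_2^M\subseteq(d_1* d_2)^M$, $\mathtt B_{c_1,c_2}(c_1,c_2)$ holds for all constants $c_1,c_2$ of the same sort, and any two elements $a,b$ of the same sort satisfy $d(a,b)$ for some locality relation $d$. The \emph{ball} $d(a)$ is $\{b: d(a,b)\}$. \emph{Positive} formulas are built from atomic ones by $\wedge,\vee,\exists$; \emph{local positive} formulas are built from atomic ones by $\wedge,\vee$ and local quantifiers $\exists x\,(d(x,t)\wedge\cdot)$ with $t$ a term not containing $x$. Negative sentences are the negations of positive sentences. A \emph{negative local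 theory} is a set $T$ of negative sentences containing every negative sentence that holds in all local models of $T$. A \emph{positive embedding} is a homomorphism $f:A\to B$ such that $B\models\varphi(f(a))$ implies $A\models\varphi(a)$ for all positive $\varphi$. A local model $M$ of $T$ is \emph{local positively closed} (pc) if every homomorphism from $M$ to a local model of $T$ is a positive embedding. Local models $A,B$ of $T$ are \emph{compatible} if both map homomorphically to a common local model of $T$; $\mathrm{Com}^{\mathrm{pc}}(M)$ is the class of pc models of $T$ compatible with $M$. A \emph{retractor} of $T$ is a local model $C$ of $T$ such that for every homomorphism $f:C\to N$ to a local model $N$ of $T$ there is a homomorphism $g:N\to C$ with $g\circ f=\mathrm{id}$. A local model $N$ of $T$ is \emph{$\kappa$-ultrahomogeneous} if for any positive embedding $f:A\to N$ and any homomorphism $g:A\to B$ to a local model $B$ of $T$ with $|A|,|B|<\kappa$ there is a homomorphism $h:B\to N$ with $f=h\circ g$. The \emph{local positive logic topology} on a sort of $N$ has as closed sets $\emptyset$ and the sets defined by arbitrary sets of local positive formulas with parameters in $N$. A \emph{bound} $\mathtt B(x)$ of a finite variable $x=(x_i)$ is a conjunction of one formula $d_i(x_i,c_i)$, with $c_i$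 a constant and $d_i$ a locality relation, for each $i$ such that there is a constant on the sort of $x_i$, and one formula $d_{i,j}(x_i,x_j)$ for each pair $(i,j)$ with $x_i,x_j$ on the same sort. A negative local theory $T$ is \emph{local positively compact} if for any local positive formula $\varphi(x,y,z)$, where $x,y$ are distinct single variables on the same sort and $z$ is a finite variable, such that $T\models\neg\exists x,y\,(\exists z\,\varphi(x,y,z)\wedge x=y)$, any bound $\mathtt B(x,z)$ and any locality relation $d$ on the sort of $x$, there is $k\in\mathbb N_{>0}$ with \[T\models\neg\exists x_1,\dots,x_k,z\ \bigwedge_{i\ne j}\mathtt B(x_i,z)\wedge d(x_i,x_j)\wedge\varphi(x_i,x_j,z),\] where $\models$ refers to local models. $L(M)$ is the expansion of $L$ by a constant for each element of $M$, with any bounds, extending those of $L$, for which the natural expansion $M_M$ of $M$ is local; $\mathrm{Th}_-(M/M)$ is the set of negative $L(M)$-sentences true in $M_M$. \textbf{Theorem.} Let $L$ be a local language, $T$ a negative local theory in $L$ and $M$ a local positively closed model of $T$. The following are equivalent: \begin{enumerate} \item[(1)] there is a homomorphism $h:M\to N$ to a local model $N$ of $T$ all of whose balls in single sorts are compact in the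 local positive logic topology (every open cover has a finite subcover); \item[(2)] $T$ has a retractor at $M$, i.e. a retractor compatible with $M$; \item[(3)] $\mathrm{Com}^{\mathrm{pc}}(M)$ is bounded, i.e. there is a cardinal $\kappa$ with $|B|\le\kappa$ for every $B\in\mathrm{Com}^{\mathrm{pc}}(M)$; \item[(4)] $\mathrm{Th}_-(M/M)$ is local positively compact (in $L(M)$); \item[(5)] every $|L(M)|^+$-ultrahomogeneous local positively closed model $N$ of $T$ for which there is a positive embedding $M\to N$ is a retractor of $T$. \end{enumerate} -/

import Mathlib

universe u

namespace LocalPositiveLogic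

/-- The symbols of a local language: a many-sorted relational language with constants together
with a partially ordered monoid of binary relation symbols (the locality relation symbols) on each
single sort. The identity `1` of the monoid plays the role of the equality symbol of the sort.
The relation symbols which are not locality relation symbols are given by `Rel`. -/
structure Lang : Type (u + 1) where
  /-- single sorts -/
  Srt : Type u
  /-- constant symbols of a given single sort -/
  Const : Srt → Type u
  /-- relation symbols whose arguments have the given sorts -/
  Rel : {n : ℕ} → (Fin n → Srt) → Type u
  /-- locality relation symbols on a given single sort -/
  Loc : Srt → Type u
  [locMonoid : ∀ s, Monoid (Loc s)]
  [locOrder : ∀ s, PartialOrder (Loc s)]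
  loc_mul_le_mul : ∀ {s} {d₁ d₂ e₁ e₂ : Loc s}, d₁ ≤ d₂ → e₁ ≤ e₂ → d₁ * e₁ ≤ d₂ * e₂
  loc_one_le : ∀ {s} (d : Loc s), 1 ≤ d

attribute [instance] Lang.locMonoid Lang.locOrder

/-- A local language: symbols together with a bound function, which assigns a locality relation
symbol to any two constant symbols of the same sort. -/
structure LocalLang : Type (u + 1) extends Lang.{u} where
  bound : {s : Srt} → Const s → Const s → Loc s

/-- The cardinality of a language (its number of formulas): `ℵ₀` plus the number of symbols. -/
noncomputable def Lang.card (L : Lang.{u}) : Cardinal.{u} :=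
  Cardinal.aleph0 + Cardinal.mk L.Srt + Cardinal.mk (Σ s, L.Const s)
    + Cardinal.mk (Σ n : ℕ, Σ ar : Fin n → L.Srt, L.Rel ar) + Cardinal.mk (Σ s, L.Loc s)

/-! ### Syntax

The variables of a formula are indexed by `Fin n`, and the variable `i` has sort `Γ i`. -/

/-- Add a new variable of sort `s`, with index `0`. -/
abbrev Lang.ext (L : Lang.{u}) (s : L.Srt) {n : ℕ} (Γ : Fin n → L.Srt) : Fin (n + 1) → L.Srt :=
  Fin.cons s Γ

/-- Terms (variables and constants), by sort. -/
inductive Term (L : Lang.{u}) {n : ℕ} (Γ : Fin n → L.Srt) : L.Srt → Type u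
  | var (i : Fin n) : Term L Γ (Γ i)
  | const {s : L.Srt} (c : L.Const s) : Term L Γ s

/-- A term regarded as a term in which the new variable `0` does not appear. -/
def Term.weaken {L : Lang.{u}} {n : ℕ} {Γ : Fin n → L.Srt} (s : L.Srt) {r : L.Srt} :
    Term L Γ r → Term L (L.ext s Γ) r
  | .var i => .var (Γ := L.ext s Γ) i.succ
  | .const c => .const c

/-- First-order formulas. The equality `t = t'` is `loc 1 t t'`. -/
inductive Formula (L : Lang.{u}) : {n : ℕ} → (Fin n → L.Srt) → Type u
  | rel {n : ℕ} {Γ : Fin n → L.Srt} {m : ℕ} {ar : Fin m → L.Srt} (R : L.Rel ar)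
      (t : ∀ i, Term L Γ (ar i)) : Formula L Γ
  | loc {n : ℕ} {Γ : Fin n → L.Srt} {s : L.Srt} (d : L.Loc s) (t t' : Term L Γ s) : Formula L Γ
  | neg {n : ℕ} {Γ : Fin n → L.Srt} (φ : Formula L Γ) : Formula L Γ
  | and {n : ℕ} {Γ : Fin n → L.Srt} (φ ψ : Formula L Γ) : Formula L Γ
  | or {n : ℕ} {Γ : Fin n → L.Srt} (φ ψ : Formula L Γ) : Formula L Γ
  | ex {n : ℕ} {Γ : Fin n → L.Srt} (s : L.Srt) (φ : Formula L (L.ext s Γ)) : Formula L Γ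

/-- Sentences: formulas without free variables. -/
abbrev Sentence (L : Lang.{u}) : Type u := Formula L (Fin.elim0 : Fin 0 → L.Srt)

/-- Positive formulas: built from atomic formulas with conjunctions, disjunctions and existential
quantifiers. -/
inductive Formula.IsPositive {L : Lang.{u}} :
    {n : ℕ} → {Γ : Fin n → L.Srt} → Formula L Γ → Prop
  | rel {n : ℕ} {Γ : Fin n → L.Srt} {m : ℕ} {ar : Fin m → L.Srt} (R : L.Rel ar)
      (t : ∀ i, Term L Γ (ar i)) : IsPositive (.rel R t)
  | loc {n : ℕ} {Γ : Fin n → L.Srt} {s : L.Srt} (d : L.Loc s) (t t' : Term L Γ s) :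
      IsPositive (.loc d t t')
  | and {n : ℕ} {Γ : Fin n → L.Srt} {φ ψ : Formula L Γ} :
      IsPositive φ → IsPositive ψ → IsPositive (.and φ ψ)
  | or {n : ℕ} {Γ : Fin n → L.Srt} {φ ψ : Formula L Γ} :
      IsPositive φ → IsPositive ψ → IsPositive (.or φ ψ)
  | ex {n : ℕ} {Γ : Fin n → L.Srt} (s : L.Srt) {φ : Formula L (L.ext s Γ)} :
      IsPositive φ → IsPositive (.ex s φ)

/-- The local existential quantification `∃ x ∈ d(t), φ`, that is, `∃ x, d(x, t) ∧ φ`, where the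
new variable `x` does not appear in the term `t`. -/
def Formula.locEx {L : Lang.{u}} {n : ℕ} {Γ : Fin n → L.Srt} {s : L.Srt} (d : L.Loc s)
    (t : Term L Γ s) (φ : Formula L (L.ext s Γ)) : Formula L Γ :=
  .ex s (.and (.loc d (.var (Γ := L.ext s Γ) 0) (t.weaken s)) φ)

/-- Local positive formulas: built from atomic formulas with conjunctions, disjunctions and local
existential quantification. -/
inductive Formula.IsLocalPositive {L : Lang.{u}} :
    {n : ℕ} → {Γ : Fin n → L.Srt} → Formula L Γ → Prop
  | rel {n : ℕ} {Γ : Fin n → L.Srt} {m : ℕ} {ar : Fin m → L.Srt} (R : L.Rel ar)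
      (t : ∀ i, Term L Γ (ar i)) : IsLocalPositive (.rel R t)
  | loc {n : ℕ} {Γ : Fin n → L.Srt} {s : L.Srt} (d : L.Loc s) (t t' : Term L Γ s) :
      IsLocalPositive (.loc d t t')
  | and {n : ℕ} {Γ : Fin n → L.Srt} {φ ψ : Formula L Γ} :
      IsLocalPositive φ → IsLocalPositive ψ → IsLocalPositive (.and φ ψ)
  | or {n : ℕ} {Γ : Fin n → L.Srt} {φ ψ : Formula L Γ} :
      IsLocalPositive φ → IsLocalPositive ψ → IsLocalPositive (.or φ ψ)
  | locEx {n : ℕ} {Γ : Fin n → L.Srt} {s : L.Srt} (d : L.Loc s) (t : Term L Γ s)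
      {φ : Formula L (L.ext s Γ)} : IsLocalPositive φ → IsLocalPositive (φ.locEx d t)

/-- Negative sentences: negations of positive sentences. -/
def Sentence.IsNegative {L : Lang.{u}} (σ : Sentence L) : Prop :=
  ∃ φ : Sentence L, Formula.IsPositive φ ∧ σ = Formula.neg φ

/-! ### Structures -/

/-- A structure, with a nonempty universe on every single sort. The equality symbols are
interpreted as equality. -/
structure Structure (L : Lang.{u}) : Type (u + 1) where
  carrier : L.Srt → Type u
  nonempty : ∀ s, Nonempty (carrier s)
  const : ∀ {s}, L.Const s → carrier s
  rel : ∀ {n : ℕ} {ar : Fin n → L.Srt}, L.Rel ar → (∀ i, carrier (ar i)) → Prop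
  loc : ∀ {s}, L.Loc s → carrier s → carrier s → Prop
  loc_one : ∀ {s} (a b : carrier s), loc 1 a b ↔ a = b

/-- The cardinality of a structure: the total number of its single elements. -/
noncomputable def Structure.card {L : Lang.{u}} (M : Structure L) : Cardinal.{u} :=
  Cardinal.mk (Σ s, M.carrier s)

/-- Extend an assignment by a value for the new variable `0`. -/
def Structure.extVal {L : Lang.{u}} (M : Structure L) {s : L.Srt} {n : ℕ} {Γ : Fin n → L.Srt}
    (a : M.carrier s) (v : ∀ i, M.carrier (Γ i)) : ∀ i, M.carrier (L.ext s Γ i) :=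
  Fin.cons (α := fun i => M.carrier (L.ext s Γ i)) a v

/-- The value of a term. -/
def Term.value {L : Lang.{u}} (M : Structure L) {n : ℕ} {Γ : Fin n → L.Srt}
    (v : ∀ i, M.carrier (Γ i)) {s : L.Srt} : Term L Γ s → M.carrier s
  | .var i => v i
  | .const c => M.const c

/-- Satisfaction of a formula in `M` under an assignment `v` of its variables. -/
def Formula.Realize {L : Lang.{u}} (M : Structure L) :
    {n : ℕ} → {Γ : Fin n → L.Srt} → Formula L Γ → (∀ i, M.carrier (Γ i)) → Prop
  | _, _, .rel R t, v => M.rel R fun i => (t i).value M v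
  | _, _, .loc d t t', v => M.loc d (t.value M v) (t'.value M v)
  | _, _, .neg φ, v => ¬ φ.Realize M v
  | _, _, .and φ ψ, v => φ.Realize M v ∧ ψ.Realize M v
  | _, _, .or φ ψ, v => φ.Realize M v ∨ ψ.Realize M v
  | _, _, .ex s φ, v => ∃ a : M.carrier s, φ.Realize M (M.extVal a v)

/-- Satisfaction of a sentence. -/
def Structure.Satisfies {L : Lang.{u}} (M : Structure L) (σ : Sentence L) : Prop :=
  σ.Realize M fun i => i.elim0

/-- Local structures: the structures satisfying the locality axioms. -/
structure Structure.IsLocal (L : LocalLang.{u}) (M : Structure L.toLang) : Prop where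
  symm : ∀ {s} (d : L.Loc s) (a b : M.carrier s), M.loc d a b → M.loc d b a
  mono : ∀ {s} (d₁ d₂ : L.Loc s), d₁ ≤ d₂ → ∀ a b : M.carrier s, M.loc d₁ a b → M.loc d₂ a b
  comp : ∀ {s} (d₁ d₂ : L.Loc s) (a b c : M.carrier s),
    M.loc d₁ a b → M.loc d₂ b c → M.loc (d₁ * d₂) a c
  bound : ∀ {s} (c₁ c₂ : L.Const s), M.loc (L.bound c₁ c₂) (M.const c₁) (M.const c₂)
  local_ : ∀ {s} (a b : M.carrier s), ∃ d : L.Loc s, M.loc d a b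

/-- The ball `d(a)`. -/
def Structure.ball {L : Lang.{u}} (M : Structure L) {s : L.Srt} (d : L.Loc s)
    (a : M.carrier s) : Set (M.carrier s) :=
  {b | M.loc d a b}

/-- Homomorphisms. -/
structure Hom {L : Lang.{u}} (M N : Structure L) : Type u where
  toFun : ∀ s, M.carrier s → N.carrier s
  map_const : ∀ {s} (c : L.Const s), toFun s (M.const c) = N.const c
  map_rel : ∀ {n : ℕ} {ar : Fin n → L.Srt} (R : L.Rel ar) (a : ∀ i, M.carrier (ar i)),
    M.rel R a → N.rel R fun i => toFun (ar i) (a i)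
  map_loc : ∀ {s} (d : L.Loc s) (a b : M.carrier s),
    M.loc d a b → N.loc d (toFun s a) (toFun s b)

/-- Positive embeddings: homomorphisms which reflect satisfaction of positive formulas. -/
def Hom.IsPositiveEmbedding {L : Lang.{u}} {M N : Structure L} (f : Hom M N) : Prop :=
  ∀ {n : ℕ} {Γ : Fin n → L.Srt} (φ : Formula L Γ), φ.IsPositive →
    ∀ a : ∀ i, M.carrier (Γ i), φ.Realize N (fun i => f.toFun (Γ i) (a i)) → φ.Realize M a

/-! ### Negative local theories -/

/-- Negative local theories: sets of negative sentences closed under local implication. -/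
structure NegTheory (L : LocalLang.{u}) : Type u where
  sentences : Set (Sentence L.toLang)
  isNegative : ∀ σ ∈ sentences, σ.IsNegative
  closed : ∀ σ : Sentence L.toLang, σ.IsNegative →
    (∀ N : Structure L.toLang, N.IsLocal L → (∀ τ ∈ sentences, N.Satisfies τ) → N.Satisfies σ) →
      σ ∈ sentences

namespace NegTheory

variable {L : LocalLang.{u}}

/-- `M` is a local model of `T`. -/
def IsModel (T : NegTheory L) (M : Structure L.toLang) : Prop :=
  M.IsLocal L ∧ ∀ σ ∈ T.sentences, M.Satisfies σ

/-- `M` is a local positively closed model of `T`. -/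
def IsPCModel (T : NegTheory L) (M : Structure L.toLang) : Prop :=
  T.IsModel M ∧ ∀ N : Structure L.toLang, T.IsModel N → ∀ f : Hom M N, f.IsPositiveEmbedding

/-- `M` is a local positively `κ`-ultrahomogeneous model of `T`. -/
def IsUltrahomogeneous (T : NegTheory L) (κ : Cardinal.{u}) (M : Structure L.toLang) : Prop :=
  T.IsModel M ∧ ∀ A B : Structure L.toLang, T.IsModel B → A.card < κ → B.card < κ →
    ∀ (f : Hom A M) (g : Hom A B), f.IsPositiveEmbedding →
      ∃ h : Hom B M, ∀ s (a : A.carrier s), f.toFun s a = h.toFun s (g.toFun s a)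

/-- `C` is a retractor of `T`: every homomorphism from `C` to a local model of `T` has a
retraction. -/
def IsRetractor (T : NegTheory L) (C : Structure L.toLang) : Prop :=
  T.IsModel C ∧ ∀ N : Structure L.toLang, T.IsModel N → ∀ f : Hom C N,
    ∃ g : Hom N C, ∀ s (a : C.carrier s), g.toFun s (f.toFun s a) = a

/-- `A` and `B` are compatible in `T`: they map homomorphically to a common local model. -/
def Compatible (T : NegTheory L) (A B : Structure L.toLang) : Prop :=
  ∃ N : Structure L.toLang, T.IsModel N ∧ Nonempty (Hom A N) ∧ Nonempty (Hom B N)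

/-- The class of local positively closed models of `T` compatible with `M`. -/
def ComPC (T : NegTheory L) (M : Structure L.toLang) : Set (Structure L.toLang) :=
  {B | T.IsPCModel B ∧ T.Compatible M B}

/-- A class of structures is bounded if there is a cardinal bounding the cardinalities of all its
elements. -/
def IsBoundedClass (K : Set (Structure L.toLang)) : Prop :=
  ∃ κ : Cardinal.{u}, ∀ B ∈ K, B.card ≤ κ

end NegTheory

/-- The negative theory of a local structure. -/
def Structure.negTheory {L : LocalLang.{u}} (M : Structure L.toLang) (hM : M.IsLocal L) :
    NegTheory L where
  sentences := {σ | σ.IsNegative ∧ M.Satisfies σ}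
  isNegative := fun _ h => h.1
  closed := fun _ hσ h => ⟨hσ, h M hM fun _ hτ => hτ.2⟩

/-! ### Local positive compactness -/

/-- A bound of the variable whose single variables have the sorts `Γ i`: a locality condition
`d(xᵢ, c)` to some constant `c` for each `xᵢ` on a sort with constants, and a locality condition
`d(xᵢ, xⱼ)` for each `xᵢ` and `xⱼ` on the same sort. -/
structure Bound (L : Lang.{u}) {n : ℕ} (Γ : Fin n → L.Srt) : Type u where
  base : ∀ i, Nonempty (L.Const (Γ i)) → L.Const (Γ i) × L.Loc (Γ i)
  pair : ∀ i j, Γ i = Γ j → L.Loc (Γ i)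

/-- Satisfaction of a bound. -/
def Bound.Realize {L : Lang.{u}} (M : Structure L) {n : ℕ} {Γ : Fin n → L.Srt} (B : Bound L Γ)
    (v : ∀ i, M.carrier (Γ i)) : Prop :=
  (∀ i (h : Nonempty (L.Const (Γ i))), M.loc (B.base i h).2 (v i) (M.const (B.base i h).1)) ∧
    ∀ i j (h : Γ i = Γ j), M.loc (B.pair i j h) (v i) (cast (congrArg M.carrier h.symm) (v j))

/-- Local positive compactness of `T`. Here `φ(x, y, z)` is a local positive formula with `x` and
`y` single variables on the same sort `s` and `z` a finite variable; the hypothesis on `φ` says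
that `∃ z, φ(x, y, z)` and `x = y` deny each other in `T`; and the conclusion says that the
negation of `∃ x₁ … x_k z, ⋀_{i ≠ j} B(xᵢ, z) ∧ d(xᵢ, xⱼ) ∧ φ(xᵢ, xⱼ, z)` holds in every local
model of `T`. -/
def NegTheory.IsLocallyPositivelyCompact {L : LocalLang.{u}} (T : NegTheory L) : Prop :=
  ∀ (s : L.Srt) (n : ℕ) (Γ : Fin n → L.Srt) (φ : Formula L.toLang (L.ext s (L.ext s Γ))),
    φ.IsLocalPositive →
    (∀ N : Structure L.toLang, T.IsModel N → ∀ x y : N.carrier s,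
      ¬ ((∃ z : ∀ i, N.carrier (Γ i), φ.Realize N (N.extVal x (N.extVal y z))) ∧ x = y)) →
    ∀ (B : Bound L.toLang (L.ext s Γ)) (d : L.Loc s), ∃ k : ℕ, 0 < k ∧
      ∀ N : Structure L.toLang, T.IsModel N →
        ¬ ∃ (x : Fin k → N.carrier s) (z : ∀ i, N.carrier (Γ i)), ∀ i j, i ≠ j →
          B.Realize N (N.extVal (x i) z) ∧ N.loc d (x i) (x j) ∧
            φ.Realize N (N.extVal (x i) (N.extVal (x j) z))

/-! ### Parameters -/

/-- The expansion of a language by new constant symbols. -/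
def Lang.withConstants (L : Lang.{u}) (A : L.Srt → Type u) : Lang.{u} where
  Srt := L.Srt
  Const := fun s => L.Const s ⊕ A s
  Rel := L.Rel
  Loc := L.Loc
  loc_mul_le_mul := L.loc_mul_le_mul
  loc_one_le := L.loc_one_le

/-- The symbols of the language `L(M)`: a new constant symbol for each element of `M`. -/
abbrev Lang.withElements (L : Lang.{u}) (M : Structure L) : Lang.{u} :=
  L.withConstants M.carrier

/-- The expansion `M_M` of `M` in which each new constant symbol names its own element. -/
def Structure.withElements {L : Lang.{u}} (M : Structure L) : Structure (L.withElements M) where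
  carrier := M.carrier
  nonempty := M.nonempty
  const := fun {_} c => Sum.elim M.const id c
  rel := M.rel
  loc := M.loc
  loc_one := M.loc_one

/-- A bound function for `L(M)`: it extends the bound function of `L` and its bounds are
satisfied in `M`. -/
structure ElementBounds (L : LocalLang.{u}) (M : Structure L.toLang) : Type u where
  bound : {s : L.Srt} → L.Const s ⊕ M.carrier s → L.Const s ⊕ M.carrier s → L.Loc s
  bound_const : ∀ {s : L.Srt} (c₁ c₂ : L.Const s), bound (.inl c₁) (.inl c₂) = L.bound c₁ c₂
  holds : ∀ {s : L.Srt} (c₁ c₂ : L.Const s ⊕ M.carrier s),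
    M.loc (bound c₁ c₂) (Sum.elim M.const id c₁) (Sum.elim M.const id c₂)

/-- Every local structure admits such a bound function. -/
theorem ElementBounds.exists_of_isLocal {L : LocalLang.{u}} {M : Structure L.toLang}
    (hM : M.IsLocal L) : Nonempty (ElementBounds L M) := by
  classical
  have key : ∀ {s : L.Srt} (c₁ c₂ : L.Const s ⊕ M.carrier s), ∃ d : L.Loc s,
      M.loc d (Sum.elim M.const id c₁) (Sum.elim M.const id c₂) ∧
        ∀ e₁ e₂, c₁ = .inl e₁ → c₂ = .inl e₂ → d = L.bound e₁ e₂ := by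
    rintro s (c₁ | a) (c₂ | b)
    · exact ⟨_, hM.bound c₁ c₂, by rintro _ _ ⟨⟩ ⟨⟩; rfl⟩
    all_goals
      obtain ⟨d, hd⟩ := hM.local_ (Sum.elim M.const id _) (Sum.elim M.const id _)
      exact ⟨d, hd, by simp⟩
  choose f hf hf' using @key
  exact ⟨⟨fun c₁ c₂ => f c₁ c₂, fun c₁ c₂ => hf' _ _ c₁ c₂ rfl rfl, fun c₁ c₂ => hf c₁ c₂⟩⟩

/-- The local language `L(M)` with a given bound function. -/
def LocalLang.withElements (L : LocalLang.{u}) (M : Structure L.toLang) (β : ElementBounds L M) :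
    LocalLang.{u} where
  toLang := L.toLang.withElements M
  bound := fun {_} c₁ c₂ => β.bound c₁ c₂

theorem Structure.IsLocal.withElements {L : LocalLang.{u}} {M : Structure L.toLang}
    (hM : M.IsLocal L) (β : ElementBounds L M) :
    Structure.IsLocal (L.withElements M β) M.withElements where
  symm := hM.symm
  mono := hM.mono
  comp := hM.comp
  bound := fun c₁ c₂ => β.holds c₁ c₂
  local_ := hM.local_

/-! ### The local positive logic topology -/

/-- The set of elements of `M` of sort `s` satisfying all the formulas of `S`, which have
parameters in `M`. -/
def Structure.definedBy {L : Lang.{u}} (M : Structure L) (s : L.Srt)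
    (S : Set (Formula (L.withElements M) (fun _ : Fin 1 => s))) : Set (M.carrier s) :=
  {a | ∀ φ ∈ S, φ.Realize M.withElements fun _ => a}

/-- The local positive logic topology on the sort `s` of `M`: the closed sets are the empty set and
the sets defined by a set of local positive formulas with parameters in `M`. -/
@[reducible]
def Structure.logicTopology {L : Lang.{u}} (M : Structure L) (s : L.Srt) :
    TopologicalSpace (M.carrier s) :=
  TopologicalSpace.ofClosed
    {D | D = ∅ ∨ ∃ S : Set (Formula (L.withElements M) (fun _ : Fin 1 => s)),
      (∀ φ ∈ S, φ.IsLocalPositive) ∧ D = M.definedBy s S}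
    (Or.inl rfl)
    (by
      intro A hA
      by_cases h : ∅ ∈ A
      · exact Or.inl (Set.subset_eq_empty (Set.sInter_subset_of_mem h) rfl)
      · refine Or.inr ⟨{φ | φ.IsLocalPositive ∧
          ∃ D ∈ A, ∀ a ∈ D, φ.Realize M.withElements fun _ => a}, fun φ hφ => hφ.1, ?_⟩
        ext a
        constructor
        · rintro ha φ ⟨-, D, hD, hφ⟩
          exact hφ a (ha D hD)
        · intro ha D hD
          rcases hA hD with h0 | ⟨S, hS, rfl⟩
          · exact absurd (h0 ▸ hD) h
          · intro φ hφ
            exact ha φ ⟨hS φ hφ, _, hD, fun b hb => hb φ hφ⟩)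
    (by
      rintro D (rfl | ⟨S, hS, rfl⟩) E (rfl | ⟨S', hS', rfl⟩)
      · exact Or.inl (by simp)
      · exact Or.inr ⟨S', hS', by simp⟩
      · exact Or.inr ⟨S, hS, by simp⟩
      · refine Or.inr ⟨{χ | ∃ φ ∈ S, ∃ ψ ∈ S', χ = .or φ ψ}, ?_, ?_⟩
        · rintro _ ⟨φ, hφ, ψ, hψ, rfl⟩
          exact .or (hS φ hφ) (hS' ψ hψ)
        · ext a
          constructor
          · rintro (ha | ha) _ ⟨φ, hφ, ψ, hψ, rfl⟩
            · exact Or.inl (ha φ hφ)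
            · exact Or.inr (ha ψ hψ)
          · intro ha
            by_contra hn
            simp only [Set.mem_union, not_or, Structure.definedBy, Set.mem_ofPred_eq,
              not_forall] at hn
            obtain ⟨⟨φ, hφ, h1⟩, ψ, hψ, h2⟩ := hn
            rcases ha _ ⟨φ, hφ, ψ, hψ, rfl⟩ with h | h
            exacts [h1 h, h2 h])

/-- All balls of `M` in single sorts are compact in the local positive logic topology. -/
def Structure.HasCompactBalls {L : Lang.{u}} (M : Structure L) : Prop :=
  ∀ (s : L.Srt) (d : L.Loc s) (a : M.carrier s),
    @IsCompact (M.carrier s) (M.logicTopology s) (M.ball d a)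

end LocalPositiveLogic

namespace LocalPositiveLogic

/-! ### Assignments and homomorphisms -/

section Basics

variable {L : Lang.{u}}

/-! The conditions are linked in the cycle (1) → (3) → (4) → (5) → (2) → (1). As `M` is positively
closed, all homomorphisms from `M` to models are positive embeddings.

(1) → (3): if `M` maps to `N` with compact balls, every local structure `P` in which `M` embeds
positively maps to `N` (`exists_hom_of_hasCompactBalls`). A partial map is extended one element at a
time. The possible values of a new element lie in a ball and satisfy closed conditions with the
finite intersection property. Any `B` compatible with `M` thus maps to `N`, injectively since `B` is
positively closed.

(3) → (4): if a formula denying equality violates compactness, it has arbitrarily long finite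
separated families. They can be moved into `M`, because finitely many bounded conditions form one
negative sentence or its failure. A local ultrapower of `M` then has a separated family of any
prescribed size. It stays separated in a positively closed model above, which contradicts a cardinal
bound (`isLocallyPositivelyCompact_of_isBoundedClass`).

(4) → (5): let `N` be ultrahomogeneous above `M`, let `f : N → P` with `P` positively closed, and
let `c` be in `P`. For each formula denying equality, compactness gives a maximal list in a ball of
`N` that is separated and whose images are separated from `c`. There are at most `|L(M)|` formulas,
so ultrahomogeneity copies `c` into `N` over all these lists. If the copy did not map to `c`, some
formula denying equality would separate them (`exists_denying_formula`), and the copy would prolong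
a maximal list. So `f` is onto (`surjective_of_isUltrahomogeneous`), hence invertible, and
retractions follow.

(5) → (2): ultrahomogeneous positively closed models exist above every model
(`exists_pc_ultrahomogeneous`), by a transfinite iteration that alternately saturates local positive
facts and amalgamates. (2) → (1): an ultrafilter on a ball of a retractor defines a point of a local
ultrapower, and its image under the retraction is a limit.

The basic tool is the local ultraproduct, restricted to families at bounded distance from a base
structure. Positive truth in it passes to almost all factors, and local positive truth comes back.
Thus finitely satisfiable bounded sets of local positive facts are realized (`exists_realization`),
and models amalgamate (`exists_amalgam`). -/

theorem Structure.extVal_map {M N : Structure L} (f : ∀ s, M.carrier s → N.carrier s) {s : L.Srt}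
    {n : ℕ} {Γ : Fin n → L.Srt} (a : M.carrier s) (v : ∀ i, M.carrier (Γ i)) :
    (fun i => f (L.ext s Γ i) (M.extVal a v i)) = N.extVal (f s a) (fun i => f (Γ i) (v i)) := by
  funext i
  refine Fin.cases ?_ (fun i => ?_) i <;> rfl

theorem Term.value_weaken (M : Structure L) {n : ℕ} {Γ : Fin n → L.Srt} {s r : L.Srt}
    (t : Term L Γ r) (a : M.carrier s) (v : ∀ i, M.carrier (Γ i)) :
    (t.weaken s).value M (M.extVal a v) = t.value M v := by
  cases t <;> rfl

theorem Formula.realize_locEx (M : Structure L) {n : ℕ} {Γ : Fin n → L.Srt} {s : L.Srt}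
    (d : L.Loc s) (t : Term L Γ s) (φ : Formula L (L.ext s Γ)) (v : ∀ i, M.carrier (Γ i)) :
    (φ.locEx d t).Realize M v ↔
      ∃ a : M.carrier s, M.loc d a (t.value M v) ∧ φ.Realize M (M.extVal a v) := by
  constructor
  · rintro ⟨a, h1, h2⟩
    refine ⟨a, ?_, h2⟩
    have h1 : M.loc d (M.extVal a v 0) ((t.weaken s).value M (M.extVal a v)) := h1
    rwa [Term.value_weaken] at h1
  · rintro ⟨a, h1, h2⟩
    refine ⟨a, ?_, h2⟩
    change M.loc d (M.extVal a v 0) ((t.weaken s).value M (M.extVal a v))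
    rwa [Term.value_weaken]

theorem Formula.IsLocalPositive.isPositive {n : ℕ} {Γ : Fin n → L.Srt} {φ : Formula L Γ}
    (h : φ.IsLocalPositive) : φ.IsPositive := by
  induction h with
  | rel R t => exact .rel R t
  | loc d t t' => exact .loc d t t'
  | and _ _ h1 h2 => exact .and h1 h2
  | or _ _ h1 h2 => exact .or h1 h2
  | locEx d t _ h => exact .ex _ (.and (.loc _ _ _) h)

theorem Hom.value {M N : Structure L} (f : Hom M N) {n : ℕ} {Γ : Fin n → L.Srt} {s : L.Srt}
    (t : Term L Γ s) (v : ∀ i, M.carrier (Γ i)) :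
    t.value N (fun i => f.toFun (Γ i) (v i)) = f.toFun s (t.value M v) := by
  cases t with
  | var i => rfl
  | const c => exact (f.map_const c).symm

theorem Hom.realize {M N : Structure L} (f : Hom M N) {n : ℕ} {Γ : Fin n → L.Srt}
    {φ : Formula L Γ} (hφ : φ.IsPositive) (v : ∀ i, M.carrier (Γ i)) (h : φ.Realize M v) :
    φ.Realize N (fun i => f.toFun (Γ i) (v i)) := by
  induction hφ with
  | rel R t =>
    have := f.map_rel R _ h
    simpa only [Formula.Realize, f.value] using this
  | loc d t t' =>
    have := f.map_loc d _ _ h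
    simpa only [Formula.Realize, f.value] using this
  | and _ _ h1 h2 => exact ⟨h1 v h.1, h2 v h.2⟩
  | or _ _ h1 h2 => exact h.imp (h1 v) (h2 v)
  | ex s _ ih =>
    obtain ⟨a, ha⟩ := h
    refine ⟨f.toFun s a, ?_⟩
    have := ih _ ha
    rwa [Structure.extVal_map] at this

/-- The identity homomorphism. -/
def Hom.id (M : Structure L) : Hom M M where
  toFun := fun _ a => a
  map_const := fun _ => rfl
  map_rel := fun _ _ h => h
  map_loc := fun _ _ _ h => h

/-- Composition of homomorphisms. -/
def Hom.comp {M N P : Structure L} (g : Hom N P) (f : Hom M N) : Hom M P where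
  toFun := fun s a => g.toFun s (f.toFun s a)
  map_const := fun c => by rw [f.map_const, g.map_const]
  map_rel := fun R a h => g.map_rel R _ (f.map_rel R a h)
  map_loc := fun d a b h => g.map_loc d _ _ (f.map_loc d a b h)

@[ext] theorem Hom.ext {M N : Structure L} {f g : Hom M N}
    (h : ∀ s a, f.toFun s a = g.toFun s a) : f = g := by
  cases f; cases g
  congr
  funext s a
  exact h s a

theorem Hom.IsPositiveEmbedding.loc_iff {M N : Structure L} {f : Hom M N}
    (hf : f.IsPositiveEmbedding) {s : L.Srt} (d : L.Loc s) (a b : M.carrier s) :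
    N.loc d (f.toFun s a) (f.toFun s b) ↔ M.loc d a b := by
  refine ⟨fun h => ?_, f.map_loc d a b⟩
  have := hf (Γ := L.ext s (L.ext s Fin.elim0))
    (.loc d (.var (Γ := L.ext s (L.ext s Fin.elim0)) 0)
      (.var (Γ := L.ext s (L.ext s Fin.elim0)) (Fin.succ 0)))
    (.loc _ _ _) (M.extVal a (M.extVal b fun i => i.elim0))
  exact this h

theorem Hom.IsPositiveEmbedding.injective {M N : Structure L} {f : Hom M N}
    (hf : f.IsPositiveEmbedding) (s : L.Srt) : Function.Injective (f.toFun s) := by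
  intro a b h
  rw [← M.loc_one, ← hf.loc_iff, N.loc_one, h]

theorem Hom.IsPositiveEmbedding.rel_iff {M N : Structure L} {f : Hom M N}
    (hf : f.IsPositiveEmbedding) {n : ℕ} {ar : Fin n → L.Srt} (R : L.Rel ar)
    (a : ∀ i, M.carrier (ar i)) :
    N.rel R (fun i => f.toFun (ar i) (a i)) ↔ M.rel R a :=
  ⟨fun h => hf (.rel R fun i => .var i) (.rel _ _) a h, f.map_rel R a⟩

theorem Hom.IsPositiveEmbedding.card_le {M N : Structure L} {f : Hom M N}
    (hf : f.IsPositiveEmbedding) : M.card ≤ N.card :=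
  Cardinal.mk_le_of_injective (f := fun x : Σ s, M.carrier s => ⟨x.1, f.toFun x.1 x.2⟩) <| by
    rintro ⟨s, a⟩ ⟨r, b⟩ h
    obtain ⟨rfl, h⟩ := Sigma.mk.inj_iff.1 h
    exact congrArg _ (hf.injective s (eq_of_heq h))

/-- Positive truth in the middle structure moves on along `g` and is reflected from there. -/
theorem Hom.IsPositiveEmbedding.of_comp {M N P : Structure L} {f : Hom M N} {g : Hom N P}
    (h : (g.comp f).IsPositiveEmbedding) : f.IsPositiveEmbedding :=
  fun φ hφ a ha => h φ hφ a (g.realize hφ _ ha)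

/-- A surjective positive embedding has an inverse. -/
theorem Hom.IsPositiveEmbedding.exists_inverse {M N : Structure L} {f : Hom M N}
    (hf : f.IsPositiveEmbedding) (hs : ∀ s, Function.Surjective (f.toFun s)) :
    ∃ g : Hom N M, ∀ s a, g.toFun s (f.toFun s a) = a := by
  choose g hg using fun s => (hs s)
  refine ⟨⟨g, fun c => hf.injective _ ?_, fun R a h => ?_, fun d a b h => ?_⟩,
    fun s a => hf.injective _ (hg _ _)⟩
  · rw [hg, f.map_const]
  · rw [← hf.rel_iff]; simpa only [hg] using h
  · rw [← hf.loc_iff]; simpa only [hg] using h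

theorem Structure.satisfies_neg_of_hom {M N : Structure L} (f : Hom M N) {σ : Sentence L}
    (hσ : σ.IsNegative) (h : N.Satisfies σ) : M.Satisfies σ := by
  obtain ⟨φ, hφ, rfl⟩ := hσ
  intro hM
  refine h ?_
  have := f.realize hφ _ hM
  convert this using 2

end Basics

/-! ### Expansions by constants -/

section Expand

variable {L : Lang.{u}}

/-- The expansion of a structure by new constants, interpreted by `e`. -/
def Structure.expand (N : Structure L) {A : L.Srt → Type u} (e : ∀ s, A s → N.carrier s) :
    Structure (L.withConstants A) where
  carrier := N.carrier
  nonempty := N.nonempty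
  const := fun {s} c => Sum.elim N.const (e s) c
  rel := N.rel
  loc := N.loc
  loc_one := N.loc_one

/-- A homomorphism which respects the new constants. -/
def Hom.expand {N N' : Structure L} (f : Hom N N') {A : L.Srt → Type u}
    (e : ∀ s, A s → N.carrier s) (e' : ∀ s, A s → N'.carrier s)
    (h : ∀ s a, f.toFun s (e s a) = e' s a) : Hom (N.expand e) (N'.expand e') where
  toFun := f.toFun
  map_const := fun {s} c => by
    rcases c with c | a
    · exact f.map_const c
    · exact h s a
  map_rel := f.map_rel
  map_loc := f.map_loc

end Expand

/-! ### Renaming -/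

section Rename

variable {L : Lang.{u}}

/-- Substitution of terms for variables in a term. -/
def Term.subst {n m : ℕ} {Γ : Fin n → L.Srt} {Γ' : Fin m → L.Srt} (σ : ∀ i, Term L Γ' (Γ i))
    {s : L.Srt} : Term L Γ s → Term L Γ' s
  | .var i => σ i
  | .const c => .const c

theorem Term.value_subst (N : Structure L) {n m : ℕ} {Γ : Fin n → L.Srt} {Γ' : Fin m → L.Srt}
    (σ : ∀ i, Term L Γ' (Γ i)) {s : L.Srt} (t : Term L Γ s) (v : ∀ i, N.carrier (Γ' i)) :
    (t.subst σ).value N v = t.value N (fun i => (σ i).value N v) := by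
  cases t <;> rfl

/-- The extension of a substitution by the new variable. -/
def liftSubst {n m : ℕ} {Γ : Fin n → L.Srt} {Γ' : Fin m → L.Srt} (σ : ∀ i, Term L Γ' (Γ i))
    (s : L.Srt) : ∀ i, Term L (L.ext s Γ') (L.ext s Γ i) :=
  Fin.cons (α := fun i => Term L (L.ext s Γ') (L.ext s Γ i)) (.var (Γ := L.ext s Γ') 0)
    (fun i => (σ i).weaken s)

theorem value_liftSubst (N : Structure L) {n m : ℕ} {Γ : Fin n → L.Srt} {Γ' : Fin m → L.Srt}
    (σ : ∀ i, Term L Γ' (Γ i)) {s : L.Srt} (a : N.carrier s) (v : ∀ i, N.carrier (Γ' i)) :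
    (fun i => (liftSubst σ s i).value N (N.extVal a v)) =
      N.extVal a (fun i => (σ i).value N v) := by
  funext i
  refine Fin.cases rfl (fun i => ?_) i
  exact Term.value_weaken N _ _ _

/-- An equivalent formula suffices, so the induction follows local positive formulas only, and the
bounding term of a local quantifier is substituted together with its body. -/
theorem Formula.IsLocalPositive.exists_rename {n : ℕ} {Γ : Fin n → L.Srt} {φ : Formula L Γ}
    (hφ : φ.IsLocalPositive) : ∀ {m : ℕ} {Γ' : Fin m → L.Srt} (σ : ∀ i, Term L Γ' (Γ i)),
    ∃ ψ : Formula L Γ', ψ.IsLocalPositive ∧ ∀ (N : Structure L) (v : ∀ i, N.carrier (Γ' i)),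
      ψ.Realize N v ↔ φ.Realize N (fun i => (σ i).value N v) := by
  induction hφ with
  | rel R t =>
    intro m Γ' σ
    refine ⟨.rel R fun i => (t i).subst σ, .rel _ _, fun N v => ?_⟩
    simp only [Formula.Realize, Term.value_subst]
  | loc d t t' =>
    intro m Γ' σ
    refine ⟨.loc d (t.subst σ) (t'.subst σ), .loc _ _ _, fun N v => ?_⟩
    simp only [Formula.Realize, Term.value_subst]
  | and _ _ h1 h2 =>
    intro m Γ' σ
    obtain ⟨ψ1, h1, h1'⟩ := h1 σ
    obtain ⟨ψ2, h2, h2'⟩ := h2 σ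
    exact ⟨.and ψ1 ψ2, .and h1 h2, fun N v => and_congr (h1' N v) (h2' N v)⟩
  | or _ _ h1 h2 =>
    intro m Γ' σ
    obtain ⟨ψ1, h1, h1'⟩ := h1 σ
    obtain ⟨ψ2, h2, h2'⟩ := h2 σ
    exact ⟨.or ψ1 ψ2, .or h1 h2, fun N v => or_congr (h1' N v) (h2' N v)⟩
  | locEx d t _ ih =>
    intro m Γ' σ
    obtain ⟨ψ, h, h'⟩ := ih (liftSubst σ _)
    refine ⟨ψ.locEx d (t.subst σ), .locEx _ _ h, fun N v => ?_⟩
    simp only [Formula.realize_locEx, h', value_liftSubst, Term.value_subst]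

/-- Substitution of terms of an expanded language for variables in a term. -/
def Term.substConst {A : L.Srt → Type u} {n m : ℕ} {Γ : Fin n → L.Srt} {Γ' : Fin m → L.Srt}
    (σ : ∀ i, Term (L.withConstants A) Γ' (Γ i)) {s : L.Srt} :
    Term L Γ s → Term (L.withConstants A) Γ' s
  | .var i => σ i
  | .const c => .const (L := L.withConstants A) (.inl c)

theorem Term.value_substConst {A : L.Srt → Type u} (N : Structure L)
    (e : ∀ s, A s → N.carrier s) {n m : ℕ} {Γ : Fin n → L.Srt} {Γ' : Fin m → L.Srt}
    (σ : ∀ i, Term (L.withConstants A) Γ' (Γ i)) {s : L.Srt} (t : Term L Γ s)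
    (v : ∀ i, N.carrier (Γ' i)) :
    (t.substConst σ).value (N.expand e) v =
      t.value N (fun i => (σ i).value (N.expand e) v) := by
  cases t <;> rfl

/-- One formula must serve every structure and every interpretation of the new constants: the same
`ψ` is later read both in an extension of `M` and in `M`. -/
theorem Formula.IsLocalPositive.exists_rename_withConstants {A : L.Srt → Type u} {n : ℕ}
    {Γ : Fin n → L.Srt} {φ : Formula L Γ}
    (hφ : φ.IsLocalPositive) : ∀ {m : ℕ} {Γ' : Fin m → L.Srt}
    (σ : ∀ i, Term (L.withConstants A) Γ' (Γ i)),
    ∃ ψ : Formula (L.withConstants A) Γ', ψ.IsLocalPositive ∧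
      ∀ (N : Structure L) (e : ∀ s, A s → N.carrier s) (v : ∀ i, N.carrier (Γ' i)),
      ψ.Realize (N.expand e) v ↔ φ.Realize N (fun i => (σ i).value (N.expand e) v) := by
  induction hφ with
  | rel R t =>
    intro m Γ' σ
    refine ⟨.rel (L := L.withConstants A) R fun i => (t i).substConst σ, .rel _ _,
      fun N e v => ?_⟩
    simp only [Formula.Realize, Term.value_substConst]
    rfl
  | loc d t t' =>
    intro m Γ' σ
    refine ⟨.loc (L := L.withConstants A) d (t.substConst σ) (t'.substConst σ), .loc _ _ _,
      fun N e v => ?_⟩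
    simp only [Formula.Realize, Term.value_substConst]
    rfl
  | and _ _ h1 h2 =>
    intro m Γ' σ
    obtain ⟨ψ1, h1, h1'⟩ := h1 σ
    obtain ⟨ψ2, h2, h2'⟩ := h2 σ
    exact ⟨.and ψ1 ψ2, .and h1 h2, fun N e v => and_congr (h1' N e v) (h2' N e v)⟩
  | or _ _ h1 h2 =>
    intro m Γ' σ
    obtain ⟨ψ1, h1, h1'⟩ := h1 σ
    obtain ⟨ψ2, h2, h2'⟩ := h2 σ
    exact ⟨.or ψ1 ψ2, .or h1 h2, fun N e v => or_congr (h1' N e v) (h2' N e v)⟩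
  | @locEx n Γ s d t φ _ ih =>
    intro m Γ' σ
    obtain ⟨ψ, h, h'⟩ := ih (liftSubst (L := L.withConstants A) σ s)
    refine ⟨Formula.locEx (L := L.withConstants A) d (t.substConst σ) ψ, .locEx _ _ h,
      fun N e v => ?_⟩
    have key : ∀ a : N.carrier s, ψ.Realize (N.expand e) ((N.expand e).extVal a v) ↔
        φ.Realize N (N.extVal a fun i => (σ i).value (N.expand e) v) := by
      intro a
      refine (h' N e _).trans (iff_of_eq (congrArg _ ?_))
      exact value_liftSubst (N.expand e) σ a v
    refine (Formula.realize_locEx (N.expand e) d _ ψ v).trans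
      (Iff.trans ?_ (Formula.realize_locEx N d t φ _).symm)
    refine exists_congr fun a => and_congr ?_ (key a)
    rw [Term.value_substConst]
    rfl

end Rename

/-! ### Local ultraproducts -/

section LocalUltraproduct

open Filter

variable {L : Lang.{u}} {I : Type u} (U : Ultrafilter I) {C : I → Structure L} {P : Structure L}
  (p : ∀ i, Hom P (C i))

/-- Families of elements which are almost everywhere at a fixed locality relation from a fixed
element of `P`. -/
def BoundedFamily (s : L.Srt) : Type u :=
  {x : ∀ i, (C i).carrier s // ∃ (d : L.Loc s) (a : P.carrier s),
    ∀ᶠ i in (U : Filter I), (C i).loc d (x i) ((p i).toFun s a)}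

/-- Almost everywhere equality of bounded families. -/
def boundedFamilySetoid (s : L.Srt) : Setoid (BoundedFamily U p s) where
  r x y := ∀ᶠ i in (U : Filter I), x.1 i = y.1 i
  iseqv := ⟨fun _ => Eventually.of_forall fun _ => rfl, fun h => h.mono fun _ h => h.symm,
    fun h h' => (h.and h').mono fun _ h => h.1.trans h.2⟩

/-- The constant family given by an element of `P`. -/
def BoundedFamily.diag (s : L.Srt) (a : P.carrier s) : BoundedFamily U p s :=
  ⟨fun i => (p i).toFun s a, 1, a, Eventually.of_forall fun _ => ((C _).loc_one _ _).2 rfl⟩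

/-- The local ultraproduct of structures `C i` under `P`: its elements are the classes of the
families at bounded distance from `P`. -/
noncomputable def localUltraproduct : Structure L where
  carrier := fun s => Quotient (boundedFamilySetoid U p s)
  nonempty := fun s => (P.nonempty s).map fun a => Quotient.mk _ (BoundedFamily.diag U p s a)
  const := fun {s} c => Quotient.mk _ (BoundedFamily.diag U p s (P.const c))
  rel := fun {_ _} R a => ∀ᶠ i in (U : Filter I), (C i).rel R fun j => (a j).out.1 i
  loc := fun {_} d a b => ∀ᶠ i in (U : Filter I), (C i).loc d (a.out.1 i) (b.out.1 i)
  loc_one := fun {s} a b => by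
    simp only [Structure.loc_one]
    refine Iff.trans ?_ (Quotient.out_inj (s := boundedFamilySetoid U p s) (x := a) (y := b))
    constructor
    · intro h
      exact Quotient.out_inj.2 (Quotient.out_equiv_out.1 h)
    · intro h
      rw [h]
      exact Eventually.of_forall fun _ => rfl

variable {U p}

/-- The class of a bounded family. -/
def BoundedFamily.mk {s : L.Srt} (x : BoundedFamily U p s) :
    (localUltraproduct U p).carrier s :=
  Quotient.mk (boundedFamilySetoid U p s) x

theorem BoundedFamily.out_mk {s : L.Srt} (x : BoundedFamily U p s) :
    ∀ᶠ i in (U : Filter I), (Quotient.out x.mk).1 i = x.1 i :=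
  Quotient.exact (s := boundedFamilySetoid U p s) (Quotient.out_eq _)

theorem BoundedFamily.mk_surjective {s : L.Srt} (a : (localUltraproduct U p).carrier s) :
    ∃ x : BoundedFamily U p s, x.mk = a :=
  Quotient.exists_rep a

/-- Relations are evaluated on chosen representatives. There are finitely many arguments, so any
other representatives agree with these on a set of the ultrafilter. -/
theorem localUltraproduct_rel {n : ℕ} {ar : Fin n → L.Srt} (R : L.Rel ar)
    (x : ∀ j, BoundedFamily U p (ar j)) :
    (localUltraproduct U p).rel R (fun j => (x j).mk) ↔
      ∀ᶠ i in (U : Filter I), (C i).rel R fun j => (x j).1 i := by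
  have h : ∀ᶠ i in (U : Filter I), ∀ j, (Quotient.out (x j).mk).1 i = (x j).1 i :=
    eventually_all.2 fun j => (x j).out_mk
  refine eventually_congr (h.mono fun i hi => ?_)
  simp only [hi]

theorem localUltraproduct_loc {s : L.Srt} (d : L.Loc s) (x y : BoundedFamily U p s) :
    (localUltraproduct U p).loc d x.mk y.mk ↔
      ∀ᶠ i in (U : Filter I), (C i).loc d (x.1 i) (y.1 i) := by
  refine eventually_congr ((x.out_mk.and y.out_mk).mono fun i hi => ?_)
  rw [hi.1, hi.2]

/-- The diagonal homomorphism into a local ultraproduct. -/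
noncomputable def diagHom (U : Ultrafilter I) (p : ∀ i, Hom P (C i)) :
    Hom P (localUltraproduct U p) where
  toFun := fun s a => (BoundedFamily.diag U p s a).mk
  map_const := fun _ => rfl
  map_rel := fun R a h => (localUltraproduct_rel R _).2 <|
    Eventually.of_forall fun i => (p i).map_rel R a h
  map_loc := fun d a b h => (localUltraproduct_loc d _ _).2 <|
    Eventually.of_forall fun i => (p i).map_loc d a b h

theorem localUltraproduct_term {n : ℕ} {Γ : Fin n → L.Srt} {s : L.Srt} (t : Term L Γ s)
    (x : ∀ j, BoundedFamily U p (Γ j)) :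
    ∃ y : BoundedFamily U p s,
      t.value (localUltraproduct U p) (fun j => (x j).mk) = y.mk ∧
      ∀ i, y.1 i = t.value (C i) fun j => (x j).1 i := by
  cases t with
  | var j => exact ⟨x j, rfl, fun _ => rfl⟩
  | const c => exact ⟨_, rfl, fun i => (p i).map_const c⟩

theorem extVal_mk {n : ℕ} {Γ : Fin n → L.Srt} {s : L.Srt} (y : BoundedFamily U p s)
    (x : ∀ j, BoundedFamily U p (Γ j)) :
    ∃ z : ∀ j, BoundedFamily U p (L.ext s Γ j),
      (localUltraproduct U p).extVal y.mk (fun j => (x j).mk) = (fun j => (z j).mk) ∧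
      ∀ i, (fun j => (z j).1 i) = (C i).extVal (y.1 i) fun j => (x j).1 i := by
  refine ⟨Fin.cons (α := fun j => BoundedFamily U p (L.ext s Γ j)) y x, ?_, fun i => ?_⟩
  · funext j
    refine Fin.cases rfl (fun j => rfl) j
  · funext j
    refine Fin.cases rfl (fun j => rfl) j

/-- Positive formulas true in a local ultraproduct are true almost everywhere. -/
theorem Formula.IsPositive.eventually_of_realize {n : ℕ} {Γ : Fin n → L.Srt} {φ : Formula L Γ}
    (hφ : φ.IsPositive) : ∀ x : ∀ j, BoundedFamily U p (Γ j),
    φ.Realize (localUltraproduct U p) (fun j => (x j).mk) →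
      ∀ᶠ i in (U : Filter I), φ.Realize (C i) fun j => (x j).1 i := by
  induction hφ with
  | rel R t =>
    intro x h
    choose y hy hy' using fun k => localUltraproduct_term (t k) x
    simp only [Formula.Realize, hy] at h
    refine ((localUltraproduct_rel R y).1 h).mono fun i hi => ?_
    simpa only [hy', Formula.Realize] using hi
  | loc d t t' =>
    intro x h
    obtain ⟨y, hy, hy'⟩ := localUltraproduct_term t x
    obtain ⟨z, hz, hz'⟩ := localUltraproduct_term t' x
    simp only [Formula.Realize, hy, hz] at h
    refine ((localUltraproduct_loc d y z).1 h).mono fun i hi => ?_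
    simpa only [hy', hz', Formula.Realize] using hi
  | and _ _ h1 h2 =>
    intro x h
    exact (h1 x h.1).and (h2 x h.2)
  | or _ _ h1 h2 =>
    intro x h
    rcases h with h | h
    · exact (h1 x h).mono fun _ => Or.inl
    · exact (h2 x h).mono fun _ => Or.inr
  | ex s _ ih =>
    rintro x ⟨a, ha⟩
    obtain ⟨y, rfl⟩ := BoundedFamily.mk_surjective a
    obtain ⟨z, hz, hz'⟩ := extVal_mk y x
    rw [hz] at ha
    exact (ih z ha).mono fun i hi => ⟨y.1 i, by rwa [hz'] at hi⟩

theorem eventually_exists_choice {C : I → Type u} {p : ∀ i, C i → Prop} (hne : ∀ i, Nonempty (C i))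
    (h : ∀ᶠ i in (U : Filter I), ∃ a, p i a) :
    ∃ y : ∀ i, C i, ∀ᶠ i in (U : Filter I), p i (y i) := by
  classical
  refine ⟨fun i => if h : ∃ a, p i a then h.choose else (hne i).some, h.mono fun i hi => ?_⟩
  simp only [dif_pos hi]
  exact hi.choose_spec

/-- Local positive formulas true almost everywhere are true in a local ultraproduct of local
structures. -/
theorem Formula.IsLocalPositive.realize_of_eventually
    (hcomp : ∀ i {s : L.Srt} (d₁ d₂ : L.Loc s) (a b c : (C i).carrier s),
      (C i).loc d₁ a b → (C i).loc d₂ b c → (C i).loc (d₁ * d₂) a c)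
    {n : ℕ} {Γ : Fin n → L.Srt} {φ : Formula L Γ}
    (hφ : φ.IsLocalPositive) : ∀ x : ∀ j, BoundedFamily U p (Γ j),
    (∀ᶠ i in (U : Filter I), φ.Realize (C i) fun j => (x j).1 i) →
    φ.Realize (localUltraproduct U p) (fun j => (x j).mk) := by
  induction hφ with
  | rel R t =>
    intro x h
    choose y hy hy' using fun k => localUltraproduct_term (t k) x
    simp only [Formula.Realize, hy]
    refine (localUltraproduct_rel R y).2 (h.mono fun i hi => ?_)
    simpa only [hy', Formula.Realize] using hi
  | loc d t t' =>
    intro x h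
    obtain ⟨y, hy, hy'⟩ := localUltraproduct_term t x
    obtain ⟨z, hz, hz'⟩ := localUltraproduct_term t' x
    simp only [Formula.Realize, hy, hz]
    refine (localUltraproduct_loc d y z).2 (h.mono fun i hi => ?_)
    simpa only [hy', hz', Formula.Realize] using hi
  | and _ _ h1 h2 =>
    intro x h
    exact ⟨h1 x (h.mono fun _ h => h.1), h2 x (h.mono fun _ h => h.2)⟩
  | or _ _ h1 h2 =>
    intro x h
    exact (Ultrafilter.eventually_or.1 h).imp (h1 x) (h2 x)
  | @locEx n Γ s d t φ _ ih =>
    intro x h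
    simp only [Formula.realize_locEx] at h ⊢
    obtain ⟨y, hy⟩ := eventually_exists_choice (fun i => (C i).nonempty s) h
    obtain ⟨w, hw, hw'⟩ := localUltraproduct_term t x
    obtain ⟨e, a, hea⟩ := w.2
    -- The local quantifier keeps the witnesses within `d` of a bounded family, so they again form a
    -- bounded family. Witnesses of an unrestricted quantifier need not define an element.
    let y' : BoundedFamily U p s := ⟨y, d * e, a, (hy.and hea).mono fun i hi =>
      hcomp i d e _ _ _ (by rw [hw']; exact hi.1.1) hi.2⟩
    obtain ⟨z, hz, hz'⟩ := extVal_mk y' x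
    refine ⟨y'.mk, ?_, ?_⟩
    · rw [hw]
      refine (localUltraproduct_loc d y' w).2 (hy.mono fun i hi => ?_)
      rw [hw']
      exact hi.1
    · rw [hz]
      refine ih z (hy.mono fun i hi => ?_)
      rw [hz']
      exact hi.2

/-- The diagonal embedding of a local ultrapower is a positive embedding. -/
theorem diagHom_isPositiveEmbedding (U : Ultrafilter I) :
    (diagHom U (fun _ => Hom.id P)).IsPositiveEmbedding := by
  intro n Γ φ hφ a h
  obtain ⟨i, hi⟩ := (hφ.eventually_of_realize (p := fun _ => Hom.id P)
    (fun j => BoundedFamily.diag U (fun _ => Hom.id P) _ (a j)) h).exists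
  exact hi

theorem localUltraproduct_satisfies {σ : Sentence L} (hσ : σ.IsNegative)
    (h : ∀ i, (C i).Satisfies σ) : (localUltraproduct U p).Satisfies σ := by
  obtain ⟨φ, hφ, rfl⟩ := hσ
  intro hU
  have : φ.Realize (localUltraproduct U p)
      (fun j : Fin 0 => (j.elim0 : BoundedFamily U p j.elim0).mk) := by
    convert hU using 2 with j
  obtain ⟨i, hi⟩ := (hφ.eventually_of_realize _ this).exists
  refine h i ?_
  convert hi using 2

end LocalUltraproduct

/-! ### Local ultraproducts of models are models -/

section LocalUltraproductModel

open Filter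

variable {L : LocalLang.{u}} {I : Type u} {U : Ultrafilter I} {C : I → Structure L.toLang}
  {P : Structure L.toLang} {p : ∀ i, Hom P (C i)}

theorem localUltraproduct_isLocal (hP : P.IsLocal L) (hC : ∀ i, (C i).IsLocal L) :
    (localUltraproduct U p).IsLocal L where
  symm := fun d a b h => by
    obtain ⟨x, rfl⟩ := BoundedFamily.mk_surjective a
    obtain ⟨y, rfl⟩ := BoundedFamily.mk_surjective b
    rw [localUltraproduct_loc] at h ⊢
    exact h.mono fun i hi => (hC i).symm _ _ _ hi
  mono := fun d₁ d₂ hd a b h => by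
    obtain ⟨x, rfl⟩ := BoundedFamily.mk_surjective a
    obtain ⟨y, rfl⟩ := BoundedFamily.mk_surjective b
    rw [localUltraproduct_loc] at h ⊢
    exact h.mono fun i hi => (hC i).mono _ _ hd _ _ hi
  comp := fun d₁ d₂ a b c h h' => by
    obtain ⟨x, rfl⟩ := BoundedFamily.mk_surjective a
    obtain ⟨y, rfl⟩ := BoundedFamily.mk_surjective b
    obtain ⟨z, rfl⟩ := BoundedFamily.mk_surjective c
    rw [localUltraproduct_loc] at h h' ⊢
    exact (h.and h').mono fun i hi => (hC i).comp _ _ _ _ _ hi.1 hi.2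
  bound := fun c₁ c₂ => by
    have := (diagHom U p).map_loc _ _ _ (hP.bound c₁ c₂)
    rwa [(diagHom U p).map_const, (diagHom U p).map_const] at this
  local_ := fun a b => by
    obtain ⟨x, rfl⟩ := BoundedFamily.mk_surjective a
    obtain ⟨y, rfl⟩ := BoundedFamily.mk_surjective b
    obtain ⟨d, a, hx⟩ := x.2
    obtain ⟨e, b, hy⟩ := y.2
    obtain ⟨c, hc⟩ := hP.local_ a b
    -- Two families are joined by the path through the elements of `P` that bound them.
    refine ⟨d * c * e, (localUltraproduct_loc _ _ _).2 ((hx.and hy).mono fun i hi => ?_)⟩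
    exact (hC i).comp _ _ _ _ _ ((hC i).comp _ _ _ _ _ hi.1 ((p i).map_loc _ _ _ hc))
      ((hC i).symm _ _ _ hi.2)

theorem localUltraproduct_isModel {T : NegTheory L} (hP : P.IsLocal L)
    (hC : ∀ i, T.IsModel (C i)) : T.IsModel (localUltraproduct U p) :=
  ⟨localUltraproduct_isLocal hP fun i => (hC i).1, fun σ hσ =>
    localUltraproduct_satisfies (T.isNegative σ hσ) fun i => (hC i).2 σ hσ⟩

end LocalUltraproductModel

/-! ### Local ultraproducts commute with naming elements of the base -/

section LocalUltraproductExpand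

variable {L : Lang.{u}} {I : Type u} (U : Ultrafilter I) {C : I → Structure L} {P : Structure L}
  (p : ∀ i, Hom P (C i)) {A : L.Srt → Type u} (e : ∀ s, A s → P.carrier s)

/-- The homomorphisms between expansions by constants. -/
def expandHom (i : I) : Hom (P.expand e) ((C i).expand fun s a => (p i).toFun s (e s a)) :=
  (p i).expand _ _ fun _ _ => rfl

/-- The local ultraproduct of the expansions maps to the expansion of the local ultraproduct. -/
noncomputable def localUltraproductExpand : Hom (localUltraproduct U (expandHom p e))
    ((localUltraproduct U p).expand fun s a => (diagHom U p).toFun s (e s a)) where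
  toFun := fun _ a => a
  map_const := fun {s} c => by rcases c with c | c <;> rfl
  map_rel := fun _ _ h => h
  map_loc := fun _ _ _ h => h

/-- The expansion of the local ultraproduct maps to the local ultraproduct of the expansions. -/
noncomputable def expandLocalUltraproduct :
    Hom ((localUltraproduct U p).expand fun s a => (diagHom U p).toFun s (e s a))
      (localUltraproduct U (expandHom p e)) where
  toFun := fun _ a => a
  map_const := fun {s} c => by rcases c with c | c <;> rfl
  map_rel := fun _ _ h => h
  map_loc := fun _ _ _ h => h

end LocalUltraproductExpand

/-! ### Local positive facts about named elements -/

section Facts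

variable {L : Lang.{u}} {E : L.Srt → Type u}

/-- The context given by a list of names. -/
def lctx : (l : List (Σ s, E s)) → Fin l.length → L.Srt
  | [] => Fin.elim0
  | e :: l => L.ext e.1 (lctx l)

/-- The name of a variable of the context given by a list. -/
def lname : (l : List (Σ s, E s)) → ∀ i, E (lctx l i)
  | [] => fun i => i.elim0
  | e :: l => Fin.cons (α := fun i => E (L.ext e.1 (lctx l) i)) e.2 (lname l)

/-- The assignment induced by an interpretation of the names. -/
def lval {N : L.Srt → Type u} (q : ∀ s, E s → N s) (l : List (Σ s, E s)) : ∀ i, N (lctx l i) :=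
  fun i => q _ (lname l i)

theorem lval_cons (N : Structure L) (q : ∀ s, E s → N.carrier s) (e : Σ s, E s)
    (l : List (Σ s, E s)) : lval q (e :: l) = N.extVal (q e.1 e.2) (lval q l) := by
  funext i
  refine Fin.cases rfl (fun i => rfl) i

theorem lname_mem : ∀ (l : List (Σ s, E s)) (i : Fin l.length),
    (⟨lctx l i, lname l i⟩ : Σ s, E s) ∈ l
  | [] => fun i => i.elim0
  | _ :: l => Fin.cases List.mem_cons_self fun i => List.mem_cons_of_mem _ (lname_mem l i)

theorem lval_congr {N : L.Srt → Type u} {q q' : ∀ s, E s → N s} {l : List (Σ s, E s)}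
    (h : ∀ e ∈ l, q e.1 e.2 = q' e.1 e.2) : lval q l = lval q' l :=
  funext fun i => h _ (lname_mem l i)

/-- Answering with a term, not an index, hides the transport between the sort of the name and the
sort of the variable. -/
theorem exists_lookup : ∀ {l : List (Σ s, E s)} {e : Σ s, E s}, e ∈ l →
    ∃ t : Term L (lctx l) e.1, ∀ (N : Structure L) (q : ∀ s, E s → N.carrier s),
      t.value N (lval q l) = q e.1 e.2
  | f :: l, e, h => by
    rcases List.mem_cons.1 h with rfl | h
    · exact ⟨.var (Γ := lctx (e :: l)) 0, fun N q => rfl⟩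
    · obtain ⟨t, ht⟩ := exists_lookup h
      refine ⟨t.weaken f.1, fun N q => ?_⟩
      rw [← ht N q, lval_cons]
      exact Term.value_weaken N t _ _

theorem Term.exists_of_subset {l l' : List (Σ s, E s)} (h : l ⊆ l') {s : L.Srt}
    (t : Term L (lctx l) s) :
    ∃ t' : Term L (lctx l') s, ∀ (N : Structure L) (q : ∀ s, E s → N.carrier s),
      t'.value N (lval q l') = t.value N (lval q l) := by
  cases t with
  | var i => exact exists_lookup (h (lname_mem l i))
  | const c => exact ⟨.const c, fun _ _ => rfl⟩

variable (L E) in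
/-- A local positive formula whose variables are replaced by names. -/
structure LPFact : Type u where
  {n : ℕ}
  {Γ : Fin n → L.Srt}
  φ : Formula L Γ
  isLocalPositive : φ.IsLocalPositive
  e : ∀ i, E (Γ i)

/-- Truth of a fact under an interpretation of the names. -/
def LPFact.Holds (F : LPFact L E) (N : Structure L) (q : ∀ s, E s → N.carrier s) : Prop :=
  F.φ.Realize N fun i => q _ (F.e i)

/-- Renaming of a fact. -/
def LPFact.map {E' : L.Srt → Type u} (F : LPFact L E) (g : ∀ s, E s → E' s) : LPFact L E' :=
  ⟨F.φ, F.isLocalPositive, fun i => g _ (F.e i)⟩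

theorem LPFact.holds_map {E' : L.Srt → Type u} (F : LPFact L E) (g : ∀ s, E s → E' s)
    (N : Structure L) (q : ∀ s, E' s → N.carrier s) :
    (F.map g).Holds N q ↔ F.Holds N fun s a => q s (g s a) := Iff.rfl

/-- The fact given by a relation symbol. -/
def LPFact.rel {n : ℕ} {ar : Fin n → L.Srt} (R : L.Rel ar) (e : ∀ i, E (ar i)) : LPFact L E :=
  ⟨.rel R fun i => .var i, .rel _ _, e⟩

/-- The fact given by a locality relation symbol. -/
def LPFact.loc {s : L.Srt} (d : L.Loc s) (a b : E s) : LPFact L E :=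
  ⟨.loc d (.var (Γ := lctx [⟨s, a⟩, ⟨s, b⟩]) 0) (.var (Γ := lctx [⟨s, a⟩, ⟨s, b⟩]) (Fin.succ 0)),
    .loc _ _ _, lname [⟨s, a⟩, ⟨s, b⟩]⟩

/-- The fact that the name `a` denotes the constant `c`. -/
def LPFact.const {s : L.Srt} (a : E s) (c : L.Const s) : LPFact L E :=
  ⟨.loc 1 (.var (Γ := lctx [⟨s, a⟩]) 0) (.const c), .loc _ _ _, lname [⟨s, a⟩]⟩

/-- The fact that the name `a` is at locality relation `d` from the constant `c`. -/
def LPFact.locConst {s : L.Srt} (d : L.Loc s) (a : E s) (c : L.Const s) : LPFact L E :=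
  ⟨.loc d (.var (Γ := lctx [⟨s, a⟩]) 0) (.const c), .loc _ _ _, lname [⟨s, a⟩]⟩

theorem LPFact.holds_rel {n : ℕ} {ar : Fin n → L.Srt} (R : L.Rel ar) (e : ∀ i, E (ar i))
    (N : Structure L) (q : ∀ s, E s → N.carrier s) :
    (LPFact.rel R e).Holds N q ↔ N.rel R fun i => q _ (e i) := Iff.rfl

theorem LPFact.holds_loc {s : L.Srt} (d : L.Loc s) (a b : E s)
    (N : Structure L) (q : ∀ s, E s → N.carrier s) :
    (LPFact.loc d a b).Holds N q ↔ N.loc d (q s a) (q s b) := Iff.rfl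

theorem LPFact.holds_const {s : L.Srt} (a : E s) (c : L.Const s)
    (N : Structure L) (q : ∀ s, E s → N.carrier s) :
    (LPFact.const a c).Holds N q ↔ q s a = N.const c := N.loc_one _ _

theorem LPFact.Holds.hom {F : LPFact L E} {N N' : Structure L} {q : ∀ s, E s → N.carrier s}
    (h : F.Holds N q) (f : Hom N N') : F.Holds N' fun s a => f.toFun s (q s a) :=
  f.realize F.isLocalPositive.isPositive _ h

/-- A fact as a formula in the context of a list which contains its names. -/
theorem LPFact.exists_formula (F : LPFact L E) {l : List (Σ s, E s)}
    (h : ∀ i, (⟨F.Γ i, F.e i⟩ : Σ s, E s) ∈ l) :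
    ∃ ψ : Formula L (lctx l), ψ.IsLocalPositive ∧
      ∀ (N : Structure L) (q : ∀ s, E s → N.carrier s),
        ψ.Realize N (lval q l) ↔ F.Holds N q := by
  choose t ht using fun i => exists_lookup (h i)
  obtain ⟨ψ, hψ, hψ'⟩ := F.isLocalPositive.exists_rename t
  refine ⟨ψ, hψ, fun N q => ?_⟩
  rw [hψ', LPFact.Holds]
  simp only [ht]

/-- The conjunction of a finite list of facts as a formula. -/
theorem LPFact.exists_formula_list {l : List (Σ s, E s)} : ∀ (F : LPFact L E)
    (Φ : List (LPFact L E)), (∀ G ∈ F :: Φ, ∀ i, (⟨G.Γ i, G.e i⟩ : Σ s, E s) ∈ l) →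
    ∃ ψ : Formula L (lctx l), ψ.IsLocalPositive ∧
      ∀ (N : Structure L) (q : ∀ s, E s → N.carrier s),
        ψ.Realize N (lval q l) ↔ ∀ G ∈ F :: Φ, G.Holds N q
  | F, [], h => by
    obtain ⟨ψ, hψ, hψ'⟩ := F.exists_formula (h F List.mem_cons_self)
    exact ⟨ψ, hψ, fun N q => by simp [hψ']⟩
  | F, G :: Φ, h => by
    obtain ⟨ψ, hψ, hψ'⟩ := F.exists_formula (h F List.mem_cons_self)
    obtain ⟨χ, hχ, hχ'⟩ := LPFact.exists_formula_list G Φ fun G' hG' =>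
      h G' (List.mem_cons_of_mem _ hG')
    refine ⟨.and ψ χ, .and hψ hχ, fun N q => ?_⟩
    rw [List.forall_mem_cons, ← hψ', ← hχ']
    exact Iff.rfl

/-- Elimination of bounded variables by local existential quantification. -/
theorem exists_peel (B : Structure L) (b : ∀ s, E s → B.carrier s) (l₀ : List (Σ s, E s)) :
    ∀ (l : List (Σ s, E s)), l.Nodup → (∀ e ∈ l, e ∉ l₀) →
    (∀ e ∈ l, ∃ (t : Term L (lctx l₀) e.1) (d : L.Loc e.1),
      B.loc d (b e.1 e.2) (t.value B (lval b l₀))) →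
    ∀ φ : Formula L (lctx (l ++ l₀)), φ.IsLocalPositive → φ.Realize B (lval b (l ++ l₀)) →
    ∃ ψ : Formula L (lctx l₀), ψ.IsLocalPositive ∧ ψ.Realize B (lval b l₀) ∧
      ∀ (C : Structure L) (q₀ : ∀ s, E s → C.carrier s), ψ.Realize C (lval q₀ l₀) →
        ∃ q : ∀ s, E s → C.carrier s, (∀ e ∈ l₀, q e.1 e.2 = q₀ e.1 e.2) ∧
          φ.Realize C (lval q (l ++ l₀))
  | [], _, _, _, φ, hφ, h => ⟨φ, hφ, h, fun C q₀ h => ⟨q₀, fun _ _ => rfl, h⟩⟩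
  | e :: l, hl, hd, hb, φ, hφ, h => by
    classical
    obtain ⟨t, d, htd⟩ := hb e List.mem_cons_self
    obtain ⟨t', ht'⟩ := Term.exists_of_subset (List.subset_append_right l l₀) t
    rw [List.nodup_cons] at hl
    obtain ⟨ψ, hψ, hB, hC⟩ := exists_peel B b l₀ l hl.2
      (fun e he => hd e (List.mem_cons_of_mem _ he))
      (fun e he => hb e (List.mem_cons_of_mem _ he))
      (Formula.locEx d t' φ) (.locEx d t' hφ) (by
        refine (Formula.realize_locEx B d t' φ _).2 ⟨b e.1 e.2, by rwa [ht'], ?_⟩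
        exact (lval_cons B b e (l ++ l₀)) ▸ h)
    refine ⟨ψ, hψ, hB, fun C q₀ hq₀ => ?_⟩
    obtain ⟨q, hq, hqφ⟩ := hC C q₀ hq₀
    obtain ⟨a, -, ha⟩ := (Formula.realize_locEx C d t' φ _).1 hqφ
    -- The witness becomes the value of the name `e`. No other name of the context is affected,
    -- since `e` occurs neither in `l` nor in `l₀`.
    let q' : ∀ s, E s → C.carrier s := fun s x =>
      if h : (⟨s, x⟩ : Σ s, E s) = e then cast (congrArg (fun y => C.carrier y.1) h.symm) a
      else q s x
    have hne : ∀ f : Σ s, E s, f ≠ e → q' f.1 f.2 = q f.1 f.2 := fun f hf => dif_neg hf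
    have he : q' e.1 e.2 = a := dif_pos rfl
    refine ⟨q', fun f hf => ?_, ?_⟩
    · rw [hne f, hq f hf]
      rintro rfl
      exact hd f List.mem_cons_self hf
    · have : lval q' (e :: (l ++ l₀)) = C.extVal a (lval q (l ++ l₀)) := by
        rw [lval_cons, he]
        congr 1
        refine lval_congr fun f hf => hne f ?_
        rintro rfl
        rcases List.mem_append.1 hf with hf | hf
        · exact hl.1 hf
        · exact hd f List.mem_cons_self hf
      exact this ▸ ha

/-- A finite list of true facts is realized in any structure which satisfies a suitable local
positive formula on the names of `l₀`. -/
theorem exists_formula_of_facts (B : Structure L) (b : ∀ s, E s → B.carrier s)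
    (l₀ : List (Σ s, E s)) (Φ : List (LPFact L E)) (hΦ : Φ ≠ [])
    (hB : ∀ F ∈ Φ, F.Holds B b)
    (hb : ∀ F ∈ Φ, ∀ i, ∃ (t : Term L (lctx l₀) (F.Γ i)) (d : L.Loc (F.Γ i)),
      B.loc d (b _ (F.e i)) (t.value B (lval b l₀))) :
    ∃ ψ : Formula L (lctx l₀), ψ.IsLocalPositive ∧ ψ.Realize B (lval b l₀) ∧
      ∀ (C : Structure L) (q₀ : ∀ s, E s → C.carrier s), ψ.Realize C (lval q₀ l₀) →
        ∃ q : ∀ s, E s → C.carrier s, (∀ e ∈ l₀, q e.1 e.2 = q₀ e.1 e.2) ∧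
          ∀ F ∈ Φ, F.Holds C q := by
  classical
  let names : List (Σ s, E s) := Φ.flatMap fun F => List.ofFn fun i => ⟨F.Γ i, F.e i⟩
  have hnames : ∀ e ∈ names, ∃ F ∈ Φ, ∃ i, (⟨F.Γ i, F.e i⟩ : Σ s, E s) = e := by
    intro e he
    obtain ⟨F, hF, he⟩ := List.mem_flatMap.1 he
    obtain ⟨i, hi⟩ := (List.mem_ofFn' _ _).1 he
    exact ⟨F, hF, i, hi⟩
  -- These are the names to be quantified away. Repetitions and names of `l₀` are removed so that
  -- each quantifier changes the value of one name only.
  let l := names.dedup.filter fun e => e ∉ l₀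
  have hl : ∀ e ∈ l, e ∈ names ∧ e ∉ l₀ := by
    intro e he
    obtain ⟨h1, h2⟩ := List.mem_filter.1 he
    exact ⟨List.mem_dedup.1 h1, by simpa using h2⟩
  have hmem : ∀ F ∈ Φ, ∀ i, (⟨F.Γ i, F.e i⟩ : Σ s, E s) ∈ l ++ l₀ := by
    intro F hF i
    by_cases h : (⟨F.Γ i, F.e i⟩ : Σ s, E s) ∈ l₀
    · exact List.mem_append_right _ h
    · refine List.mem_append_left _ (List.mem_filter.2 ⟨List.mem_dedup.2 ?_, by simpa using h⟩)
      exact List.mem_flatMap.2 ⟨F, hF, (List.mem_ofFn' _ _).2 ⟨i, rfl⟩⟩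
  -- There is no formula for the empty conjunction, hence the assumption that the list is nonempty.
  obtain ⟨F, Φ, rfl⟩ := List.exists_cons_of_ne_nil hΦ
  obtain ⟨φ, hφ, hφ'⟩ := LPFact.exists_formula_list F Φ hmem
  obtain ⟨ψ, hψ, hψB, hψC⟩ := exists_peel B b l₀ l
    ((List.nodup_dedup _).filter _) (fun e he => (hl e he).2) (fun e he => by
      obtain ⟨F', hF', i, rfl⟩ := hnames e (hl e he).1
      exact hb F' hF' i) φ hφ ((hφ' B b).2 hB)
  refine ⟨ψ, hψ, hψB, fun C q₀ h => ?_⟩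
  obtain ⟨q, hq, hq'⟩ := hψC C q₀ h
  exact ⟨q, hq, (hφ' C q).1 hq'⟩

end Facts

/-! ### Realization of finitely satisfiable sets of facts -/

theorem exists_ultrafilter_of_finite {X ι : Type*} (S : ι → Set X)
    (h : ∀ t : Finset ι, ∃ x, ∀ i ∈ t, x ∈ S i) : ∃ U : Ultrafilter X, ∀ i, S i ∈ U := by
  classical
  have : (Filter.generate (Set.range S)).NeBot := by
    rw [Filter.generate_neBot_iff]
    intro t ht hfin
    choose f hf using fun x : t => ht x.2
    have := hfin.fintype
    obtain ⟨x, hx⟩ := h (Finset.univ.image f)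
    refine ⟨x, fun s hs => ?_⟩
    have := hx _ (Finset.mem_image_of_mem f (Finset.mem_univ ⟨s, hs⟩))
    rwa [hf] at this
  refine ⟨Ultrafilter.of (Filter.generate (Set.range S)), fun i => Ultrafilter.of_le _ ?_⟩
  exact Filter.mem_generate_of_mem ⟨i, rfl⟩

section Realization

open Filter

variable {L : LocalLang.{u}}

/-- A homomorphism which remains a positive embedding when elements of its domain are named by
constants. -/
def IsStrongEmbedding {L : Lang.{u}} {P D : Structure L} (f : Hom P D) : Prop :=
  f.IsPositiveEmbedding ∧ ∀ (A : L.Srt → Type u) (e : ∀ s, A s → P.carrier s),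
    (f.expand e (fun s a => f.toFun s (e s a)) fun _ _ => rfl).IsPositiveEmbedding

/-- Naming elements of `P` before or after the ultrapower gives the same structure, so the
ultrapower of the expansion `P.expand e` applies. -/
theorem isStrongEmbedding_diagHom {L : Lang.{u}} {P : Structure L} {I : Type u}
    (U : Ultrafilter I) : IsStrongEmbedding (diagHom U fun _ => Hom.id P) := by
  refine ⟨diagHom_isPositiveEmbedding U, fun A e n Γ φ hφ a h => ?_⟩
  have := (expandLocalUltraproduct U (fun _ => Hom.id P) e).realize hφ _ h
  exact diagHom_isPositiveEmbedding (P := P.expand e) U φ hφ a this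

/-- Every structure `P` embeds in a model which realizes all the finitely satisfiable sets of facts
with parameters in `P` whose variables are bounded. -/
theorem exists_realization {T : NegTheory L} {P : Structure L.toLang} (hP : T.IsModel P)
    (V : L.Srt → Type u) :
    ∃ (D : Structure L.toLang) (ι : Hom P D), T.IsModel D ∧ IsStrongEmbedding ι ∧
      ∀ Φ : Set (LPFact L.toLang fun s => V s ⊕ P.carrier s),
        (∀ l : List _, (∀ F ∈ l, F ∈ Φ) → ∃ q : ∀ s, V s → P.carrier s,
          ∀ F ∈ l, F.Holds P fun s => Sum.elim (q s) id) →
        (∀ s (v : V s), ∃ (d : L.Loc s) (a : P.carrier s), ∃ F ∈ Φ, ∀ q : ∀ s, V s → P.carrier s,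
          F.Holds P (fun s => Sum.elim (q s) id) → P.loc d (q s v) a) →
        ∃ h : ∀ s, V s → D.carrier s, ∀ F ∈ Φ, F.Holds D fun s => Sum.elim (h s) (ι.toFun s) := by
  classical
  -- All finitely satisfiable sets are treated at once, so that one `D` serves them all. A point of
  -- the index set `X` picks an assignment for each of them.
  let 𝒮 := {Φ : Set (LPFact L.toLang fun s => V s ⊕ P.carrier s) //
    ∀ l : List _, (∀ F ∈ l, F ∈ Φ) → ∃ q : ∀ s, V s → P.carrier s,
      ∀ F ∈ l, F.Holds P fun s => Sum.elim (q s) id}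
  let X := 𝒮 → ∀ s, V s → P.carrier s
  obtain ⟨U, hU⟩ := exists_ultrafilter_of_finite
    (fun i : Σ Φ : 𝒮, {F // F ∈ Φ.1} =>
      {x : X | i.2.1.Holds P fun s => Sum.elim (x i.1 s) id}) (by
    intro t
    choose q hq using fun Φ : 𝒮 => Φ.2
      (((t.toList.filter fun i => i.1 = Φ).map fun i => i.2.1).filter fun F => F ∈ Φ.1)
      (fun F hF => by simpa using (List.mem_filter.1 hF).2)
    refine ⟨q, fun i hi => hq i.1 _ (List.mem_filter.2 ⟨List.mem_map.2 ⟨i, ?_, rfl⟩, ?_⟩)⟩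
    · exact List.mem_filter.2 ⟨Finset.mem_toList.2 hi, by simp⟩
    · simp [i.2.2])
  refine ⟨localUltraproduct U fun _ => Hom.id P, diagHom U fun _ => Hom.id P,
    localUltraproduct_isModel hP.1 fun _ => hP, isStrongEmbedding_diagHom U,
    fun Φ hfs hbd => ?_⟩
  let Ψ : 𝒮 := ⟨Φ, hfs⟩
  have hΦ : ∀ F ∈ Φ, ∀ᶠ x : X in (U : Filter X), F.Holds P fun s => Sum.elim (x Ψ s) id :=
    fun F hF => hU ⟨Ψ, F, hF⟩
  -- The bounding fact for `v` belongs to `Φ`, so it holds almost everywhere. Without it the values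
  -- of `v` need not define an element.
  let y : ∀ s, V s → BoundedFamily U (fun _ => Hom.id P) s := fun s v =>
    ⟨fun x => x Ψ s v, by
      obtain ⟨d, a, F, hF, h⟩ := hbd s v
      exact ⟨d, a, (hΦ F hF).mono fun x hx => h _ hx⟩⟩
  refine ⟨fun s v => (y s v).mk, fun F hF => ?_⟩
  have := F.isLocalPositive.realize_of_eventually (U := U) (p := fun _ => Hom.id P)
    (fun _ => hP.1.comp)
    (fun j => Sum.elim (y _) (BoundedFamily.diag U (fun _ => Hom.id P) _) (F.e j))
    ((hΦ F hF).mono fun x hx => by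
      unfold LPFact.Holds at hx
      convert hx using 2 with j
      cases F.e j <;> rfl)
  unfold LPFact.Holds
  convert this using 2 with j
  cases F.e j <;> rfl

/-- Finitely many facts on elements of `B` and of `A` transfer from `B` to `C` if local positive
formulas on elements of `A` do. -/
theorem exists_holds_of_transfer {L : Lang.{u}} {A B C : Structure L}
    (hB : ∀ s (a b : B.carrier s), ∃ d : L.Loc s, B.loc d a b)
    (f : ∀ s, A.carrier s → B.carrier s) (g : ∀ s, A.carrier s → C.carrier s)
    (h : ∀ F : LPFact L A.carrier, F.Holds B f → F.Holds C g)
    {K : L.Srt → Type u} (r : ∀ s, K s → B.carrier s)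
    (Φ : List (LPFact L fun s => A.carrier s ⊕ K s))
    (hΦ : ∀ F ∈ Φ, F.Holds B fun s => Sum.elim (f s) (r s)) :
    ∃ q : ∀ s, K s → C.carrier s, ∀ F ∈ Φ, F.Holds C fun s => Sum.elim (g s) (q s) := by
  classical
  by_cases hne : Φ = []
  · subst hne
    exact ⟨fun s _ => (C.nonempty s).some, by simp⟩
  -- Names from `A` are kept and names from `K` are replaced by an arbitrary element of `A`. Hence
  -- `l₀` contains every name from `A` that is used, and on each sort that occurs a name from `A` to
  -- which the names from `K` can be bounded.
  let α : ∀ s, A.carrier s ⊕ K s → A.carrier s := fun s =>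
    Sum.elim id fun _ => (A.nonempty s).some
  let l₀ : List (Σ s, A.carrier s ⊕ K s) :=
    Φ.flatMap fun F => List.ofFn fun i => ⟨F.Γ i, .inl (α _ (F.e i))⟩
  have hl₀ : ∀ e ∈ l₀, ∃ a, e.2 = Sum.inl a := by
    intro e he
    obtain ⟨F, hF, he⟩ := List.mem_flatMap.1 he
    obtain ⟨i, rfl⟩ := (List.mem_ofFn' _ _).1 he
    exact ⟨_, rfl⟩
  have hmem : ∀ F ∈ Φ, ∀ i, (⟨F.Γ i, .inl (α _ (F.e i))⟩ : Σ s, A.carrier s ⊕ K s) ∈ l₀ :=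
    fun F hF i => List.mem_flatMap.2 ⟨F, hF, (List.mem_ofFn' _ _).2 ⟨i, rfl⟩⟩
  obtain ⟨ψ, hψ, hψB, hψC⟩ := exists_formula_of_facts B (fun s => Sum.elim (f s) (r s)) l₀ Φ hne hΦ
    (fun F hF i => by
      obtain ⟨t, ht⟩ := exists_lookup (L := L) (hmem F hF i)
      obtain ⟨d, hd⟩ := hB _ (Sum.elim (f _) (r _) (F.e i)) (f _ (α _ (F.e i)))
      exact ⟨t, d, by rw [ht]; exact hd⟩)
  have key : ∀ {N : L.Srt → Type u} (f : ∀ s, A.carrier s → N s) (r : ∀ s, K s → N s),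
      lval (fun s => Sum.elim (f s) (r s)) l₀ = lval (fun s a => f s (α s a)) l₀ := by
    intro N f r
    refine lval_congr fun e he => ?_
    obtain ⟨a, ha⟩ := hl₀ e he
    rw [ha]; rfl
  rw [key] at hψB
  obtain ⟨q, hq, hqΦ⟩ := hψC C (fun s => Sum.elim (g s) fun _ => (C.nonempty s).some) (by
    rw [key]
    exact h ⟨ψ, hψ, lval α l₀⟩ hψB)
  refine ⟨fun s k => q s (.inr k), fun F hF => ?_⟩
  have := hqΦ F hF
  unfold LPFact.Holds at this ⊢
  convert this using 2 with i
  have hi := hmem F hF i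
  cases he : F.e i with
  | inl a =>
    rw [he] at hi
    exact (hq _ hi).symm
  | inr k => rfl

/-- Uniform amalgamation. -/
theorem exists_amalgam {T : NegTheory L} {C : Structure L.toLang} (hC : T.IsModel C)
    (K : Type u) :
    ∃ (D : Structure L.toLang) (ι : Hom C D), T.IsModel D ∧ IsStrongEmbedding ι ∧
      ∀ (A B : Structure L.toLang) (f : ∀ s, A.carrier s → B.carrier s)
        (g : ∀ s, A.carrier s → C.carrier s), B.IsLocal L →
        (∀ F : LPFact L.toLang A.carrier, F.Holds B f → F.Holds C g) →
        (∀ s, ∃ r : K → B.carrier s, Function.Surjective r) →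
        ∃ h : Hom B D, ∀ s a, h.toFun s (f s a) = ι.toFun s (g s a) := by
  obtain ⟨D, ι, hD, hι, H⟩ := exists_realization hC fun _ => K
  refine ⟨D, ι, hD, hι, fun A B f g hB h hr => ?_⟩
  choose r hr using hr
  -- This is the local positive diagram of `B`, enumerated by `K`, with the elements of `A` read in
  -- `C`. The set `K` depends only on the size allowed for `B`, so `D` is uniform in `A` and `B`.
  let Φ : Set (LPFact L.toLang fun s => K ⊕ C.carrier s) :=
    {F' | ∃ F : LPFact L.toLang fun s => A.carrier s ⊕ K,
      F.Holds B (fun s => Sum.elim (f s) (r s)) ∧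
        F' = F.map fun s => Sum.elim (fun a => .inr (g s a)) .inl}
  obtain ⟨k, hk⟩ := H Φ (by
    intro l hl
    choose G hG hG' using fun F' : {F' // F' ∈ Φ} => F'.2
    obtain ⟨q, hq⟩ := exists_holds_of_transfer (fun _ => hB.local_) f g h r
      (l.attach.map fun F' : {F' // F' ∈ l} => G ⟨F'.1, hl F'.1 F'.2⟩) (by
        intro F hF
        obtain ⟨F', -, rfl⟩ := List.mem_map.1 hF
        exact hG _)
    refine ⟨q, fun F hF => ?_⟩
    have := hq (G ⟨F, hl F hF⟩) (List.mem_map.2 ⟨⟨F, hF⟩, List.mem_attach _ _, rfl⟩)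
    have h2 := hG' ⟨F, hl F hF⟩
    dsimp only at h2
    rw [h2, LPFact.holds_map]
    convert this using 3 with s x
    cases x <;> rfl) (by
    intro s v
    obtain ⟨a⟩ := A.nonempty s
    obtain ⟨d, hd⟩ := hB.local_ (r s v) (f s a)
    exact ⟨d, g s a, _, ⟨.loc d (.inr v) (.inl a), hd, rfl⟩, fun q hq => hq⟩)
  have hk' : ∀ F : LPFact L.toLang fun s => A.carrier s ⊕ K,
      F.Holds B (fun s => Sum.elim (f s) (r s)) →
      F.Holds D (fun s => Sum.elim (fun a => ι.toFun s (g s a)) (k s)) := by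
    intro F hF
    have := hk _ ⟨F, hF, rfl⟩
    rw [LPFact.holds_map] at this
    convert this using 3 with s x
    cases x <;> rfl
  choose σ hσ using fun s => (hr s)
  refine ⟨⟨fun s b => k s (σ s b), fun {s} c => ?_, fun R b hb => ?_, fun d a b hab => ?_⟩,
    fun s a => ?_⟩
  · refine (LPFact.holds_const _ _ _ _).1 (hk' (.const (.inr (σ s (B.const c))) c) ?_)
    rw [LPFact.holds_const]
    exact hσ s _
  · refine hk' (.rel R fun i => .inr (σ _ (b i))) ?_
    rw [LPFact.holds_rel]
    simpa only [Sum.elim_inr, hσ] using hb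
  · refine hk' (.loc d (.inr (σ _ a)) (.inr (σ _ b))) ?_
    rw [LPFact.holds_loc]
    simpa only [Sum.elim_inr, hσ] using hab
  · refine (D.loc_one _ _).1 (hk' (.loc 1 (.inr (σ _ (f s a))) (.inl a)) ?_)
    rw [LPFact.holds_loc, Structure.loc_one]
    exact hσ s _

theorem exists_surjective_sigma {L : Lang.{u}} (B : Structure L) (s : L.Srt) :
    ∃ r : (Σ s, B.carrier s) → B.carrier s, Function.Surjective r := by
  classical
  obtain ⟨b⟩ := B.nonempty s
  refine ⟨fun x => if h : x.1 = s then h ▸ x.2 else b, fun a => ⟨⟨s, a⟩, dif_pos rfl⟩⟩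

/-- Homomorphisms between local structures which reflect local positive formulas are positive
embeddings. -/
theorem isStrongEmbedding_of_reflects {A B : Structure L.toLang} (hA : A.IsLocal L)
    (hB : B.IsLocal L) (f : Hom A B)
    (h : ∀ F : LPFact L.toLang A.carrier, F.Holds B f.toFun → F.Holds A fun _ => id) :
    IsStrongEmbedding f := by
  -- Amalgamation over `A`, within the theory of `A`, factors a strong embedding through `f`.
  -- Reflection by the composite gives reflection by `f`.
  obtain ⟨D, ι, hD, hι, H⟩ := exists_amalgam (T := A.negTheory hA) (C := A)
    ⟨hA, fun σ hσ => hσ.2⟩ (Σ s, B.carrier s)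
  obtain ⟨k, hk⟩ := H A B f.toFun (fun _ => id) hB h (exists_surjective_sigma B)
  have hkι : k.comp f = ι := Hom.ext hk
  refine ⟨Hom.IsPositiveEmbedding.of_comp (g := k) (hkι ▸ hι.1), fun X e => ?_⟩
  refine Hom.IsPositiveEmbedding.of_comp
    (g := k.expand (fun s x => f.toFun s (e s x)) (fun s x => ι.toFun s (e s x))
      fun s x => hk s (e s x)) ?_
  subst hkι
  exact hι.2 X e

theorem Hom.IsPositiveEmbedding.isStrongEmbedding {A B : Structure L.toLang} {f : Hom A B}
    (hf : f.IsPositiveEmbedding) (hA : A.IsLocal L) (hB : B.IsLocal L) : IsStrongEmbedding f :=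
  isStrongEmbedding_of_reflects hA hB f fun F hF => hf _ F.isLocalPositive.isPositive _ hF

/-- Every model maps to a model which satisfies all the local positive facts on elements of the
first one which are satisfied in some further model. -/
theorem exists_maximal_hom {T : NegTheory L} {P : Structure L.toLang} (hP : T.IsModel P) :
    ∃ (Q : Structure L.toLang) (i : Hom P Q), T.IsModel Q ∧
      ∀ R : Structure L.toLang, T.IsModel R → ∀ f : Hom Q R, ∀ F : LPFact L.toLang P.carrier,
        F.Holds R (fun s a => f.toFun s (i.toFun s a)) → F.Holds Q i.toFun := by
  -- Zorn's lemma is applied to the sets of facts about `P` that hold in a single model above `P`.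
  -- Any fact true further up could be added to a maximal one.
  obtain ⟨Δ, hΔ⟩ := zorn_subset
    {Δ : Set (LPFact L.toLang P.carrier) | ∃ (Q : Structure L.toLang) (i : Hom P Q),
      T.IsModel Q ∧ ∀ F ∈ Δ, F.Holds Q i.toFun} (by
    intro c hc hchain
    rcases c.eq_empty_or_nonempty with rfl | hne
    · exact ⟨∅, ⟨P, Hom.id P, hP, by simp⟩, by simp⟩
    choose Q i hQ hi using fun Δ : c => hc Δ.2
    have : Nonempty c := hne.to_subtype
    -- The ultrafilter contains all the final segments of the chain, so each fact of the union is
    -- true in almost all factors.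
    obtain ⟨U, hU⟩ := exists_ultrafilter_of_finite (fun Δ : c => {Δ' : c | Δ.1 ⊆ Δ'.1}) (by
      intro t
      exact (directedOn_iff_directed.1 hchain.directedOn).finset_le t)
    refine ⟨⋃₀ c, ⟨localUltraproduct U i, diagHom U i, localUltraproduct_isModel hP.1 hQ, ?_⟩,
      fun Δ hΔ => Set.subset_sUnion_of_mem hΔ⟩
    rintro F ⟨Δ, hΔ, hF⟩
    refine F.isLocalPositive.realize_of_eventually (fun Δ => (hQ Δ).1.comp)
      (fun j => BoundedFamily.diag U i _ (F.e j)) ?_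
    filter_upwards [hU ⟨Δ, hΔ⟩] with Δ' hΔ'
    exact hi Δ' F (hΔ' hF))
  obtain ⟨Q, i, hQ, hi⟩ := hΔ.prop
  refine ⟨Q, i, hQ, fun R hR f F hF => hi F ?_⟩
  refine hΔ.le_of_ge (y := insert F Δ) ⟨R, f.comp i, hR, ?_⟩ (Set.subset_insert _ _)
    (Set.mem_insert _ _)
  rintro G (rfl | hG)
  · exact hF
  · exact (hi G hG).hom f

end Realization

/-! ### Directed colimits of models -/

section Colimit

open CategoryTheory

variable {L : LocalLang.{u}}

/-- The category of local models of `T`. -/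
structure ModelCat (T : NegTheory L) : Type (u + 1) where
  carrier : Structure L.toLang
  isModel : T.IsModel carrier

instance (T : NegTheory L) : Category.{u} (ModelCat T) where
  Hom M N := LocalPositiveLogic.Hom M.carrier N.carrier
  id M := Hom.id M.carrier
  comp f g := Hom.comp g f

variable {T : NegTheory L} {J : Type u} [Preorder J] (F : J ⥤ ModelCat T)

/-- The transition homomorphisms of a diagram of models. -/
def transHom {i j : J} (h : i ≤ j) : Hom (F.obj i).carrier (F.obj j).carrier :=
  F.map (homOfLE h)

theorem transHom_transHom {i j k : J} (h : i ≤ j) (h' : j ≤ k) {s : L.Srt}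
    (a : (F.obj i).carrier.carrier s) :
    (transHom F h').toFun s ((transHom F h).toFun s a) = (transHom F (h.trans h')).toFun s a := by
  have : F.map (homOfLE (h.trans h')) = F.map (homOfLE h) ≫ F.map (homOfLE h') := by
    rw [← F.map_comp]; rfl
  unfold transHom
  rw [this]
  rfl

variable [IsDirectedOrder J]

/-- Eventual equality of elements of a directed system. -/
def colimSetoid (s : L.Srt) : Setoid (Σ j, (F.obj j).carrier.carrier s) where
  r x y := ∃ (k : J) (hx : x.1 ≤ k) (hy : y.1 ≤ k),
    (transHom F hx).toFun s x.2 = (transHom F hy).toFun s y.2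
  iseqv := by
    refine ⟨fun x => ⟨x.1, le_rfl, le_rfl, rfl⟩, fun ⟨k, hx, hy, h⟩ => ⟨k, hy, hx, h.symm⟩, ?_⟩
    rintro x y z ⟨k, hx, hy, h⟩ ⟨k', hy', hz, h'⟩
    obtain ⟨m, hm, hm'⟩ := exists_ge_ge k k'
    refine ⟨m, hx.trans hm, hz.trans hm', ?_⟩
    rw [← transHom_transHom F hx hm, h, transHom_transHom, ← transHom_transHom F hz hm', ← h',
      transHom_transHom]

/-- The class in the colimit of an element of a directed system. -/
def colimMk {s : L.Srt} (j : J) (a : (F.obj j).carrier.carrier s) :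
    Quotient (colimSetoid F s) :=
  Quotient.mk _ ⟨j, a⟩

variable {F}

theorem colimMk_eq {s : L.Srt} {i j : J} {a : (F.obj i).carrier.carrier s}
    {b : (F.obj j).carrier.carrier s} : colimMk F i a = colimMk F j b ↔
    ∃ (k : J) (hx : i ≤ k) (hy : j ≤ k),
    (transHom F hx).toFun s a = (transHom F hy).toFun s b :=
  Quotient.eq (r := colimSetoid F s)

theorem colimMk_transHom {s : L.Srt} {i j : J} (h : i ≤ j) (a : (F.obj i).carrier.carrier s) :
    colimMk F j ((transHom F h).toFun s a) = colimMk F i a :=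
  colimMk_eq.2 ⟨j, le_rfl, h, transHom_transHom F h le_rfl a⟩

theorem exists_colimMk {s : L.Srt} (a : Quotient (colimSetoid F s)) :
    ∃ j₀ : J, ∀ j ≥ j₀, ∃ b, colimMk F j b = a := by
  obtain ⟨⟨j₀, b⟩, rfl⟩ := Quotient.exists_rep a
  exact ⟨j₀, fun j hj => ⟨(transHom F hj).toFun s b, colimMk_transHom hj b⟩⟩

/-- Finitely many identifications take place at one common stage. -/
theorem colimMk_eq_family {n : ℕ} {Γ : Fin n → L.Srt} {i j : J}
    {a : ∀ m, (F.obj i).carrier.carrier (Γ m)} {b : ∀ m, (F.obj j).carrier.carrier (Γ m)}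
    (h : ∀ m, colimMk F i (a m) = colimMk F j (b m)) :
    ∃ (k : J) (hi : i ≤ k) (hj : j ≤ k), ∀ m,
      (transHom F hi).toFun _ (a m) = (transHom F hj).toFun _ (b m) := by
  choose k hi hj hk using fun m => colimMk_eq.1 (h m)
  have : Nonempty J := ⟨i⟩
  obtain ⟨K, hK⟩ := (Set.finite_range k).bddAbove
  obtain ⟨K', h1, h2⟩ := exists_ge_ge i j
  obtain ⟨K'', h3, h4⟩ := exists_ge_ge K K'
  refine ⟨K'', h1.trans h4, h2.trans h4, fun m => ?_⟩
  have hm : k m ≤ K'' := (hK ⟨m, rfl⟩).trans h3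
  rw [← transHom_transHom F (hi m) hm, hk, transHom_transHom]

variable (F) [Nonempty J]

/-- The colimit of a directed diagram of models, as a structure. -/
noncomputable def colimStructure : Structure L.toLang where
  carrier := fun s => Quotient (colimSetoid F s)
  nonempty := fun s => by
    obtain ⟨j⟩ := ‹Nonempty J›
    exact ((F.obj j).carrier.nonempty s).map (colimMk F j)
  const := fun c => colimMk F (Classical.arbitrary J) ((F.obj _).carrier.const c)
  rel := fun {_ ar} R a => ∃ (j : J) (b : ∀ i, (F.obj j).carrier.carrier (ar i)),
    (F.obj j).carrier.rel R b ∧ ∀ i, colimMk F j (b i) = a i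
  loc := fun {s} d a b => ∃ (j : J) (x y : (F.obj j).carrier.carrier s),
    (F.obj j).carrier.loc d x y ∧ colimMk F j x = a ∧ colimMk F j y = b
  loc_one := fun a b => by
    constructor
    · rintro ⟨j, x, y, h, rfl, rfl⟩
      rw [((F.obj j).carrier.loc_one x y).1 h]
    · rintro rfl
      obtain ⟨j, hj⟩ := exists_colimMk a
      obtain ⟨x, hx⟩ := hj j le_rfl
      exact ⟨j, x, x, ((F.obj j).carrier.loc_one x x).2 rfl, hx, hx⟩

/-- The canonical homomorphisms to the colimit. -/
noncomputable def colimHom (j : J) : Hom (F.obj j).carrier (colimStructure F) where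
  toFun := fun _ a => colimMk F j a
  map_const := fun c => by
    obtain ⟨k, h, h'⟩ := exists_ge_ge j (Classical.arbitrary J)
    refine colimMk_eq.2 ⟨k, h, h', ?_⟩
    rw [(transHom F h).map_const, (transHom F h').map_const]
  map_rel := fun R a h => ⟨j, a, h, fun _ => rfl⟩
  map_loc := fun d a b h => ⟨j, a, b, h, rfl, rfl⟩

variable {F}

theorem colimHom_transHom {s : L.Srt} {i j : J} (h : i ≤ j) (a : (F.obj i).carrier.carrier s) :
    (colimHom F j).toFun s ((transHom F h).toFun s a) = (colimHom F i).toFun s a :=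
  colimMk_transHom h a

theorem exists_colimHom {s : L.Srt} (a : (colimStructure F).carrier s) :
    ∃ j₀ : J, ∀ j ≥ j₀, ∃ b, (colimHom F j).toFun s b = a :=
  exists_colimMk a

theorem exists_colimHom_family {n : ℕ} {Γ : Fin n → L.Srt}
    (a : ∀ i, (colimStructure F).carrier (Γ i)) :
    ∃ (j : J) (b : ∀ i, (F.obj j).carrier.carrier (Γ i)),
      (fun i => (colimHom F j).toFun _ (b i)) = a := by
  choose j hj using fun i => exists_colimHom (a i)
  obtain ⟨K, hK⟩ := (Set.finite_range j).bddAbove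
  choose b hb using fun i => hj i K (hK ⟨i, rfl⟩)
  exact ⟨K, b, funext hb⟩

/-- Relations in the colimit hold at some stage. -/
theorem colimStructure_rel {n : ℕ} {ar : Fin n → L.Srt} (R : L.Rel ar) {j : J}
    {b : ∀ i, (F.obj j).carrier.carrier (ar i)}
    (h : (colimStructure F).rel R fun i => (colimHom F j).toFun _ (b i)) :
    ∃ (k : J) (hk : j ≤ k), (F.obj k).carrier.rel R fun i => (transHom F hk).toFun _ (b i) := by
  obtain ⟨i, a, ha, hab⟩ := h
  obtain ⟨k, hi, hj, hk⟩ := colimMk_eq_family hab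
  refine ⟨k, hj, ?_⟩
  simp only [← hk]
  exact (transHom F hi).map_rel R a ha

theorem colimStructure_loc {s : L.Srt} (d : L.Loc s) {j : J}
    {x y : (F.obj j).carrier.carrier s}
    (h : (colimStructure F).loc d ((colimHom F j).toFun _ x) ((colimHom F j).toFun _ y)) :
    ∃ (k : J) (hk : j ≤ k), (F.obj k).carrier.loc d ((transHom F hk).toFun _ x)
      ((transHom F hk).toFun _ y) := by
  obtain ⟨i, a, b, hab, ha, hb⟩ := h
  obtain ⟨k, hi, hj, hk⟩ := colimMk_eq.1 ha
  obtain ⟨k', hi', hj', hk'⟩ := colimMk_eq.1 hb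
  obtain ⟨m, hm, hm'⟩ := exists_ge_ge k k'
  refine ⟨m, hj.trans hm, ?_⟩
  have := (transHom F (hi.trans hm)).map_loc d _ _ hab
  rw [← transHom_transHom F hj hm, ← hk, transHom_transHom F hi hm,
    ← transHom_transHom F hj' hm', ← hk', transHom_transHom F hi' hm']
  exact this

/-- Positive formulas true in the colimit hold at some stage. -/
theorem Formula.IsPositive.exists_stage {n : ℕ} {Γ : Fin n → L.Srt} {φ : Formula L.toLang Γ}
    (hφ : φ.IsPositive) : ∀ {j : J} (b : ∀ i, (F.obj j).carrier.carrier (Γ i)),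
    φ.Realize (colimStructure F) (fun i => (colimHom F j).toFun _ (b i)) →
    ∃ (k : J) (hk : j ≤ k), φ.Realize (F.obj k).carrier fun i => (transHom F hk).toFun _ (b i) := by
  induction hφ with
  | rel R t =>
    intro j b h
    simp only [Formula.Realize, Hom.value] at h ⊢
    exact colimStructure_rel R h
  | loc d t t' =>
    intro j b h
    simp only [Formula.Realize, Hom.value] at h ⊢
    exact colimStructure_loc d h
  | and hφ hψ h1 h2 =>
    intro j b h
    obtain ⟨k, hk, h1⟩ := h1 b h.1
    obtain ⟨k', hk', h2⟩ := h2 b h.2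
    obtain ⟨m, hm, hm'⟩ := exists_ge_ge k k'
    have h1 := (transHom F hm).realize hφ _ h1
    have h2 := (transHom F hm').realize hψ _ h2
    simp only [transHom_transHom] at h1 h2
    exact ⟨m, hk.trans hm, h1, h2⟩
  | or _ _ h1 h2 =>
    intro j b h
    rcases h with h | h
    · obtain ⟨k, hk, h1⟩ := h1 b h
      exact ⟨k, hk, Or.inl h1⟩
    · obtain ⟨k, hk, h2⟩ := h2 b h
      exact ⟨k, hk, Or.inr h2⟩
  | @ex n Γ s φ hφ ih =>
    rintro j b ⟨a, ha⟩
    obtain ⟨i, hi⟩ := exists_colimHom a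
    obtain ⟨k, hj, hik⟩ := exists_ge_ge j i
    obtain ⟨c, rfl⟩ := hi k hik
    have key := Structure.extVal_map (colimHom F k).toFun c
      (fun i => (transHom F hj).toFun _ (b i))
    simp only [colimHom_transHom] at key
    rw [← key] at ha
    obtain ⟨m, hm, h⟩ := ih _ ha
    refine ⟨m, hj.trans hm, (transHom F hm).toFun _ c, ?_⟩
    rw [Structure.extVal_map] at h
    simpa only [transHom_transHom] using h

/-- The locality axioms concern finitely many elements and can be checked at one stage. A negative
sentence that fails in the colimit already fails at some stage. -/
theorem colimStructure_isModel : T.IsModel (colimStructure F) := by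
  refine ⟨⟨?_, ?_, ?_, ?_, ?_⟩, ?_⟩
  · rintro s d _ _ ⟨j, x, y, h, rfl, rfl⟩
    exact ⟨j, y, x, (F.obj j).isModel.1.symm _ _ _ h, rfl, rfl⟩
  · rintro s d d' hd _ _ ⟨j, x, y, h, rfl, rfl⟩
    exact ⟨j, x, y, (F.obj j).isModel.1.mono _ _ hd _ _ h, rfl, rfl⟩
  · rintro s d d' _ _ _ ⟨j, x, y, h, rfl, rfl⟩ ⟨j', y', z, h', hy, rfl⟩
    obtain ⟨k, hk, hk', hkk⟩ := colimMk_eq.1 hy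
    refine ⟨k, (transHom F hk').toFun _ x, (transHom F hk).toFun _ z, ?_,
      colimMk_transHom _ _, colimMk_transHom _ _⟩
    have h1 := (transHom F hk').map_loc _ _ _ h
    have h2 := (transHom F hk).map_loc _ _ _ h'
    rw [hkk] at h2
    exact (F.obj k).isModel.1.comp _ _ _ _ _ h1 h2
  · intro s c c'
    exact ⟨_, _, _, (F.obj _).isModel.1.bound c c', rfl, rfl⟩
  · intro s a b
    obtain ⟨i, hi⟩ := exists_colimHom a
    obtain ⟨j, hj⟩ := exists_colimHom b
    obtain ⟨k, hik, hjk⟩ := exists_ge_ge i j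
    obtain ⟨x, rfl⟩ := hi k hik
    obtain ⟨y, rfl⟩ := hj k hjk
    obtain ⟨d, hd⟩ := (F.obj k).isModel.1.local_ x y
    exact ⟨d, k, x, y, hd, rfl, rfl⟩
  · intro σ hσ
    obtain ⟨φ, hφ, rfl⟩ := T.isNegative σ hσ
    intro h
    obtain ⟨k, _, hk⟩ := hφ.exists_stage (F := F) (j := Classical.arbitrary J)
      (fun i => i.elim0) (by convert h using 2 with i)
    refine (F.obj k).isModel.2 _ hσ ?_
    convert hk using 2

variable (F) in
/-- The colimit cocone. -/
noncomputable def colimCocone : Limits.Cocone F where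
  pt := ⟨colimStructure F, colimStructure_isModel⟩
  ι :=
    { app := fun j => colimHom F j
      naturality := fun _ _ f => Hom.ext fun _ a => colimHom_transHom (leOfHom f) a }

variable (F) in
/-- The homomorphism from the colimit given by a cocone. -/
noncomputable def colimDesc (c : Limits.Cocone F) : Hom (colimStructure F) c.pt.carrier := by
  have hc : ∀ {i j : J} (h : i ≤ j) {s} (a : (F.obj i).carrier.carrier s),
      Hom.toFun (c.ι.app j) s ((transHom F h).toFun s a) = Hom.toFun (c.ι.app i) s a := by
    intro i j h s a
    rw [← c.w (homOfLE h)]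
    rfl
  refine ⟨fun s => Quotient.lift (fun x => Hom.toFun (c.ι.app x.1) s x.2) ?_, ?_, ?_, ?_⟩
  · rintro ⟨i, a⟩ ⟨j, b⟩ ⟨k, hi, hj, h⟩
    change Hom.toFun (c.ι.app i) s a = Hom.toFun (c.ι.app j) s b
    rw [← hc hi, ← hc hj]
    exact congrArg _ h
  · intro s x
    exact Hom.map_const (c.ι.app (Classical.arbitrary J)) x
  · rintro n ar R a ⟨j, b, hb, h⟩
    obtain rfl : (fun i => colimMk F j (b i)) = a := funext h
    exact Hom.map_rel (c.ι.app j) R b hb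
  · rintro s d _ _ ⟨j, x, y, h, rfl, rfl⟩
    exact Hom.map_loc (c.ι.app j) d x y h

variable (F) in
/-- The colimit cocone is universal. -/
noncomputable def colimIsColimit : Limits.IsColimit (colimCocone F) where
  desc c := colimDesc F c
  fac c j := rfl
  uniq c m hm := by
    refine Hom.ext fun s a => ?_
    obtain ⟨i, hi⟩ := exists_colimHom a
    obtain ⟨x, rfl⟩ := hi i le_rfl
    have h := hm i
    have h' : Hom.toFun ((colimCocone F).ι.app i ≫ m) s x = Hom.toFun (c.ι.app i) s x := by
      rw [h]
    exact h'

theorem ModelCat.hasColimitsOfShape (T : NegTheory L) (J : Type u) [Preorder J]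
    [IsDirectedOrder J] [Nonempty J] : Limits.HasColimitsOfShape J (ModelCat T) :=
  ⟨fun F => ⟨⟨colimCocone F, colimIsColimit F⟩⟩⟩

instance (T : NegTheory L) (J : Type u) [LinearOrder J] [Nonempty J] :
    Limits.HasIterationOfShape J (ModelCat T) where
  hasColimitsOfShape_of_isSuccLimit j hj := by
    obtain ⟨i, hi⟩ := not_isMin_iff.1 hj.not_isMin
    have : Nonempty (Set.Iio j) := ⟨⟨i, hi⟩⟩
    exact ModelCat.hasColimitsOfShape T _
  hasColimitsOfShape := ModelCat.hasColimitsOfShape T J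

end Colimit

/-- Transfinite iteration of a construction on models. -/
theorem exists_iteration {L : LocalLang.{u}} {T : NegTheory L} (S : ModelCat T → ModelCat T)
    (i : ∀ P : ModelCat T, Hom P.carrier (S P).carrier) (P : ModelCat T)
    (κ : Cardinal.{u}) (hκ : Cardinal.aleph0 ≤ κ) :
    ∃ F : CategoryTheory.Functor κ.ord.ToType (ModelCat T), ∃ j₀ : κ.ord.ToType,
      Nonempty (Hom P.carrier (F.obj j₀).carrier) ∧
      ∀ j, ∃ (k : κ.ord.ToType) (hk : j ≤ k) (e : Hom (S (F.obj j)).carrier (F.obj k).carrier),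
        transHom F hk = e.comp (i (F.obj j)) := by
  open CategoryTheory in
  have h0 : κ.ord ≠ 0 := by
    rw [Ne, Cardinal.ord_eq_zero]
    exact (Cardinal.aleph0_pos.trans_le hκ).ne'
  have : Nonempty κ.ord.ToType := Ordinal.nonempty_toType_iff.2 h0
  let _ := WellFoundedLT.toOrderBot κ.ord.ToType
  have := Cardinal.noMaxOrder hκ
  -- The iteration takes colimits at limit stages. The index order has no maximum, so every stage is
  -- followed by one application of `S`.
  let Φ : SmallObject.SuccStruct (ModelCat T) := ⟨P, S, i⟩
  refine ⟨Φ.iterationFunctor κ.ord.ToType, ⊥,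
    ⟨(Φ.iterationFunctorObjBotIso κ.ord.ToType).inv⟩, fun j => ?_⟩
  refine ⟨Order.succ j, Order.le_succ j, (Φ.iterationFunctorObjSuccIso j (not_isMax j)).inv, ?_⟩
  exact Φ.iterationFunctor_map_succ j (not_isMax j)

/-! ### Counting formulas -/

section Counting

open Cardinal

theorem mk_sigma_le_of_le {ι : Type u} {f : ι → Type u} {lam : Cardinal.{u}} (h0 : ℵ₀ ≤ lam)
    (hι : #ι ≤ lam) (hf : ∀ i, #(f i) ≤ lam) : #(Σ i, f i) ≤ lam := by
  rw [mk_sigma]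
  refine (sum_le_sum _ (fun _ => lam) hf).trans ?_
  rw [sum_const']
  exact mul_le_of_le h0 hι le_rfl

theorem mk_sigma_nat_le_of_le {f : ℕ → Type u} {lam : Cardinal.{u}} (h0 : ℵ₀ ≤ lam)
    (hf : ∀ i, #(f i) ≤ lam) : #(Σ i, f i) ≤ lam := by
  rw [mk_sigma]
  refine (sum_le_sum _ (fun _ => lam) hf).trans ?_
  rw [sum_const]
  exact mul_le_of_le h0 (by simpa using h0) (by simp)

theorem mk_pi_fin_le_of_le {n : ℕ} {f : Fin n → Type u} {lam : Cardinal.{u}} (h0 : ℵ₀ ≤ lam)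
    (hf : ∀ i, #(f i) ≤ lam) : #(∀ i, f i) ≤ lam := by
  rw [mk_pi]
  refine (prod_le_prod _ (fun _ => lam) hf).trans ?_
  rw [prod_const]
  simpa using power_nat_le h0

theorem mk_prod_le_of_le {α β : Type u} {lam : Cardinal.{u}} (h0 : ℵ₀ ≤ lam)
    (hα : #α ≤ lam) (hβ : #β ≤ lam) : #(α × β) ≤ lam := by
  rw [mk_prod, lift_id, lift_id]
  exact mul_le_of_le h0 hα hβ

theorem mk_sum_le_of_le {α β : Type u} {lam : Cardinal.{u}} (h0 : ℵ₀ ≤ lam)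
    (hα : #α ≤ lam) (hβ : #β ≤ lam) : #(α ⊕ β) ≤ lam := by
  rw [mk_sum, lift_id, lift_id]
  exact add_le_of_le h0 hα hβ

variable {L : Lang.{u}}

theorem Lang.aleph0_le_card : ℵ₀ ≤ L.card := by
  unfold Lang.card
  simp only [add_assoc]
  exact self_le_add_right _ _

theorem Lang.mk_srt_le : #L.Srt ≤ L.card := by
  unfold Lang.card
  calc #L.Srt ≤ ℵ₀ + #L.Srt := self_le_add_left _ _
    _ ≤ _ := by
      simp only [add_assoc]
      exact add_le_add_right (self_le_add_right _ _) _

theorem Lang.mk_const_le : #(Σ s, L.Const s) ≤ L.card := by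
  unfold Lang.card
  refine le_trans ?_ (self_le_add_right _ _)
  refine le_trans ?_ (self_le_add_right _ _)
  exact self_le_add_left _ _

theorem Lang.mk_rel_le : #(Σ n : ℕ, Σ ar : Fin n → L.Srt, L.Rel ar) ≤ L.card := by
  unfold Lang.card
  refine le_trans ?_ (self_le_add_right _ _)
  exact self_le_add_left _ _

theorem Lang.mk_loc_le : #(Σ s, L.Loc s) ≤ L.card := self_le_add_left _ _

theorem Lang.mk_term_le {n : ℕ} (Γ : Fin n → L.Srt) (s : L.Srt) : #(Term L Γ s) ≤ L.card := by
  refine le_trans (mk_le_of_surjective (α := {i : ULift.{u} (Fin n) // Γ i.1 = s} ⊕ L.Const s)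
    (f := Sum.elim (fun i => i.2 ▸ .var i.1.1) .const) ?_)
    (mk_sum_le_of_le Lang.aleph0_le_card ?_ ?_)
  · rintro (i | c)
    · exact ⟨.inl ⟨⟨i⟩, rfl⟩, rfl⟩
    · exact ⟨.inr c, rfl⟩
  · refine (mk_subtype_le _).trans ?_
    simp only [mk_uLift, mk_fin, lift_natCast]
    exact natCast_lt_aleph0.le.trans Lang.aleph0_le_card
  · refine le_trans (mk_le_of_injective (f := fun c => (⟨s, c⟩ : Σ s, L.Const s)) ?_) L.mk_const_le
    exact fun a b h => by simpa using h

/-- The depth of a formula. -/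
def Formula.depth : {n : ℕ} → {Γ : Fin n → L.Srt} → Formula L Γ → ℕ
  | _, _, .rel _ _ => 0
  | _, _, .loc _ _ _ => 0
  | _, _, .neg φ => φ.depth + 1
  | _, _, .and φ ψ => max φ.depth ψ.depth + 1
  | _, _, .or φ ψ => max φ.depth ψ.depth + 1
  | _, _, .ex _ φ => φ.depth + 1

/-- A quantifier changes the context, so the induction bounds the formulas of all contexts at once,
with one summand of `X` for each constructor. -/
theorem Lang.mk_formula_depth_le (k : ℕ) : ∀ {n : ℕ} (Γ : Fin n → L.Srt),
    #{φ : Formula L Γ // φ.depth < k} ≤ L.card := by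
  induction k with
  | zero => intro n Γ; simp
  | succ k ih =>
    intro n Γ
    have h0 := L.aleph0_le_card
    let X : Type u := ((Σ R : (Σ n : ℕ, Σ ar : Fin n → L.Srt, L.Rel ar), ∀ i, Term L Γ (R.2.1 i)) ⊕
      (Σ d : (Σ s, L.Loc s), Term L Γ d.1 × Term L Γ d.1)) ⊕
      ({φ : Formula L Γ // φ.depth < k} ⊕
      ((({φ : Formula L Γ // φ.depth < k} × {φ : Formula L Γ // φ.depth < k}) ⊕
      ({φ : Formula L Γ // φ.depth < k} × {φ : Formula L Γ // φ.depth < k})) ⊕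
      (Σ s, {φ : Formula L (L.ext s Γ) // φ.depth < k})))
    have hX : #X ≤ L.card := by
      refine mk_sum_le_of_le h0 (mk_sum_le_of_le h0 ?_ ?_) (mk_sum_le_of_le h0 (ih Γ)
        (mk_sum_le_of_le h0 (mk_sum_le_of_le h0 (mk_prod_le_of_le h0 (ih Γ) (ih Γ))
          (mk_prod_le_of_le h0 (ih Γ) (ih Γ)))
          (mk_sigma_le_of_le h0 L.mk_srt_le fun s => ih _)))
      · exact mk_sigma_le_of_le h0 L.mk_rel_le fun R =>
          mk_pi_fin_le_of_le h0 fun i => L.mk_term_le _ _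
      · exact mk_sigma_le_of_le h0 L.mk_loc_le fun d =>
          mk_prod_le_of_le h0 (L.mk_term_le _ _) (L.mk_term_le _ _)
    let g : X → Formula L Γ
      | .inl (.inl x) => .rel x.1.2.2 x.2
      | .inl (.inr x) => .loc x.1.2 x.2.1 x.2.2
      | .inr (.inl φ) => .neg φ.1
      | .inr (.inr (.inl (.inl x))) => .and x.1.1 x.2.1
      | .inr (.inr (.inl (.inr x))) => .or x.1.1 x.2.1
      | .inr (.inr (.inr x)) => .ex x.1 x.2.1
    have hg : {φ : Formula L Γ | φ.depth < k + 1} ⊆ Set.range g := by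
      intro φ hφ
      cases φ with
      | rel R t => exact ⟨.inl (.inl ⟨⟨_, _, R⟩, t⟩), rfl⟩
      | loc d t t' => exact ⟨.inl (.inr ⟨⟨_, d⟩, t, t'⟩), rfl⟩
      | neg φ =>
        simp only [Set.mem_ofPred_eq, Formula.depth, Nat.add_lt_add_iff_right] at hφ
        exact ⟨.inr (.inl ⟨φ, hφ⟩), rfl⟩
      | and φ ψ =>
        simp only [Set.mem_ofPred_eq, Formula.depth, Nat.add_lt_add_iff_right, max_lt_iff] at hφ
        exact ⟨.inr (.inr (.inl (.inl ⟨⟨φ, hφ.1⟩, ⟨ψ, hφ.2⟩⟩))), rfl⟩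
      | or φ ψ =>
        simp only [Set.mem_ofPred_eq, Formula.depth, Nat.add_lt_add_iff_right, max_lt_iff] at hφ
        exact ⟨.inr (.inr (.inl (.inr ⟨⟨φ, hφ.1⟩, ⟨ψ, hφ.2⟩⟩))), rfl⟩
      | ex s φ =>
        simp only [Set.mem_ofPred_eq, Formula.depth, Nat.add_lt_add_iff_right] at hφ
        exact ⟨.inr (.inr (.inr ⟨s, φ, hφ⟩)), rfl⟩
    exact (mk_le_mk_of_subset hg).trans (mk_range_le.trans hX)

theorem Lang.mk_formula_le {n : ℕ} (Γ : Fin n → L.Srt) : #(Formula L Γ) ≤ L.card := by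
  have h := mk_sigma_nat_le_of_le L.aleph0_le_card fun k => L.mk_formula_depth_le k Γ
  refine (mk_le_of_surjective (f := fun x : Σ k, {φ : Formula L Γ // φ.depth < k} => x.2.1)
    fun φ => ?_).trans h
  exact ⟨⟨_, φ, Nat.lt_succ_self _⟩, rfl⟩

theorem Structure.mk_carrier_le (M : Structure L) (s : L.Srt) : #(M.carrier s) ≤ M.card :=
  mk_le_of_injective (f := fun a => (⟨s, a⟩ : Σ s, M.carrier s)) fun a b h => by simpa using h

end Counting

/-! ### Small positive substructures -/

section LowenheimSkolem

open Cardinal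

variable {L : Lang.{u}}

/-- A set which contains a given set and is closed under given finitary operations. -/
theorem exists_closed_set {X : Type u} {K : ℕ → Type u} (op : ∀ {n}, K n → (Fin n → X) → X)
    {lam : Cardinal.{u}} (h0 : ℵ₀ ≤ lam) (hK : ∀ n, #(K n) ≤ lam) (X₀ : Set X) (hX₀ : #X₀ ≤ lam) :
    ∃ S : Set X, X₀ ⊆ S ∧ #S ≤ lam ∧ ∀ {n} (k : K n) (x : Fin n → X), (∀ i, x i ∈ S) →
      op k x ∈ S := by
  -- The operations are viewed as function symbols, and the required set is the substructure
  -- generated by `X₀`.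
  let 𝓛 : FirstOrder.Language.{u, 0} := ⟨K, fun _ => Empty⟩
  let _ : 𝓛.Structure X := ⟨fun k x => op k x, fun r => r.elim⟩
  refine ⟨(FirstOrder.Language.Substructure.closure 𝓛 X₀ : Set X),
    FirstOrder.Language.Substructure.subset_closure, ?_, fun k x hx => ?_⟩
  · have := FirstOrder.Language.Substructure.lift_card_closure_le (L := 𝓛) (s := X₀)
    simp only [lift_id] at this
    refine this.trans (max_le h0 (add_le_of_le h0 hX₀ ?_))
    exact mk_sigma_nat_le_of_le h0 hK
  · exact (FirstOrder.Language.Substructure.closure 𝓛 X₀).fun_mem k x hx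

/-- The restriction of a structure to a family of subsets. -/
def Structure.restrict (N : Structure L) (S : ∀ s, Set (N.carrier s)) (hne : ∀ s, (S s).Nonempty)
    (hc : ∀ {s} (c : L.Const s), N.const c ∈ S s) : Structure L where
  carrier := fun s => S s
  nonempty := fun s => (hne s).to_subtype
  const := fun c => ⟨N.const c, hc c⟩
  rel := fun R a => N.rel R fun i => (a i).1
  loc := fun d a b => N.loc d a.1 b.1
  loc_one := fun _ _ => (N.loc_one _ _).trans Subtype.ext_iff.symm

/-- The inclusion of a restriction. -/
def Structure.restrictHom (N : Structure L) (S : ∀ s, Set (N.carrier s))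
    (hne : ∀ s, (S s).Nonempty) (hc : ∀ {s} (c : L.Const s), N.const c ∈ S s) :
    Hom (N.restrict S hne hc) N where
  toFun := fun _ a => a.1
  map_const := fun _ => rfl
  map_rel := fun _ _ h => h
  map_loc := fun _ _ _ h => h

/-- This is the Tarski–Vaught test for positive formulas. -/
theorem Structure.restrictHom_isPositiveEmbedding (N : Structure L) (S : ∀ s, Set (N.carrier s))
    (hne : ∀ s, (S s).Nonempty) (hc : ∀ {s} (c : L.Const s), N.const c ∈ S s)
    (hS : ∀ {n : ℕ} {Γ : Fin n → L.Srt} {s : L.Srt} (φ : Formula L (L.ext s Γ))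
      (v : ∀ i, N.carrier (Γ i)), (∀ i, v i ∈ S (Γ i)) → (∃ a, φ.Realize N (N.extVal a v)) →
      ∃ a ∈ S s, φ.Realize N (N.extVal a v)) :
    (N.restrictHom S hne hc).IsPositiveEmbedding := by
  intro n Γ φ hφ
  induction hφ with
  | rel R t =>
    intro a h
    simp only [Formula.Realize, Hom.value] at h ⊢
    exact h
  | loc d t t' =>
    intro a h
    simp only [Formula.Realize, Hom.value] at h ⊢
    exact h
  | and _ _ h1 h2 => exact fun a h => ⟨h1 a h.1, h2 a h.2⟩
  | or _ _ h1 h2 => exact fun a h => h.imp (h1 a) (h2 a)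
  | ex s _ ih =>
    rintro v h
    obtain ⟨a, ha, h⟩ := hS _ _ (fun i => (v i).2) h
    refine ⟨⟨a, ha⟩, ih _ ?_⟩
    exact (congrArg (Formula.Realize N _) (Structure.extVal_map (M := N.restrict S hne hc)
      (N.restrictHom S hne hc).toFun ⟨a, ha⟩ v)).mpr h

/-- A downward Löwenheim–Skolem argument: close `X₀` under Skolem functions, of which there are at
most `lam`. -/
theorem exists_small_positive_substructure (N : Structure L) {lam : Cardinal.{u}}
    (hL : L.card ≤ lam) (X₀ : Set (Σ s, N.carrier s)) (hX₀ : #X₀ ≤ lam) :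
    ∃ (A : Structure L) (i : Hom A N), i.IsPositiveEmbedding ∧ A.card ≤ lam ∧
      ∀ x ∈ X₀, ∃ a, i.toFun x.1 a = x.2 := by
  classical
  have h0 := L.aleph0_le_card.trans hL
  let K : ℕ → Type u := fun n => Σ Γ : Fin n → L.Srt, Σ s, Formula L (L.ext s Γ)
  -- The operation returns a witness of the formula if the arguments have the sorts of the context
  -- and a witness exists, and any element of the sort otherwise.
  let op : ∀ {n}, K n → (Fin n → Σ s, N.carrier s) → Σ s, N.carrier s := fun {n} k x =>
    if h : ∃ a : N.carrier k.2.1, ∃ v : ∀ i, N.carrier (k.1 i),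
      (∀ i, x i = ⟨k.1 i, v i⟩) ∧ k.2.2.Realize N (N.extVal a v) then ⟨k.2.1, h.choose⟩
    else ⟨k.2.1, (N.nonempty _).some⟩
  obtain ⟨S, hXS, hS, hop⟩ := exists_closed_set op h0 (fun n =>
    mk_sigma_le_of_le h0 (mk_pi_fin_le_of_le h0 fun _ => L.mk_srt_le.trans hL) fun Γ =>
      mk_sigma_le_of_le h0 (L.mk_srt_le.trans hL) fun s => (L.mk_formula_le _).trans hL) X₀ hX₀
  have key : ∀ {n : ℕ} {Γ : Fin n → L.Srt} {s : L.Srt} (φ : Formula L (L.ext s Γ))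
      (v : ∀ i, N.carrier (Γ i)), (∀ i, (⟨Γ i, v i⟩ : Σ s, N.carrier s) ∈ S) →
      (∃ a, φ.Realize N (N.extVal a v)) →
      ∃ a, (⟨s, a⟩ : Σ s, N.carrier s) ∈ S ∧ φ.Realize N (N.extVal a v) := by
    rintro n Γ s φ v hv ⟨a, ha⟩
    have h : ∃ a : N.carrier s, ∃ w : ∀ i, N.carrier (Γ i),
        (∀ i, (⟨Γ i, v i⟩ : Σ s, N.carrier s) = ⟨Γ i, w i⟩) ∧ φ.Realize N (N.extVal a w) :=
      ⟨a, v, fun _ => rfl, ha⟩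
    have hmem := hop (n := n) ⟨Γ, s, φ⟩ (fun i => ⟨Γ i, v i⟩) hv
    have hopeq : op (n := n) ⟨Γ, s, φ⟩ (fun i => ⟨Γ i, v i⟩) = ⟨s, h.choose⟩ := dif_pos h
    rw [hopeq] at hmem
    refine ⟨_, hmem, ?_⟩
    obtain ⟨w, hw, hw'⟩ := h.choose_spec
    obtain rfl : v = w := funext fun i => by simpa using hw i
    exact hw'
  -- Constants are caught by the formula `x = c` in the empty context; below, `x = x` gives nonempty
  -- sorts.
  have hc : ∀ {s} (c : L.Const s), (⟨s, N.const c⟩ : Σ s, N.carrier s) ∈ S := by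
    intro s c
    obtain ⟨a, ha, h⟩ := key (Γ := Fin.elim0) (s := s)
      (.loc 1 (.var (Γ := L.ext s Fin.elim0) 0) (.const c)) (fun i => i.elim0)
      (fun i => i.elim0) ⟨N.const c, (N.loc_one _ _).2 rfl⟩
    obtain rfl : a = N.const c := (N.loc_one _ _).1 h
    exact ha
  have hne : ∀ s, {a | (⟨s, a⟩ : Σ s, N.carrier s) ∈ S}.Nonempty := by
    intro s
    obtain ⟨a, ha, -⟩ := key (Γ := Fin.elim0) (s := s)
      (.loc 1 (.var (Γ := L.ext s Fin.elim0) 0) (.var (Γ := L.ext s Fin.elim0) 0))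
      (fun i => i.elim0) (fun i => i.elim0) ⟨(N.nonempty s).some, (N.loc_one _ _).2 rfl⟩
    exact ⟨a, ha⟩
  refine ⟨N.restrict (fun s => {a | (⟨s, a⟩ : Σ s, N.carrier s) ∈ S}) hne hc,
    N.restrictHom _ hne hc, N.restrictHom_isPositiveEmbedding _ hne hc key, ?_,
    fun x hx => ⟨⟨x.2, hXS hx⟩, rfl⟩⟩
  refine le_trans (mk_le_of_injective (β := S) (f := fun x => ⟨⟨x.1, x.2.1⟩, x.2.2⟩) ?_) hS
  rintro ⟨s, a, ha⟩ ⟨r, b, hb⟩ h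
  simp only [Subtype.mk.injEq] at h
  cases h
  rfl

theorem Hom.IsPositiveEmbedding.isLocal {L : LocalLang.{u}} {A N : Structure L.toLang}
    {f : Hom A N} (hf : f.IsPositiveEmbedding) (hN : N.IsLocal L) : A.IsLocal L where
  symm := fun d a b h => by
    rw [← hf.loc_iff] at h ⊢
    exact hN.symm _ _ _ h
  mono := fun d d' hd a b h => by
    rw [← hf.loc_iff] at h ⊢
    exact hN.mono _ _ hd _ _ h
  comp := fun d d' a b c h h' => by
    rw [← hf.loc_iff] at h h' ⊢
    exact hN.comp _ _ _ _ _ h h'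
  bound := fun c c' => by
    rw [← hf.loc_iff, f.map_const, f.map_const]
    exact hN.bound c c'
  local_ := fun a b => by
    obtain ⟨d, hd⟩ := hN.local_ (f.toFun _ a) (f.toFun _ b)
    exact ⟨d, hf.loc_iff d a b |>.1 hd⟩

theorem Hom.IsPositiveEmbedding.isModel {L : LocalLang.{u}} {T : NegTheory L}
    {A N : Structure L.toLang} {f : Hom A N} (hf : f.IsPositiveEmbedding) (hN : T.IsModel N) :
    T.IsModel A :=
  ⟨hf.isLocal hN.1, fun σ hσ =>
    Structure.satisfies_neg_of_hom f (T.isNegative σ hσ) (hN.2 σ hσ)⟩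

end LowenheimSkolem

/-! ### Existence of ultrahomogeneous positively closed models -/

section Existence

open Cardinal

variable {L : LocalLang.{u}}

/-- A successor cardinal is regular, so no family indexed by at most `lam` elements is unbounded. -/
theorem exists_upper_bound_ord {lam : Cardinal.{u}} (h0 : ℵ₀ ≤ lam) {ι : Type u}
    (hι : #ι ≤ lam) (f : ι → (Order.succ lam).ord.ToType) : ∃ j, ∀ i, f i ≤ j := by
  by_contra! hs
  have h : Function.Surjective (fun i => (⟨f i, i, rfl⟩ : Set.range f)) := by
    rintro ⟨_, i, rfl⟩; exact ⟨i, rfl⟩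
  have : Order.succ lam ≤ lam := by
    rw [← (isRegular_succ h0).cof_ord, ← Ordinal.cof_toType]
    refine (Order.cof_le fun j => ?_).trans ((mk_le_of_surjective h).trans hι)
    obtain ⟨k, hk⟩ := hs j
    exact ⟨_, Set.mem_range_self k, hk.le⟩
  exact (Order.lt_succ lam).not_ge this

theorem exists_surjective_out {lam : Cardinal.{u}} {α : Type u} [Nonempty α] (h : #α ≤ lam) :
    ∃ r : lam.out → α, Function.Surjective r := by
  rw [← mk_out lam] at h
  obtain ⟨e⟩ := h
  exact ⟨Function.invFun e, Function.invFun_surjective e.injective⟩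

/-- Every model maps to an ultrahomogeneous positively closed model. -/
theorem exists_pc_ultrahomogeneous {T : NegTheory L} {P : Structure L.toLang} (hP : T.IsModel P)
    {lam : Cardinal.{u}} (hL : L.card ≤ lam) :
    ∃ N : Structure L.toLang, T.IsPCModel N ∧ T.IsUltrahomogeneous (Order.succ lam) N ∧
      Nonempty (Hom P N) := by
  have h0 := L.toLang.aleph0_le_card.trans hL
  -- One step of the iteration first makes local positive facts about the old elements maximal,
  -- which yields positive closedness. It then amalgamates with all models of size at most `lam`,
  -- which yields ultrahomogeneity.
  choose Q i hQ hmax using fun P : ModelCat T => exists_maximal_hom P.isModel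
  choose D ι hD _ hamalg using fun P : ModelCat T => exists_amalgam (hQ P) lam.out
  obtain ⟨F, j₀, ⟨p⟩, hF⟩ := exists_iteration (fun P => ⟨D P, hD P⟩)
    (fun P => (ι P).comp (i P)) ⟨P, hP⟩ (Order.succ lam) (h0.trans (Order.le_succ _))
  have : Nonempty (Order.succ lam).ord.ToType := ⟨j₀⟩
  let N := colimStructure F
  have hN : T.IsModel N := colimStructure_isModel
  have key : ∀ j, ∃ e : Hom (D (F.obj j)) N, ∀ s a,
      e.toFun s ((ι (F.obj j)).toFun s ((i (F.obj j)).toFun s a)) =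
        (colimHom F j).toFun s a := by
    intro j
    obtain ⟨k, hk, e, he⟩ := hF j
    refine ⟨(colimHom F k).comp e, fun s a => ?_⟩
    have h2 := congrArg (fun f => f.toFun s a) he
    exact (congrArg ((colimHom F k).toFun s) h2.symm).trans (colimHom_transHom hk a)
  choose e he using key
  refine ⟨N, ⟨hN, fun R hR f => ?_⟩, ⟨hN, fun A B hB hA hBc f g hf => ?_⟩, ⟨(colimHom F j₀).comp p⟩⟩
  · refine (isStrongEmbedding_of_reflects hN.1 hR.1 f fun G hG => ?_).1
    obtain ⟨φ, hφ, a⟩ := G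
    -- The parameters live at a stage `j`. A fact about them true in `R` was already true in the
    -- maximal model after stage `j`, and hence holds in `N`.
    obtain ⟨j, b, rfl⟩ := exists_colimHom_family (F := F) a
    have hQ := hmax (F.obj j) R hR (f.comp ((e j).comp (ι _))) ⟨φ, hφ, b⟩ (by
      unfold LPFact.Holds
      simp only [Hom.comp, he]
      exact hG)
    have := hQ.hom ((e j).comp (ι _))
    unfold LPFact.Holds at this ⊢
    simp only [Hom.comp, he] at this
    exact this
  · have hAc : #(Σ s, A.carrier s) ≤ lam := Order.lt_succ_iff.1 hA
    have hBc : B.card ≤ lam := Order.lt_succ_iff.1 hBc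
    choose j hj using fun x : Σ s, A.carrier s => exists_colimHom (F := F) (f.toFun x.1 x.2)
    obtain ⟨J, hJ⟩ := exists_upper_bound_ord h0 hAc j
    choose f' hf' using fun s a => hj ⟨s, a⟩ J (hJ ⟨s, a⟩)
    -- To amalgamate, facts true in `B` about `A` must hold in the maximal model `Q` after stage
    -- `J`. The models `B` and `Q` are first mapped to a common `D₀` over `A`, and maximality of `Q`
    -- brings facts down from `D₀`.
    obtain ⟨D₀, ι₀, hD₀, -, H⟩ := exists_amalgam hB (Σ s, (Q (F.obj J)).carrier s)
    obtain ⟨k, hk⟩ := H A (Q (F.obj J)) (fun s a => (i (F.obj J)).toFun s (f' s a)) g.toFun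
      (hQ _).1 (by
        intro G hG
        have h1 := hG.hom ((e J).comp (ι _))
        unfold LPFact.Holds at h1
        simp only [Hom.comp, he, hf'] at h1
        exact LPFact.Holds.hom (F := G) (q := fun _ => id)
          (hf G.φ G.isLocalPositive.isPositive _ h1) g)
      (exists_surjective_sigma _)
    obtain ⟨h, hh⟩ := hamalg (F.obj J) A B g.toFun (fun s a => (i (F.obj J)).toFun s (f' s a)) hB.1
      (by
        intro G hG
        refine hmax (F.obj J) D₀ hD₀ k (G.map f') ?_
        rw [LPFact.holds_map]
        simp only [hk]
        exact hG.hom ι₀)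
      (fun s => by
        have := B.nonempty s
        exact exists_surjective_out ((B.mk_carrier_le s).trans hBc))
    refine ⟨(e J).comp h, fun s a => ?_⟩
    simp only [Hom.comp, hh, he, hf']

end Existence

/-! ### Compactness of balls -/

section CompactBalls

open Filter Topology

variable {L : LocalLang.{u}}

theorem Structure.isClosed_logicTopology {L : Lang.{u}} {M : Structure L} {s : L.Srt}
    {D : Set (M.carrier s)} :
    IsClosed[M.logicTopology s] D ↔
      D = ∅ ∨ ∃ S : Set (Formula (L.withElements M) (fun _ : Fin 1 => s)),
        (∀ φ ∈ S, φ.IsLocalPositive) ∧ D = M.definedBy s S := by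
  rw [← @isOpen_compl_iff _ _ (M.logicTopology s)]
  change Dᶜᶜ ∈ _ ↔ _
  rw [compl_compl]
  exact Iff.rfl

/-- The balls of a retractor are compact. -/
theorem NegTheory.IsRetractor.hasCompactBalls {T : NegTheory L} {C : Structure L.toLang}
    (hC : T.IsRetractor C) : C.HasCompactBalls := by
  intro s d a
  let _ := C.logicTopology s
  rw [isCompact_iff_ultrafilter_le_nhds]
  intro U hU
  have hball : ∀ᶠ x in (U : Filter (C.carrier s)), C.loc d a x := le_principal_iff.1 hU
  let p : C.carrier s → Hom C C := fun _ => Hom.id C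
  -- The identity family is the generic point of `U`. It is bounded because `U` concentrates on the
  -- ball.
  let x : BoundedFamily U p s := ⟨id, d, a, hball.mono fun _ h => hC.1.1.symm _ _ _ h⟩
  obtain ⟨g, hg⟩ := hC.2 _ (localUltraproduct_isModel hC.1.1 fun _ => hC.1) (diagHom U p)
  refine ⟨g.toFun s x.mk, ?_, ?_⟩
  · have : (localUltraproduct U p).loc d ((diagHom U p).toFun s a) x.mk :=
      (localUltraproduct_loc d _ x).2 hball
    have := g.map_loc d _ _ this
    rwa [hg] at this
  · rw [le_nhds_iff]
    intro O hO hOo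
    by_contra hn
    have hn : Oᶜ ∈ (U : Filter (C.carrier s)) := Ultrafilter.compl_mem_iff_notMem.2 hn
    have hcl : IsClosed Oᶜ := isClosed_compl_iff.2 hOo
    rcases Structure.isClosed_logicTopology.1 hcl with h | ⟨S, hS, h⟩
    · rw [h] at hn
      exact U.neBot.ne (empty_mem_iff_bot.1 hn)
    · refine absurd hO (?_ : g.toFun s x.mk ∈ Oᶜ)
      rw [h]
      intro φ hφ
      have hev : ∀ᶠ b in (U : Filter (C.carrier s)), φ.Realize C.withElements fun _ => b := by
        filter_upwards [hn] with b hb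
        rw [h] at hb
        exact hb φ hφ
      -- The formula has parameters, so the generic point is read in the ultrapower of the
      -- expansion. The retraction fixes the parameters, so it carries the formula back to the
      -- candidate limit.
      let y : BoundedFamily U (expandHom p (A := C.carrier) fun _ => id) s := x
      have h1 := (hS φ hφ).realize_of_eventually (U := U)
        (p := expandHom p (A := C.carrier) fun _ => id)
        (fun _ => hC.1.1.comp) (fun _ => y) hev
      have h2 := (localUltraproductExpand U p (A := C.carrier) fun _ => id).realize
        (hS φ hφ).isPositive _ h1
      have h3 := (g.expand (A := C.carrier) (fun s a => (diagHom U p).toFun s a) (fun _ => id)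
        (fun s a => hg s a)).realize (hS φ hφ).isPositive _ h2
      exact h3

/-- Sets defined by a local positive formula with parameters are closed. -/
theorem Structure.isClosed_realize {L : Lang.{u}} {N : Structure L} {s : L.Srt} {n : ℕ}
    {Γ : Fin n → L.Srt} {φ : Formula L (L.ext s Γ)} (hφ : φ.IsLocalPositive)
    (v : ∀ i, N.carrier (Γ i)) :
    IsClosed[N.logicTopology s] {y | φ.Realize N (N.extVal y v)} := by
  obtain ⟨ψ, hψ, hψ'⟩ := hφ.exists_rename_withConstants (A := N.carrier)
    (Γ' := fun _ : Fin 1 => s)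
    (Fin.cons (α := fun i => Term (L.withConstants N.carrier) (fun _ : Fin 1 => s) (L.ext s Γ i))
      (.var (L := L.withConstants N.carrier) (Γ := fun _ : Fin 1 => s) 0)
      fun i => .const (L := L.withConstants N.carrier) (.inr (v i)))
  refine Structure.isClosed_logicTopology.2 (Or.inr ⟨{ψ}, by rintro _ rfl; exact hψ, ?_⟩)
  ext y
  have h := hψ' N (fun _ => id) (fun _ => y)
  have hv : (fun i => Term.value (N.expand (A := N.carrier) fun _ => id) (fun _ => y)
      (Fin.cons (α := fun i => Term (L.withConstants N.carrier) (fun _ : Fin 1 => s) (L.ext s Γ i))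
      (.var (L := L.withConstants N.carrier) (Γ := fun _ : Fin 1 => s) 0)
      (fun i => .const (L := L.withConstants N.carrier) (.inr (v i))) i)) = N.extVal y v := by
    funext i
    refine Fin.cases rfl (fun i => rfl) i
  constructor
  · rintro hy _ rfl
    refine h.2 ?_
    exact (congrArg (φ.Realize N) hv).mpr hy
  · intro hy
    exact (congrArg (φ.Realize N) hv).mp (h.1 (hy ψ rfl))

/-- If `M` maps to a structure `N` with compact balls, then every local structure in which `M` is
positively embedded maps to `N`. -/
theorem exists_hom_of_hasCompactBalls {M P N : Structure L.toLang} (hP : P.IsLocal L)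
    {f : Hom M P} (hf : f.IsPositiveEmbedding) (g : Hom M N) (hN : N.HasCompactBalls) :
    Nonempty (Hom P N) := by
  classical
  -- A name `(p, n)` proposes the value `n` for `p`. A set of names is good if any finitely many
  -- facts true in `P` can be realized in `N` while finitely many proposals of the set are
  -- respected.
  let E : L.Srt → Type u := fun s => P.carrier s × N.carrier s
  let Good : Set (Σ s, E s) → Prop := fun G => ∀ Φ : List (LPFact L.toLang E),
    (∀ F ∈ Φ, F.Holds P fun _ => Prod.fst) → ∀ l : List (Σ s, E s), (∀ e ∈ l, e ∈ G) →
      ∃ q : ∀ s, E s → N.carrier s, (∀ F ∈ Φ, F.Holds N q) ∧ ∀ e ∈ l, q e.1 e.2 = e.2.2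
  let nm : ∀ s, M.carrier s → Σ s, E s := fun s m => ⟨s, (f.toFun s m, g.toFun s m)⟩
  let G₀ : Set (Σ s, E s) := {e | ∃ m, nm e.1 m = e}
  have hG₀ : Good G₀ := by
    intro Φ hΦ l hl
    let mo : ∀ e : Σ s, E s, M.carrier e.1 := fun e =>
      if h : ∃ m, nm e.1 m = e then h.choose else (M.nonempty _).some
    have hmo : ∀ e ∈ l, nm e.1 (mo e) = e := by
      intro e he
      have h : ∃ m, nm e.1 m = e := hl e he
      simp only [mo]
      rw [dif_pos h]
      exact h.choose_spec
    obtain ⟨q, hq⟩ := exists_holds_of_transfer (fun _ => hP.local_) f.toFun g.toFun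
      (fun F hF => LPFact.Holds.hom (F := F) (q := fun _ => id)
        (hf _ F.isLocalPositive.isPositive _ hF) g)
      (K := E) (fun _ => Prod.fst)
      -- The added equalities tie each name of `l` to an element of `M`, which the transfer sends to
      -- the proposed value.
      (Φ.map (fun F => F.map fun _ => .inr) ++
        l.map fun e => LPFact.loc 1 (.inr e.2) (.inl (mo e))) (by
        intro F hF
        rcases List.mem_append.1 hF with hF | hF
        · obtain ⟨F', hF', rfl⟩ := List.mem_map.1 hF
          exact hΦ F' hF'
        · obtain ⟨e, he, rfl⟩ := List.mem_map.1 hF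
          rw [LPFact.holds_loc, P.loc_one]
          exact (congrArg (fun e : Σ s, E s => (⟨e.1, e.2.1⟩ : Σ s, P.carrier s)) (hmo e he)
            |> fun h => (eq_of_heq (Sigma.mk.inj_iff.1 h).2).symm))
    refine ⟨q, fun F hF => hq _ (List.mem_append_left _ (List.mem_map.2 ⟨F, hF, rfl⟩)),
      fun e he => ?_⟩
    have := hq _ (List.mem_append_right _ (List.mem_map.2 ⟨e, he, rfl⟩))
    rw [LPFact.holds_loc, N.loc_one] at this
    refine this.trans ?_
    exact (congrArg (fun e : Σ s, E s => (⟨e.1, e.2.2⟩ : Σ s, N.carrier s)) (hmo e he)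
      |> fun h => eq_of_heq (Sigma.mk.inj_iff.1 h).2)
  obtain ⟨G, hG₀G, hG⟩ := zorn_subset_nonempty {G | Good G} (by
    intro c hc hchain hne
    refine ⟨⋃₀ c, fun Φ hΦ l hl => ?_, fun G hG => Set.subset_sUnion_of_mem hG⟩
    have : ∃ G ∈ c, ∀ e ∈ l, e ∈ G := by
      induction l with
      | nil => exact ⟨_, hne.some_mem, by simp⟩
      | cons e l ih =>
        obtain ⟨G, hG, h⟩ := ih fun e' he' => hl e' (List.mem_cons_of_mem _ he')
        obtain ⟨G', hG', he⟩ := hl e List.mem_cons_self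
        obtain ⟨H, hH, h1, h2⟩ := hchain.directedOn G hG G' hG'
        refine ⟨H, hH, fun e' he' => ?_⟩
        rcases List.mem_cons.1 he' with rfl | he'
        · exact h2 he
        · exact h1 (h e' he')
    obtain ⟨G, hGc, hG⟩ := this
    exact hc hGc Φ hΦ l hG) G₀ hG₀
  have htotal : ∀ s (b : P.carrier s), ∃ n, (⟨s, (b, n)⟩ : Σ s, E s) ∈ G := by
    intro s b
    by_contra! hb
    obtain ⟨m⟩ := M.nonempty s
    obtain ⟨d, hd⟩ := hP.local_ (f.toFun s m) b
    let _ := N.logicTopology s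
    let e₀ : Σ s, E s := ⟨s, (b, (N.nonempty s).some)⟩
    -- These are the local positive conditions satisfied by `b` over the names of `G`. Each one
    -- becomes a closed set in `N`; goodness of `G` yields the finite intersection property inside
    -- the ball.
    let ι := {x : Σ l : List (Σ s, E s), Formula L.toLang (L.ext s (lctx l)) //
      (∀ e ∈ x.1, e ∈ G) ∧ x.2.IsLocalPositive ∧
        x.2.Realize P (P.extVal b (lval (fun _ => Prod.fst) x.1))}
    obtain ⟨y, hyb, hy⟩ := (hN s d (g.toFun s m)).inter_iInter_nonempty
      (fun x : ι => {y | x.1.2.Realize N (N.extVal y (lval (fun _ => Prod.snd) x.1.1))})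
      (fun x => Structure.isClosed_realize x.2.2.1 _) (by
        intro u
        obtain ⟨q, hq, hql⟩ := hG.prop
          (LPFact.loc d (nm s m).2 e₀.2 :: u.toList.map fun x : ι =>
            ⟨x.1.2, x.2.2.1, lname (e₀ :: x.1.1)⟩)
          (by
            intro F hF
            rcases List.mem_cons.1 hF with rfl | hF
            · exact hd
            · obtain ⟨x, hx, rfl⟩ := List.mem_map.1 hF
              exact (congrArg (Formula.Realize P x.1.2)
                (lval_cons P (fun _ => Prod.fst) e₀ x.1.1)).mpr x.2.2.2)
          (nm s m :: u.toList.flatMap fun x : ι => x.1.1)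
          (by
            intro e he
            rcases List.mem_cons.1 he with rfl | he
            · exact hG₀G ⟨m, rfl⟩
            · obtain ⟨x, hx, he⟩ := List.mem_flatMap.1 he
              exact x.2.1 e he)
        refine ⟨q s e₀.2, ?_, Set.mem_iInter₂.2 fun x hx => ?_⟩
        · have h1 := hq _ List.mem_cons_self
          rw [LPFact.holds_loc, hql _ List.mem_cons_self] at h1
          exact h1
        · have h1 := hq _ (List.mem_cons_of_mem _
            (List.mem_map.2 ⟨x, Finset.mem_toList.2 hx, rfl⟩))
          have h2 : lval q (e₀ :: x.1.1) =
              N.extVal (q s e₀.2) (lval (fun _ => Prod.snd) x.1.1) := by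
            rw [lval_cons]
            congr 1
            exact lval_congr fun e he => hql e (List.mem_cons_of_mem _
              (List.mem_flatMap.2 ⟨x, Finset.mem_toList.2 hx, he⟩))
          exact (congrArg (Formula.Realize N x.1.2) h2).mp h1)
    let e₁ : Σ s, E s := ⟨s, (b, y)⟩
    refine hb y (hG.le_of_ge (y := insert e₁ G) (fun Φ hΦ l hl => ?_) (Set.subset_insert _ _)
      (Set.mem_insert _ _))
    -- Besides the proposals to respect, `l₀` holds a name from `M` on each sort occurring in `Φ`,
    -- to bound the names that are quantified away.
    let l₀ : List (Σ s, E s) := l.filter (fun e => e ∈ G) ++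
      Φ.flatMap fun F => List.ofFn fun i => nm (F.Γ i) (M.nonempty (F.Γ i)).some
    have hl₀ : ∀ e ∈ l₀, e ∈ G := by
      intro e he
      rcases List.mem_append.1 he with he | he
      · simpa using (List.mem_filter.1 he).2
      · obtain ⟨F, hF, he⟩ := List.mem_flatMap.1 he
        obtain ⟨i, rfl⟩ := (List.mem_ofFn' _ _).1 he
        exact hG₀G ⟨_, rfl⟩
    obtain ⟨ψ, hψ, hψP, hψN⟩ := exists_formula_of_facts P (fun _ => Prod.fst) (e₁ :: l₀)
      -- The trivial equality makes the list nonempty.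
      (LPFact.loc 1 e₁.2 e₁.2 :: Φ) (List.cons_ne_nil _ _)
      (by
        intro F hF
        rcases List.mem_cons.1 hF with rfl | hF
        · exact (P.loc_one _ _).2 rfl
        · exact hΦ F hF)
      (by
        intro F hF
        rcases List.mem_cons.1 hF with rfl | hF
        · have h : ∀ i : Fin 2, ∃ (t : Term L.toLang (lctx (e₁ :: l₀)) s),
              P.loc 1 b (t.value P (lval (fun _ => Prod.fst) (e₁ :: l₀))) := by
            intro i
            obtain ⟨t, ht⟩ := exists_lookup (L := L.toLang) (l := e₁ :: l₀) List.mem_cons_self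
            exact ⟨t, by rw [ht, P.loc_one]⟩
          intro i
          refine Fin.cases ?_ (fun i => Fin.cases ?_ (fun i => i.elim0) i) i
          · obtain ⟨t, ht⟩ := h 0
            exact ⟨t, 1, ht⟩
          · obtain ⟨t, ht⟩ := h 0
            exact ⟨t, 1, ht⟩
        · intro i
          obtain ⟨t, ht⟩ := exists_lookup (L := L.toLang) (l := e₁ :: l₀)
            (e := nm (F.Γ i) (M.nonempty (F.Γ i)).some)
            (List.mem_cons_of_mem _ (List.mem_append_right _
              (List.mem_flatMap.2 ⟨F, hF, (List.mem_ofFn' _ _).2 ⟨i, rfl⟩⟩)))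
          obtain ⟨d, hd⟩ := hP.local_ (F.e i).1
            (f.toFun (F.Γ i) (M.nonempty (F.Γ i)).some)
          exact ⟨t, d, by rw [ht]; exact hd⟩)
    have hyψ := Set.mem_iInter.1 hy ⟨⟨l₀, ψ⟩, hl₀, hψ,
      (lval_cons P (fun _ => Prod.fst) e₁ l₀) ▸ hψP⟩
    obtain ⟨q, hq, hqΦ⟩ := hψN N (fun _ => Prod.snd)
      ((lval_cons N (fun _ => Prod.snd) e₁ l₀) ▸ hyψ)
    refine ⟨q, fun F hF => hqΦ F (List.mem_cons_of_mem _ hF), fun e he => hq e ?_⟩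
    rcases hl e he with rfl | h
    · exact List.mem_cons_self
    · exact List.mem_cons_of_mem _ (List.mem_append_left _ (List.mem_filter.2 ⟨he, by simpa using h⟩))
  choose k hk using htotal
  have key : ∀ F : LPFact L.toLang P.carrier, F.Holds P (fun _ => id) → F.Holds N k := by
    intro F hF
    obtain ⟨q, hq, hql⟩ := hG.prop [F.map fun s a => (a, k s a)] (by
        intro F' hF'
        rw [List.mem_singleton] at hF'
        subst hF'
        exact hF)
      (List.ofFn fun i => ⟨F.Γ i, (F.e i, k _ (F.e i))⟩) (by
        intro e he
        obtain ⟨i, rfl⟩ := (List.mem_ofFn' _ _).1 he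
        exact hk _ _)
    have h1 := hq _ List.mem_cons_self
    rw [LPFact.holds_map] at h1
    unfold LPFact.Holds at h1 ⊢
    convert h1 using 2 with i
    exact (hql _ ((List.mem_ofFn' _ _).2 ⟨i, rfl⟩)).symm
  exact ⟨⟨k, fun c => (LPFact.holds_const _ c N k).1
      (key (.const (P.const c) c) ((LPFact.holds_const _ _ _ _).2 rfl)),
    fun R a h => key (.rel R a) h, fun d a b h => key (.loc d a b) h⟩⟩

end CompactBalls

/-! ### The negative theory with parameters -/

section Parameters

variable {L : LocalLang.{u}} {M : Structure L.toLang}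

/-- The negative theory with parameters of a local structure. -/
abbrev elementTheory (hM : M.IsLocal L) (β : ElementBounds L M) : NegTheory (L.withElements M β) :=
  Structure.negTheory (L := L.withElements M β) M.withElements (hM.withElements β)

/-- Positive embeddings of `M` give models of the negative theory with parameters in `M`. -/
theorem elementTheory_isModel_expand (hM : M.IsLocal L) (β : ElementBounds L M)
    {N : Structure L.toLang} (hN : N.IsLocal L) {f : Hom M N} (hf : f.IsPositiveEmbedding) :
    (elementTheory hM β).IsModel (N.expand f.toFun) := by
  refine ⟨⟨hN.symm, hN.mono, hN.comp, fun {s} c₁ c₂ => ?_, hN.local_⟩, ?_⟩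
  · have h := f.map_loc _ _ _ (β.holds c₁ c₂)
    have hc : ∀ c : L.Const s ⊕ M.carrier s,
        f.toFun s (Sum.elim M.const id c) = Sum.elim N.const (f.toFun s) c := by
      rintro (c | c)
      · exact f.map_const c
      · rfl
    exact (congrArg₂ (N.loc _) (hc c₁) (hc c₂)).mp h
  · rintro σ ⟨⟨φ, hφ, rfl⟩, hσ⟩ h
    exact hσ ((hf.isStrongEmbedding hM hN).2 M.carrier (fun _ => id) φ hφ _
      ((congrArg (φ.Realize (N.expand f.toFun)) (funext fun i => i.elim0)).mp h))

/-- Finitely many facts which hold in a model of the negative theory with parameters in `M` are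
realized in `M`. -/
theorem exists_holds_withElements {hM : M.IsLocal L} {β : ElementBounds L M}
    {N : Structure (L.withElements M β).toLang} (hN : (elementTheory hM β).IsModel N)
    {E : L.Srt → Type u} (b : ∀ s, E s → N.carrier s)
    {Φ : Set (LPFact (L.withElements M β).toLang E)} (hfin : Φ.Finite)
    (hΦ : ∀ F ∈ Φ, F.Holds N b) :
    ∃ q : ∀ s, E s → M.carrier s, ∀ F ∈ Φ, F.Holds M.withElements q := by
  let q₀ : ∀ s, E s → M.carrier s := fun s _ => (M.nonempty s).some
  by_cases hne : hfin.toFinset.toList = []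
  · refine ⟨q₀, fun F hF => ?_⟩
    rw [← hfin.mem_toFinset, ← Finset.mem_toList, hne] at hF
    simp at hF
  have hmem : ∀ F, F ∈ hfin.toFinset.toList ↔ F ∈ Φ := fun F => by simp
  -- In `L(M)` every sort has a constant that bounds the names, so all of them can be quantified
  -- away. If the resulting sentence failed in `M`, its negation would belong to the theory.
  obtain ⟨ψ, hψ, hψN, hψC⟩ := exists_formula_of_facts N b [] hfin.toFinset.toList hne
    (fun F hF => hΦ F ((hmem F).1 hF)) (by
      intro F _ i
      let t : Term (L.withElements M β).toLang (lctx (E := E) []) (F.Γ i) :=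
        .const (Sum.inr (M.nonempty (F.Γ i)).some)
      obtain ⟨d, hd⟩ := hN.1.local_ (b _ (F.e i)) (t.value N (lval b []))
      exact ⟨t, d, hd⟩)
  have hM' : ψ.Realize M.withElements (lval q₀ []) := by
    by_contra hn
    exact hN.2 (.neg ψ) ⟨⟨ψ, hψ.isPositive, rfl⟩, fun h => hn
      ((congrArg (ψ.Realize M.withElements) (funext fun i => i.elim0)).mp h)⟩
      ((congrArg (ψ.Realize N) (funext fun i => i.elim0)).mp hψN)
  obtain ⟨q, -, hq⟩ := hψC M.withElements q₀ hM'
  exact ⟨q, fun F hF => hq F ((hmem F).2 hF)⟩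

theorem Structure.map_cast {L : Lang.{u}} {N N' : L.Srt → Type u} (q : ∀ s, N s → N' s)
    {s r : L.Srt} (h : s = r) (a : N r) :
    q s (cast (congrArg N h.symm) a) = cast (congrArg N' h.symm) (q r a) := by
  subst h; rfl

/-- The failure of local positive compactness for one formula is witnessed in `M`. -/
theorem exists_family_withElements {hM : M.IsLocal L} {β : ElementBounds L M}
    {N : Structure (L.withElements M β).toLang} (hN : (elementTheory hM β).IsModel N)
    {s : L.Srt} {n : ℕ} {Γ : Fin n → L.Srt}
    {φ : Formula (L.withElements M β).toLang (L.ext s (L.ext s Γ))} (hφ : φ.IsLocalPositive)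
    (B : Bound (L.withElements M β).toLang (L.ext s Γ)) (d : L.Loc s) {k : ℕ} (hk : 2 ≤ k)
    (x : Fin k → N.carrier s) (z : ∀ i, N.carrier (Γ i))
    (h : ∀ i j, i ≠ j → B.Realize N (N.extVal (x i) z) ∧ N.loc d (x i) (x j) ∧
      φ.Realize N (N.extVal (x i) (N.extVal (x j) z))) :
    ∃ (x : Fin k → M.carrier s) (z : ∀ i, M.carrier (Γ i)), ∀ i j, i ≠ j →
      B.Realize M.withElements (M.extVal (x i) z) ∧ M.loc d (x i) (x j) ∧
        φ.Realize M.withElements (M.extVal (x i) (M.extVal (x j) z)) := by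
  -- The bound is only asserted for pairs of distinct indices, hence the requirement of at least two
  -- of them.
  have hB : ∀ i, B.Realize N (N.extVal (x i) z) := by
    intro i
    have : Nontrivial (Fin k) := Fin.nontrivial_iff_two_le.2 hk
    obtain ⟨j, hj⟩ := exists_ne i
    exact (h i j hj.symm).1
  have hne : ∀ r, Nonempty ((L.withElements M β).Const r) := fun r =>
    (M.nonempty r).map Sum.inr
  let f₁ : {p : Fin k × Fin k // p.1 ≠ p.2} → LPFact (L.withElements M β).toLang N.carrier :=
    fun p => ⟨φ, hφ, N.extVal (x p.1.1) (N.extVal (x p.1.2) z)⟩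
  let f₂ : {p : Fin k × Fin k // p.1 ≠ p.2} → LPFact (L.withElements M β).toLang N.carrier :=
    fun p => .loc d (x p.1.1) (x p.1.2)
  let f₃ : Fin k × Fin (n + 1) → LPFact (L.withElements M β).toLang N.carrier := fun p =>
    .locConst (B.base p.2 (hne _)).2 (N.extVal (x p.1) z p.2) (B.base p.2 (hne _)).1
  let f₄ : Fin k × {p : Fin (n + 1) × Fin (n + 1) // L.ext s Γ p.1 = L.ext s Γ p.2} →
      LPFact (L.withElements M β).toLang N.carrier := fun p =>
    .loc (B.pair p.2.1.1 p.2.1.2 p.2.2) (N.extVal (x p.1) z p.2.1.1)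
      (cast (congrArg N.carrier p.2.2.symm) (N.extVal (x p.1) z p.2.1.2))
  obtain ⟨q, hq⟩ := exists_holds_withElements hN (fun _ => id)
    (Φ := ((Set.range f₁ ∪ Set.range f₂) ∪ Set.range f₃) ∪ Set.range f₄)
    ((((Set.finite_range _).union (Set.finite_range _)).union (Set.finite_range _)).union
      (Set.finite_range _)) (by
    rintro F (((⟨p, rfl⟩ | ⟨p, rfl⟩) | ⟨p, rfl⟩) | ⟨p, rfl⟩)
    · exact (h _ _ p.2).2.2
    · exact (h _ _ p.2).2.1
    · exact (hB p.1).1 p.2 (hne _)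
    · exact (hB p.1).2 _ _ p.2.2)
  have hval : ∀ i, M.extVal (q s (x i)) (fun j => q _ (z j)) =
      fun j => q _ (N.extVal (x i) z j) := fun i =>
    (Structure.extVal_map (M := N) (N := M.withElements) q (x i) z).symm
  refine ⟨fun i => q s (x i), fun i => q _ (z i), fun i j hij => ⟨⟨fun a ha => ?_,
    fun a b hab => ?_⟩, ?_, ?_⟩⟩
  · rw [hval]
    exact hq _ (Or.inl (Or.inr ⟨(i, a), rfl⟩))
  · rw [hval]
    have := hq _ (Or.inr ⟨(i, ⟨(a, b), hab⟩), rfl⟩)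
    have hc := Structure.map_cast (L := (L.withElements M β).toLang) q hab (N.extVal (x i) z b)
    exact (congrArg (M.loc _ _) hc).mp this
  · exact hq _ (Or.inl (Or.inl (Or.inr ⟨⟨(i, j), hij⟩, rfl⟩)))
  · have := hq _ (Or.inl (Or.inl (Or.inl ⟨⟨(i, j), hij⟩, rfl⟩)))
    have h2 := Structure.extVal_map (M := N) (N := M.withElements) q (x i) (N.extVal (x j) z)
    rw [← hval j] at h2
    exact (congrArg (φ.Realize M.withElements) h2).mp this

open Cardinal Filter in
/-- Boundedness of the class of compatible positively closed models implies local positive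
compactness. -/
theorem isLocallyPositivelyCompact_of_isBoundedClass {T : NegTheory L} (hM : T.IsPCModel M)
    (β : ElementBounds L M) (hb : NegTheory.IsBoundedClass (T.ComPC M)) :
    (elementTheory hM.1.1 β).IsLocallyPositivelyCompact := by
  classical
  intro s n Γ φ hφ hden B d
  by_contra! hk
  obtain ⟨κ, hκ⟩ := hb
  let J : Type u := (Order.succ (max ℵ₀ κ)).out
  have hJ : max ℵ₀ κ < #J := by rw [mk_out]; exact Order.lt_succ _
  have : Nontrivial J := by
    rw [← one_lt_iff_nontrivial]
    exact one_lt_aleph0.trans ((le_max_left _ _).trans_lt hJ)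
  let R : M.carrier s → M.carrier s → (∀ i, M.carrier (Γ i)) → Prop := fun a b z =>
    B.Realize M.withElements (M.extVal a z) ∧ M.loc d a b ∧
        φ.Realize M.withElements (M.extVal a (M.extVal b z))
  let X : Type u := (J → M.carrier s) × ∀ i, M.carrier (Γ i)
  obtain ⟨U, hU⟩ := exists_ultrafilter_of_finite
    (fun p : {p : J × J // p.1 ≠ p.2} => {w : X | R (w.1 p.1.1) (w.1 p.1.2) w.2}) (by
    intro t
    let J₀ : Finset J := t.image (fun p => p.1.1) ∪ t.image fun p => p.1.2
    -- The two extra indices ensure a family of at least two elements, as needed to move it into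
    -- `M`.
    obtain ⟨N, hN, x, z, h⟩ := hk (J₀.card + 2) (by omega)
    obtain ⟨x, z, h⟩ := exists_family_withElements hN hφ B d (by omega) x z h
    refine ⟨⟨fun j => if hj : j ∈ J₀ then x (Fin.castAdd 2 (J₀.equivFin ⟨j, hj⟩)) else
      (M.nonempty s).some, z⟩, fun p hp => ?_⟩
    have h1 : p.1.1 ∈ J₀ := Finset.mem_union_left _ (Finset.mem_image.2 ⟨p, hp, rfl⟩)
    have h2 : p.1.2 ∈ J₀ := Finset.mem_union_right _ (Finset.mem_image.2 ⟨p, hp, rfl⟩)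
    simp only [Set.mem_ofPred_eq, dif_pos h1, dif_pos h2]
    refine h _ _ fun he => p.2 ?_
    simpa using he)
  have hR : ∀ i j, i ≠ j → ∀ᶠ w : X in (U : Filter X), R (w.1 i) (w.1 j) w.2 := fun i j hij =>
    hU ⟨(i, j), hij⟩
  have hne : ∀ r, Nonempty ((L.withElements M β).Const r) := fun r =>
    (M.nonempty r).map Sum.inr
  let p : X → Hom M M := fun _ => Hom.id M
  -- All sorts of `L(M)` have constants, so the bound `B` keeps each coordinate near a fixed element
  -- of `M`. This makes the families elements of the local ultrapower.
  let y : J → BoundedFamily U (expandHom p (A := M.carrier) fun _ => id) s := fun j =>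
    ⟨fun w => w.1 j, (B.base 0 (hne _)).2, M.withElements.const (B.base 0 (hne _)).1, by
      obtain ⟨i, hi⟩ := exists_ne j
      exact (hR j i hi.symm).mono fun w hw => hw.1.1 0 (hne _)⟩
  let z : ∀ i, BoundedFamily U (expandHom p (A := M.carrier) fun _ => id) (Γ i) := fun i =>
    ⟨fun w => w.2 i, (B.base i.succ (hne _)).2, M.withElements.const (B.base i.succ (hne _)).1, by
      obtain ⟨a, b, hab⟩ := exists_pair_ne J
      exact (hR a b hab).mono fun w hw => hw.1.1 i.succ (hne _)⟩
  have hφU : ∀ i j, i ≠ j →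
      φ.Realize (localUltraproduct U (expandHom p (A := M.carrier) fun _ => id))
        ((localUltraproduct U (expandHom p (A := M.carrier) fun _ => id)).extVal (y i).mk
        ((localUltraproduct U (expandHom p (A := M.carrier) fun _ => id)).extVal (y j).mk
          fun a => (z a).mk)) := by
    intro i j hij
    obtain ⟨z₁, hz₁, hz₁'⟩ := extVal_mk (y j) z
    obtain ⟨z₂, hz₂, hz₂'⟩ := extVal_mk (y i) z₁
    refine (congrArg (φ.Realize _) ((congrArg (Structure.extVal _ (y i).mk) hz₁).trans hz₂)).mpr
      (hφ.realize_of_eventually (U := U) (p := expandHom p fun _ => id)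
        (fun _ => hM.1.1.comp) z₂ ((hR i j hij).mono fun w hw => ?_))
    exact (congrArg (φ.Realize M.withElements) ((hz₂' w).trans
      (congrArg (M.withElements.extVal (w.1 i)) (hz₁' w)))).mpr hw.2.2
  obtain ⟨Q, hQ, -, ⟨r⟩⟩ := exists_pc_ultrahomogeneous
    (localUltraproduct_isModel (T := T) (U := U) (p := p) hM.1.1 fun _ => hM.1)
    (le_refl L.toLang.card)
  let f : Hom M Q := r.comp (diagHom U p)
  have hf : f.IsPositiveEmbedding := hM.2 Q hQ.1 f
  have hQM := elementTheory_isModel_expand hM.1.1 β hQ.1.1 hf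
  let g : Hom (localUltraproduct U (expandHom p (A := M.carrier) fun _ => id))
      (Q.expand f.toFun) :=
    (r.expand (A := M.carrier) (fun s a => (diagHom U p).toFun s a) f.toFun
      fun _ _ => rfl).comp (localUltraproductExpand U p (A := M.carrier) fun _ => id)
  -- The formula survives the homomorphism `g`, and its target is a model of the theory in which the
  -- formula denies equality.
  have hinj : Function.Injective fun j => g.toFun s (y j).mk := by
    intro i j hij
    by_contra hne
    have h := g.realize hφ.isPositive _ (hφU i j hne)
    refine hden _ hQM _ _ ⟨⟨fun a => g.toFun _ (z a).mk, ?_⟩, hij⟩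
    exact (congrArg (φ.Realize (Q.expand f.toFun)) ((Structure.extVal_map g.toFun _ _).trans
      (congrArg (Structure.extVal _ _) (Structure.extVal_map g.toFun _ _)))).mp h
  have h1 : #J ≤ Q.card := (mk_le_of_injective hinj).trans (Q.mk_carrier_le s)
  have h2 : Q.card ≤ κ := hκ Q ⟨hQ, Q, hQ.1, ⟨f⟩, ⟨Hom.id Q⟩⟩
  exact (h1.trans h2).not_gt ((le_max_right _ _).trans_lt hJ)

end Parameters

/-! ### Separating elements by formulas that deny equality -/

section Denial

/-- A fact with some names replaced by new constants. -/
theorem LPFact.exists_withConstants {L : Lang.{u}} {A V : L.Srt → Type u}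
    (F : LPFact L fun s => V s ⊕ A s) (hV : ∀ s, Nonempty (V s)) :
    ∃ F' : LPFact (L.withConstants A) V, ∀ (N : Structure L) (e : ∀ s, A s → N.carrier s)
      (q : ∀ s, V s → N.carrier s),
      F'.Holds (N.expand e) q ↔ F.Holds N fun s => Sum.elim (q s) (e s) := by
  obtain ⟨ψ, hψ, hψ'⟩ := F.isLocalPositive.exists_rename_withConstants (A := A) (Γ' := F.Γ)
    fun i => (F.e i).elim (fun _ => .var (L := L.withConstants A) (Γ := F.Γ) i)
      fun a => .const (L := L.withConstants A) (.inr a)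
  refine ⟨⟨ψ, hψ, fun i => (F.e i).elim id fun _ => (hV _).some⟩, fun N e q => ?_⟩
  refine (hψ' N e _).trans (iff_of_eq (congrArg (F.φ.Realize N) (funext fun i => ?_)))
  change Term.value (N.expand e) (fun i => q _ ((F.e i).elim id fun _ => (hV _).some))
    ((F.e i).elim _ _) = Sum.elim (q _) (e _) (F.e i)
  cases h : F.e i with
  | inl v =>
    change q _ ((F.e i).elim id fun _ => (hV _).some) = q _ v
    rw [h]; rfl
  | inr a => rfl

variable {L : LocalLang.{u}} {M : Structure L.toLang} {T : NegTheory L}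

/-- Distinct elements of a positively closed extension of `M` are separated by a formula with
parameters in `M` which denies equality. -/
theorem exists_denying_formula (hM : T.IsModel M) (β : ElementBounds L M)
    {P : Structure L.toLang} (hP : T.IsPCModel P) (f : Hom M P) {s : L.Srt} {a b : P.carrier s}
    (hab : a ≠ b) :
    ∃ φ : Formula (L.toLang.withElements M)
        ((L.toLang.withElements M).ext s ((L.toLang.withElements M).ext s Fin.elim0)),
      φ.IsLocalPositive ∧
      φ.Realize (P.expand f.toFun) (P.extVal a (P.extVal b fun i => i.elim0)) ∧
      ∀ N : Structure (L.withElements M β).toLang, (elementTheory hM.1 β).IsModel N →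
        ∀ x : N.carrier s, ¬ φ.Realize N (N.extVal x (N.extVal x fun i => i.elim0)) := by
  classical
  by_contra! hcon
  -- If no formula separates `a` and `b`, the diagram of `P` over `M` together with `a = b` is
  -- finitely satisfiable in `M`. A realization is a homomorphism from `P` that identifies `a` and
  -- `b`, against positive closedness.
  obtain ⟨D, ι, hD, -, hreal⟩ := exists_realization hM P.carrier
  let Φ₀ : Set (LPFact L.toLang fun s => P.carrier s ⊕ M.carrier s) :=
    {F | F.Holds P fun s => Sum.elim id (f.toFun s)}
  let F₀ : LPFact L.toLang fun s => P.carrier s ⊕ M.carrier s := .loc 1 (.inl a) (.inl b)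
  obtain ⟨h, hh⟩ := hreal (insert F₀ Φ₀) (by
    intro l hl
    choose F' hF' using fun F : LPFact L.toLang fun s => P.carrier s ⊕ M.carrier s =>
      F.exists_withConstants P.nonempty
    let l' := (LPFact.loc (L := L.toLang) 1 (.inl a) (.inl a) :: l.filter fun F => F ∈ Φ₀).map F'
    obtain ⟨ψ, hψ, hψP, hψC⟩ := exists_formula_of_facts (P.expand f.toFun) (fun _ => id)
      [⟨s, a⟩, ⟨s, b⟩] l' (List.cons_ne_nil _ _) (by
        intro G hG
        obtain ⟨F, hF, rfl⟩ := List.mem_map.1 hG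
        refine (hF' F P f.toFun fun _ => id).2 ?_
        rcases List.mem_cons.1 hF with rfl | hF
        · exact (LPFact.holds_loc _ _ _ _ _).2 ((P.loc_one _ _).2 rfl)
        · exact of_decide_eq_true (List.mem_filter.1 hF).2) (by
        intro G _ i
        obtain ⟨m⟩ := M.nonempty (G.Γ i)
        obtain ⟨d, hd⟩ := hP.1.1.local_ (G.e i) (f.toFun _ m)
        exact ⟨.const (L := L.toLang.withConstants M.carrier) (.inr m), d, hd⟩)
    -- The formula `ψ` collects the facts with all names but `a` and `b` quantified away. As it does
    -- not deny equality, some `x` satisfies it on the diagonal, and so does an element of `M`.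
    obtain ⟨N, hN, x, hx⟩ := hcon ψ hψ ((congrArg (ψ.Realize (P.expand f.toFun))
      ((lval_cons (P.expand f.toFun) _ _ _).trans (congrArg (Structure.extVal _ _)
        ((lval_cons (P.expand f.toFun) _ _ _).trans (congrArg (Structure.extVal _ _)
          (funext fun i => i.elim0)))))).mp hψP)
    obtain ⟨q, hq⟩ := exists_holds_withElements hN (fun _ => id)
      (Φ := {⟨ψ, hψ, N.extVal x (N.extVal x fun i => i.elim0)⟩}) (Set.finite_singleton _) (by
        rintro F rfl
        exact hx)
    let q₀ : ∀ r, P.carrier r → M.carrier r := fun r _ =>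
      if h : s = r then h ▸ q s x else (M.nonempty r).some
    have hq₀ : ∀ p : P.carrier s, q₀ s p = q s x := fun p => dif_pos rfl
    obtain ⟨q', hq', hqΦ⟩ := hψC (M.expand fun _ => id) q₀
      ((congrArg (ψ.Realize (M.expand fun _ => id)) (funext fun i => by
        refine Fin.cases ?_ (fun i => Fin.cases ?_ (fun i => i.elim0) i) i
        · exact (hq₀ a).symm
        · exact (hq₀ b).symm)).mp (hq _ rfl))
    refine ⟨q', fun F hF => ?_⟩
    rcases hl F hF with rfl | hF0
    · refine (M.loc_one _ _).2 ?_
      exact ((hq' ⟨s, a⟩ (by simp)).trans (hq₀ a)).trans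
        ((hq' ⟨s, b⟩ (by simp)).trans (hq₀ b)).symm
    · exact (hF' F M (fun _ => id) q').1 (hqΦ _ (List.mem_map.2 ⟨F, List.mem_cons_of_mem _
        (List.mem_filter.2 ⟨hF, decide_eq_true hF0⟩), rfl⟩))) (by
    intro r v
    obtain ⟨m⟩ := M.nonempty r
    obtain ⟨d, hd⟩ := hP.1.1.local_ v (f.toFun r m)
    exact ⟨d, m, .loc d (.inl v) (.inr m), Or.inr hd, fun q h => h⟩)
  let g : Hom P D :=
    { toFun := h
      map_const := fun {r} c => (D.loc_one _ _).1 (hh (.const (.inl (P.const c)) c)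
        (Or.inr ((P.loc_one (P.const c) _).2 rfl)))
      map_rel := fun R x hx => hh (.rel R fun i => .inl (x i)) (Or.inr hx)
      map_loc := fun d x y hx => hh (.loc d (.inl x) (.inl y)) (Or.inr hx) }
  exact hab (Hom.IsPositiveEmbedding.injective (hP.2 D hD g) s ((D.loc_one _ _).1 (hh F₀ (Or.inl rfl))))

end Denial

/-! ### Ultrahomogeneous models are retractors -/

section UltrahomogeneousModels

/-- Homomorphisms into the image of a positive embedding lift. -/
theorem Hom.IsPositiveEmbedding.exists_lift {L : Lang.{u}} {A B P : Structure L} {j : Hom B P}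
    (hj : j.IsPositiveEmbedding) (h : Hom A P)
    (hr : ∀ s (a : A.carrier s), ∃ b, j.toFun s b = h.toFun s a) :
    ∃ g : Hom A B, ∀ s a, j.toFun s (g.toFun s a) = h.toFun s a := by
  choose g hg using hr
  refine ⟨⟨g, fun {s} c => hj.injective s ?_, fun R a ha => (hj.rel_iff R _).1 ?_,
    fun d a b hab => (hj.loc_iff d _ _).1 ?_⟩, hg⟩
  · rw [hg, h.map_const, j.map_const]
  · simpa only [hg] using h.map_rel R a ha
  · simpa only [hg] using h.map_loc d a b hab

open Cardinal

theorem IsStrongEmbedding.expand {L : Lang.{u}} {N N' : Structure L} {f : Hom N N'}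
    (hf : IsStrongEmbedding f) {A : L.Srt → Type u} {e : ∀ s, A s → N.carrier s}
    {e' : ∀ s, A s → N'.carrier s} (h : ∀ s a, f.toFun s (e s a) = e' s a) :
    (f.expand e e' h).IsPositiveEmbedding := by
  obtain rfl : (fun s a => f.toFun s (e s a)) = e' := funext fun s => funext fun a => h s a
  exact hf.2 A e

theorem Lang.card_le_withElements {L : Lang.{u}} (M : Structure L) :
    L.card ≤ (L.withElements M).card := by
  have h : #(Σ s, L.Const s) ≤ #(Σ s, (L.withElements M).Const s) :=
    mk_le_of_injective (f := fun x => ⟨x.1, .inl x.2⟩) (by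
      rintro ⟨s, a⟩ ⟨r, b⟩ h
      obtain ⟨rfl, h⟩ := Sigma.mk.inj_iff.1 h
      exact congrArg _ (Sum.inl_injective (eq_of_heq h)))
  exact add_le_add_left (add_le_add_left (add_le_add_right h _) _) _

theorem Structure.card_le_withElements {L : Lang.{u}} (M : Structure L) :
    M.card ≤ (L.withElements M).card :=
  le_trans (mk_le_of_injective (f := fun x : Σ s, M.carrier s =>
    (⟨x.1, .inr x.2⟩ : Σ s, (L.withElements M).Const s)) (by
      rintro ⟨s, a⟩ ⟨r, b⟩ h
      obtain ⟨rfl, h⟩ := Sigma.mk.inj_iff.1 h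
      exact congrArg _ (Sum.inr_injective (eq_of_heq h)))) Lang.mk_const_le

variable {L : LocalLang.{u}} {M : Structure L.toLang} {T : NegTheory L}

/-- In a ball, the length of the lists whose elements are separated by a formula which denies
equality is bounded. -/
theorem NegTheory.IsLocallyPositivelyCompact.exists_length_lt {hM : M.IsLocal L}
    {β : ElementBounds L M} (h : (elementTheory hM β).IsLocallyPositivelyCompact)
    {N : Structure L.toLang} (hN : N.IsLocal L) {f : Hom M N} (hf : f.IsPositiveEmbedding)
    {s : L.Srt} {φ : Formula (L.toLang.withElements M)
      ((L.toLang.withElements M).ext s ((L.toLang.withElements M).ext s Fin.elim0))}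
    (hφ : φ.IsLocalPositive)
    (hden : ∀ N : Structure (L.withElements M β).toLang, (elementTheory hM β).IsModel N →
      ∀ x : N.carrier s, ¬ φ.Realize N (N.extVal x (N.extVal x fun i => i.elim0)))
    (d : L.Loc s) (m : M.carrier s) :
    ∃ k : ℕ, ∀ F : List (N.carrier s), (∀ n ∈ F, N.loc d n (f.toFun s m)) →
      F.Pairwise (fun x y => φ.Realize (N.expand f.toFun)
        (N.extVal y (N.extVal x fun i => i.elim0))) → F.length < k := by
  let Γ₂ : Fin 2 → (L.toLang.withElements M).Srt :=
    (L.toLang.withElements M).ext s ((L.toLang.withElements M).ext s Fin.elim0)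
  let σ : ∀ i, Term (L.toLang.withElements M) Γ₂ (Γ₂ i) :=
    Fin.cons (α := fun i => Term (L.toLang.withElements M) Γ₂ (Γ₂ i)) (.var (Γ := Γ₂) (Fin.succ 0))
      (Fin.cons (α := fun i => Term (L.toLang.withElements M) Γ₂ (Γ₂ (Fin.succ i)))
        (.var (Γ := Γ₂) 0) fun i => i.elim0)
  -- Compactness asks for the formula in both orders, while a list is separated in one order only.
  -- So it is applied to the disjunction of the formula with its transpose `ψ`.
  obtain ⟨ψ, hψ, hψ'⟩ := hφ.exists_rename σ
  have hswap : ∀ (N : Structure (L.toLang.withElements M)) (x y : N.carrier s) (z),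
      ψ.Realize N (N.extVal x (N.extVal y z)) ↔
        φ.Realize N (N.extVal y (N.extVal x fun i => i.elim0)) := fun N x y z =>
    (hψ' N _).trans (iff_of_eq (congrArg (φ.Realize N) (funext fun i => by
      refine Fin.cases ?_ (fun i => Fin.cases ?_ (fun i => i.elim0) i) i <;> rfl)))
  have hz : ∀ (N : Structure (L.toLang.withElements M)) (x y : N.carrier s)
      (z : ∀ i : Fin 0, N.carrier (Fin.elim0 i)), φ.Realize N (N.extVal x (N.extVal y z)) ↔
        φ.Realize N (N.extVal x (N.extVal y fun i => i.elim0)) := fun N x y z =>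
    iff_of_eq (congrArg (fun z => φ.Realize N (N.extVal x (N.extVal y z)))
      (funext fun i => i.elim0))
  let B : Bound (L.withElements M β).toLang ((L.withElements M β).ext s Fin.elim0) :=
    ⟨fun i => Fin.cases (fun _ => (.inr m, d)) (fun i => i.elim0) i, fun _ _ _ => 1⟩
  obtain ⟨k, -, hk⟩ := h s 0 Fin.elim0 (.or φ ψ) (.or hφ hψ) (by
    rintro N' hN' x y ⟨⟨z, hz' | hz'⟩, rfl⟩
    · exact hden N' hN' x ((hz N' _ _ _).1 hz')
    · exact hden N' hN' x ((hswap N' _ _ _).1 hz')) B (d * d)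
  refine ⟨k, fun F hF hpair => lt_of_not_ge fun hlen => ?_⟩
  refine hk (N.expand f.toFun) (elementTheory_isModel_expand hM β hN hf)
    ⟨fun i => F.get (Fin.castLE hlen i), fun i => i.elim0, fun i j hij => ⟨⟨fun a => ?_,
      fun a b _ => ?_⟩, ?_, ?_⟩⟩
  · refine Fin.cases (fun _ => hF _ (List.get_mem _ _)) (fun a => a.elim0) a
  · obtain rfl : a = b := Subsingleton.elim (α := Fin 1) a b
    exact (N.loc_one _ _).2 rfl
  · exact hN.comp _ _ _ _ _ (hF _ (List.get_mem _ _)) (hN.symm _ _ _ (hF _ (List.get_mem _ _)))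
  · rcases lt_or_gt_of_ne hij with hij | hij
    · exact Or.inr ((hswap _ _ _ _).2 (List.pairwise_iff_get.1 hpair _ _ hij))
    · exact Or.inl (List.pairwise_iff_get.1 hpair _ _ hij)

/-- A property of lists which bounds their lengths has a maximal list. -/
theorem exists_maximal_list {α : Type*} {Q : List α → Prop} (h0 : Q []) {k : ℕ}
    (hk : ∀ F, Q F → F.length < k) : ∃ F, Q F ∧ ∀ a, ¬ Q (a :: F) := by
  by_contra! h
  have key : ∀ n, ∃ F, Q F ∧ F.length = n := by
    intro n
    induction n with
    | zero => exact ⟨[], h0, rfl⟩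
    | succ n ih =>
      obtain ⟨F, hF, rfl⟩ := ih
      obtain ⟨a, ha⟩ := h F hF
      exact ⟨a :: F, ha, rfl⟩
  obtain ⟨F, hF, rfl⟩ := key k
  exact (hk F hF).false

/-- Homomorphisms from a sufficiently ultrahomogeneous positively closed extension of `M` to
positively closed models are surjective. -/
theorem surjective_of_isUltrahomogeneous {hM : T.IsModel M} {β : ElementBounds L M}
    (h : (elementTheory hM.1 β).IsLocallyPositivelyCompact)
    {N : Structure L.toLang} (hN : T.IsPCModel N)
    (hNu : T.IsUltrahomogeneous (Order.succ (L.toLang.withElements M).card) N)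
    {f₀ : Hom M N} (hf₀ : f₀.IsPositiveEmbedding)
    {P : Structure L.toLang} (hP : T.IsPCModel P) (f : Hom N P) (s : L.Srt) :
    Function.Surjective (f.toFun s) := by
  intro c
  obtain ⟨m⟩ := M.nonempty s
  obtain ⟨d, hd⟩ := hP.1.1.local_ c (f.toFun s (f₀.toFun s m))
  let 𝓓 : Type u := {φ : Formula (L.toLang.withElements M)
      ((L.toLang.withElements M).ext s ((L.toLang.withElements M).ext s Fin.elim0)) //
    φ.IsLocalPositive ∧ ∀ N : Structure (L.withElements M β).toLang,
      (elementTheory hM.1 β).IsModel N →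
        ∀ x : N.carrier s, ¬ φ.Realize N (N.extVal x (N.extVal x fun i => i.elim0))}
  -- The lists lie in a ball around `M`, their images are separated from `c`, and each later entry
  -- is separated from the earlier ones. A copy of `c` could thus be added in front.
  let Q : 𝓓 → List (N.carrier s) → Prop := fun φ F =>
    (∀ n ∈ F, N.loc d n (f₀.toFun s m) ∧ φ.1.Realize (P.expand (f.comp f₀).toFun)
      (P.extVal (f.toFun s n) (P.extVal c fun i => i.elim0))) ∧
    F.Pairwise fun x y => φ.1.Realize (N.expand f₀.toFun)
      (N.extVal y (N.extVal x fun i => i.elim0))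
  have hmax : ∀ φ, ∃ F, Q φ F ∧ ∀ a, ¬ Q φ (a :: F) := by
    intro φ
    obtain ⟨k, hk⟩ := h.exists_length_lt hN.1.1 hf₀ φ.2.1 φ.2.2 d m
    exact exists_maximal_list ⟨by simp, .nil⟩ fun F hF => hk F (fun n hn => (hF.1 n hn).1) hF.2
  choose F hQF hmax using hmax
  have h0 := (L.toLang.withElements M).aleph0_le_card
  have hL := Lang.card_le_withElements M
  -- The elements of `M` and of all the maximal lists number at most `|L(M)|`, so they fit into a
  -- structure to which ultrahomogeneity applies.
  let S : (Σ r, M.carrier r) ⊕ (Σ φ : 𝓓, {n // n ∈ F φ}) → Σ r, N.carrier r :=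
    Sum.elim (fun x => ⟨x.1, f₀.toFun x.1 x.2⟩) fun x => ⟨s, x.2.1⟩
  obtain ⟨A, i, hi, hAc, hA⟩ := exists_small_positive_substructure N hL (Set.range S)
    (mk_range_le.trans (mk_sum_le_of_le h0 M.card_le_withElements
      (mk_sigma_le_of_le h0 ((mk_subtype_le _).trans (Lang.mk_formula_le _)) fun φ =>
        (F φ).finite_toSet.countable.le_aleph0.trans h0)))
  obtain ⟨B, j, hj, hBc, hB⟩ := exists_small_positive_substructure P hL
    (insert ⟨s, c⟩ (Set.range fun x : Σ r, A.carrier r =>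
      (⟨x.1, f.toFun x.1 (i.toFun x.1 x.2)⟩ : Σ r, P.carrier r)))
    (mk_insert_le.trans (add_le_of_le h0 (mk_range_le.trans hAc) (one_lt_aleph0.le.trans h0)))
  obtain ⟨g, hg⟩ := hj.exists_lift (f.comp i) fun r a => hB ⟨r, _⟩ (Or.inr ⟨⟨r, a⟩, rfl⟩)
  obtain ⟨c', hc'⟩ := hB ⟨s, c⟩ (Or.inl rfl)
  obtain ⟨k, hk⟩ := hNu.2 A B (hj.isModel hP.1) (Order.lt_succ_iff.2 hAc) (Order.lt_succ_iff.2 hBc)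
    i g hi
  refine ⟨k.toFun s c', ?_⟩
  by_contra hne
  -- The image of the copy differs from `c`, so a formula `φ` separates them. The separation of `c`
  -- from the list for `φ` is reflected to `B` and sent by `k` to `N`, so the copy prolongs that
  -- maximal list.
  obtain ⟨φ, hφ, hφP, hφd⟩ := exists_denying_formula hM β hP (f.comp f₀) hne
  choose a ha using fun r m => hA ⟨r, f₀.toFun r m⟩ ⟨.inl ⟨r, m⟩, rfl⟩
  have hje : ∀ r m, j.toFun r (g.toFun r (a r m)) = (f.comp f₀).toFun r m := fun r m =>
    (hg r _).trans (congrArg (f.toFun r) (ha r m))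
  have hke : ∀ r m, k.toFun r (g.toFun r (a r m)) = f₀.toFun r m := fun r m =>
    (hk r _).symm.trans (ha r m)
  refine hmax ⟨φ, hφ, hφd⟩ (k.toFun s c') ⟨?_, List.pairwise_cons.2 ⟨fun n hn => ?_, (hQF _).2⟩⟩
  · refine List.forall_mem_cons.2 ⟨⟨?_, hφP⟩, (hQF _).1⟩
    rw [← hke]
    refine k.map_loc _ _ _ ((hj.loc_iff _ _ _).1 ?_)
    rw [hje, hc']
    exact hd
  · obtain ⟨b, hb⟩ := hA ⟨s, n⟩ ⟨.inr ⟨⟨φ, hφ, hφd⟩, n, hn⟩, rfl⟩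
    have hjb : j.toFun s (g.toFun s b) = f.toFun s n :=
      (hg s b).trans (congrArg (f.toFun s) hb)
    have hkb : k.toFun s (g.toFun s b) = n := (hk s b).symm.trans hb
    let j' := j.expand (fun r m => g.toFun r (a r m)) _ hje
    let k' := k.expand (fun r m => g.toFun r (a r m)) _ hke
    have hval : ∀ {N : Structure L.toLang} (l : Hom B N) {x y : N.carrier s},
        l.toFun s (g.toFun s b) = x → l.toFun s c' = y →
        (fun i => l.toFun _ (B.extVal (g.toFun s b) (B.extVal c' fun i => i.elim0) i)) =
          N.extVal (Γ := L.ext s Fin.elim0) x (N.extVal y fun i => i.elim0) := by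
      rintro N l _ _ rfl rfl
      funext i
      refine Fin.cases ?_ (fun i => Fin.cases ?_ (fun i => i.elim0) i) i <;> rfl
    have hj' : j'.IsPositiveEmbedding :=
      (hj.isStrongEmbedding (hj.isLocal hP.1.1) hP.1.1).expand hje
    have h1 := hj' φ hφ.isPositive (B.extVal (g.toFun s b) (B.extVal c' fun i => i.elim0))
      ((congrArg (φ.Realize (P.expand (f.comp f₀).toFun)) (hval j hjb hc')).mpr
        ((hQF ⟨φ, hφ, hφd⟩).1 n hn).2)
    exact (congrArg (φ.Realize (N.expand f₀.toFun)) (hval k hkb rfl)).mp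
      (k'.realize hφ.isPositive _ h1)

/-- Sufficiently ultrahomogeneous positively closed extensions of `M` are retractors. -/
theorem isRetractor_of_isUltrahomogeneous {hM : T.IsModel M} {β : ElementBounds L M}
    (h : (elementTheory hM.1 β).IsLocallyPositivelyCompact)
    {N : Structure L.toLang} (hN : T.IsPCModel N)
    (hNu : T.IsUltrahomogeneous (Order.succ (L.toLang.withElements M).card) N)
    {f₀ : Hom M N} (hf₀ : f₀.IsPositiveEmbedding) : T.IsRetractor N := by
  refine ⟨hN.1, fun N' hN' f => ?_⟩
  obtain ⟨P, hP, -, ⟨p⟩⟩ := exists_pc_ultrahomogeneous hN' (le_refl L.toLang.card)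
  -- The map from `N` to a positively closed model above `N'` is a bijective positive embedding, and
  -- its inverse restricts to the retraction.
  obtain ⟨g, hg⟩ := Hom.IsPositiveEmbedding.exists_inverse (hN.2 P hP.1 (p.comp f))
    (surjective_of_isUltrahomogeneous (hM := hM) h hN hNu hf₀ hP (p.comp f))
  exact ⟨g.comp p, hg⟩

end UltrahomogeneousModels

end LocalPositiveLogic

theorem mainTheorem6 (L : LocalPositiveLogic.LocalLang.{u}) (T : LocalPositiveLogic.NegTheory L)
    (M : LocalPositiveLogic.Structure L.toLang) (hM : T.IsPCModel M)
    (β : LocalPositiveLogic.ElementBounds L M) :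
    List.TFAE [
      ∃ N : LocalPositiveLogic.Structure L.toLang,
        T.IsModel N ∧ Nonempty (LocalPositiveLogic.Hom M N) ∧ N.HasCompactBalls,
      ∃ C : LocalPositiveLogic.Structure L.toLang, T.IsRetractor C ∧ T.Compatible M C,
      LocalPositiveLogic.NegTheory.IsBoundedClass (T.ComPC M),
      LocalPositiveLogic.NegTheory.IsLocallyPositivelyCompact
        (LocalPositiveLogic.Structure.negTheory (L := L.withElements M β)
          M.withElements (hM.1.1.withElements β)),
      ∀ N : LocalPositiveLogic.Structure L.toLang,
        T.IsPCModel N →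
        T.IsUltrahomogeneous (Order.succ (L.withElements M β).card) N →
        (∃ f : LocalPositiveLogic.Hom M N, f.IsPositiveEmbedding) →
        T.IsRetractor N] := by
  tfae_have 1 → 3 := by
    rintro ⟨N, hN, ⟨h⟩, hc⟩
    refine ⟨N.card, fun B hB => ?_⟩
    obtain ⟨hB, P, hP, ⟨f⟩, ⟨g⟩⟩ := hB
    obtain ⟨k⟩ := LocalPositiveLogic.exists_hom_of_hasCompactBalls hP.1 (hM.2 P hP f) h hc
    -- Positive closedness of `B` makes its homomorphism to `N` injective.
    exact LocalPositiveLogic.Hom.IsPositiveEmbedding.card_le (hB.2 N hN (k.comp g))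
  tfae_have 3 → 4 := LocalPositiveLogic.isLocallyPositivelyCompact_of_isBoundedClass hM β
  tfae_have 4 → 5 := fun h N hN hNu ⟨_, hf⟩ =>
    LocalPositiveLogic.isRetractor_of_isUltrahomogeneous (hM := hM.1) h hN hNu hf
  tfae_have 5 → 2 := fun h => by
    obtain ⟨N, hN, hNu, ⟨f⟩⟩ := LocalPositiveLogic.exists_pc_ultrahomogeneous hM.1
      (LocalPositiveLogic.Lang.card_le_withElements M)
    exact ⟨N, h N hN hNu ⟨f, hM.2 N hN.1 f⟩, N, hN.1, ⟨f⟩, ⟨.id N⟩⟩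
  tfae_have 2 → 1 := by
    rintro ⟨C, hC, P, hP, ⟨f⟩, ⟨g⟩⟩
    obtain ⟨r, -⟩ := hC.2 P hP g
    exact ⟨C, hC.1, ⟨r.comp f⟩, hC.hasCompactBalls⟩
  tfae_finish
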